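/- Let $N\ge 2$, let $A,B\in\mathbb R$, $C>0$, $\rho>0$, and let $\Omega\subseteq S^{N-1}$ be a subdomain (nonempty connected open subset) of the unit sphere of $\mathbb R^N$. Put $$\mathcal C_\Omega^\rho=\{r\omega:\ \omega\in\Omega,\ r>\rho\}\subset\mathbb R^N,\qquad C_H=\frac{(2-N-A)^2}{4},$$ and let $\lambda_1=\lambda_1(\Omega)\ge 0$ be the principal (smallest) Dirichlet eigenvalue of the Laplace--Beltrami operator $-\Delta_\omega$ on $\Omega$. Consider the equation $$-\nabla\cdot(|x|^A\nabla u)-B|x|^{A-2}u=C|x|^{A-2}u\quad\text{in } G:=\mathcal C_\Omega^\rho. \tag{1}$$ A nonnegative super-solution to (1) is a function $0\le u\in H^1_{loc}(G)$ such that $$\int_G\nabla u\cdot\nabla\varphi\,|x|^A\,dx-B\int_G u\varphi\,|x|^{A-2}\,dx\ \ge\ C\int_G u\varphi\,|x|^{A-2}\,dx$$ for all $0\le\varphi\in H^1_c(G)\cap L^\infty_c(G)$, the set of bounded functions in $H^1(G)$ vanishing a.e. outside a compact subset of $G$. It is called positive if it is strictly positive in the sense that $u^{-1}\in L^\infty_{loc}(G)$.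 No boundary conditions are imposed. Then equation (1) has no positive super-solutions if and only if $B+C>C_H+\lambda_1$. -/

import Mathlib

open MeasureTheory Filter Topology
open scoped ContDiff ENNReal

noncomputable section

/-- The Euclidean space `ℝ^N`. -/
abbrev Euc (N : ℕ) : Type := EuclideanSpace ℝ (Fin N)

/-- The unit sphere `S^{N-1}` of `ℝ^N`. -/
abbrev UnitSphere (N : ℕ) : Type := Metric.sphere (0 : Euc N) 1

/-- The cone-like domain `{(r, ω) : ω ∈ Ω, r > ρ}`. -/
def coneLike {N : ℕ} (Ω : Set (UnitSphere N)) (ρ : ℝ) : Set (Euc N) :=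
  {x | ρ < ‖x‖ ∧ ∃ θ ∈ Ω, x = ‖x‖ • (θ : Euc N)}

/-! ### The Dirichlet Laplace--Beltrami operator on a subdomain of the sphere -/

/-- The surface measure of the unit sphere. -/
def surfaceMeasure (N : ℕ) : Measure (UnitSphere N) :=
  (volume : Measure (Euc N)).toSphere

/-- The gradient on the sphere of (the restriction to the sphere of) `ψ`: the orthogonal
projection of the Euclidean gradient at `θ` to the tangent space `θ^⊥`. -/
def tangentialGradient {N : ℕ} (ψ : Euc N → ℝ) (θ : UnitSphere N) : Euc N :=
  gradient ψ (θ : Euc N) - inner ℝ (θ : Euc N) (gradient ψ (θ : Euc N)) • (θ : Euc N)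

/-- The restriction of `ψ` to the sphere belongs to `C_c^∞(Ω)`. Every smooth function on the sphere
is such a restriction, and supports on the sphere are automatically compact. -/
def IsSphereTest {N : ℕ} (Ω : Set (UnitSphere N)) (ψ : Euc N → ℝ) : Prop :=
  ContDiff ℝ ∞ ψ ∧ tsupport (fun θ : UnitSphere N => ψ (θ : Euc N)) ⊆ Ω

/-- `φ ∈ H^1_0(Ω)` with gradient `g`: the pair is a limit in `L^2` of pairs consisting of a function
in `C_c^∞(Ω)` and its gradient on the sphere. -/
def IsSphereH10 {N : ℕ} (Ω : Set (UnitSphere N)) (φ : UnitSphere N → ℝ)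
    (g : UnitSphere N → Euc N) : Prop :=
  MemLp φ 2 (surfaceMeasure N) ∧ MemLp g 2 (surfaceMeasure N) ∧
  ∃ ψ : ℕ → Euc N → ℝ, (∀ n, IsSphereTest Ω (ψ n)) ∧
    Tendsto (fun n => eLpNorm (fun θ : UnitSphere N => ψ n (θ : Euc N) - φ θ) 2 (surfaceMeasure N))
      atTop (𝓝 0) ∧
    Tendsto (fun n => eLpNorm (fun θ => tangentialGradient (ψ n) θ - g θ) 2 (surfaceMeasure N))
      atTop (𝓝 0)

/-- `lam` is an eigenvalue of the Dirichlet Laplace--Beltrami operator `-Δ_ω` on `Ω`: there is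
`0 ≠ φ ∈ H^1_0(Ω)` which solves `-Δ_ω φ = lam φ` weakly in `Ω`. -/
def IsDirichletEigenvalue {N : ℕ} (Ω : Set (UnitSphere N)) (lam : ℝ) : Prop :=
  ∃ (φ : UnitSphere N → ℝ) (g : UnitSphere N → Euc N),
    IsSphereH10 Ω φ g ∧ ¬ (φ =ᵐ[surfaceMeasure N] 0) ∧
    ∀ ψ : Euc N → ℝ, IsSphereTest Ω ψ →
      ∫ θ, inner ℝ (g θ) (tangentialGradient ψ θ) ∂(surfaceMeasure N) =
        lam * ∫ θ, φ θ * ψ (θ : Euc N) ∂(surfaceMeasure N)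

/-- The principal (smallest) Dirichlet eigenvalue `λ₁(Ω)` of `-Δ_ω` on `Ω`. -/
def principalDirichletEigenvalue {N : ℕ} (Ω : Set (UnitSphere N)) : ℝ :=
  sInf {lam | IsDirichletEigenvalue Ω lam}

/-! ### Sobolev functions on a domain of `ℝ^N` -/

/-- `g` is the weak gradient of `u` in the open set `G`. -/
def IsWeakGradient {N : ℕ} (G : Set (Euc N)) (u : Euc N → ℝ) (g : Euc N → Euc N) : Prop :=
  ∀ η : Euc N → ℝ, ContDiff ℝ ∞ η → HasCompactSupport η → tsupport η ⊆ G →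
    ∫ x in G, u x • gradient η x = - ∫ x in G, η x • g x

/-- `u ∈ H^1_loc(G)` with weak gradient `g`. -/
def IsH1Loc {N : ℕ} (G : Set (Euc N)) (u : Euc N → ℝ) (g : Euc N → Euc N) : Prop :=
  (∀ K ⊆ G, IsCompact K → MemLp u 2 (volume.restrict K) ∧ MemLp g 2 (volume.restrict K)) ∧
  IsWeakGradient G u g

/-- `φ ∈ H^1_c(G) ∩ L^∞_c(G)` with weak gradient `h`. -/
def IsH1cLinftyc {N : ℕ} (G : Set (Euc N)) (φ : Euc N → ℝ) (h : Euc N → Euc N) : Prop :=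
  MemLp φ 2 (volume.restrict G) ∧ MemLp h 2 (volume.restrict G) ∧ IsWeakGradient G φ h ∧
  MemLp φ ∞ (volume.restrict G) ∧
  ∃ K ⊆ G, IsCompact K ∧ ∀ᵐ x ∂(volume.restrict G), x ∉ K → φ x = 0

/-! ### Super-solutions -/

/-- `u` is a nonnegative super-solution in `G` to
`-∇·(|x|^A ∇u) - B |x|^{A-2} u = C |x|^{A-2} u`. -/
def IsNonnegSuperSolution {N : ℕ} (A B C : ℝ) (G : Set (Euc N)) (u : Euc N → ℝ) : Prop :=
  (∀ᵐ x ∂(volume.restrict G), 0 ≤ u x) ∧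
  ∃ g : Euc N → Euc N, IsH1Loc G u g ∧
    ∀ (φ : Euc N → ℝ) (h : Euc N → Euc N), IsH1cLinftyc G φ h →
      (∀ᵐ x ∂(volume.restrict G), 0 ≤ φ x) →
      C * ∫ x in G, u x * φ x * ‖x‖ ^ (A - 2) ≤
        (∫ x in G, inner ℝ (g x) (h x) * ‖x‖ ^ A) - B * ∫ x in G, u x * φ x * ‖x‖ ^ (A - 2)

/-- `u` is a positive super-solution: a nonnegative super-solution which is strictly positive in the
sense that `u⁻¹ ∈ L^∞_loc(G)`, i.e. `u` is essentially bounded away from zero on compact sets. -/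
def IsPositiveSuperSolution {N : ℕ} (A B C : ℝ) (G : Set (Euc N)) (u : Euc N → ℝ) : Prop :=
  IsNonnegSuperSolution A B C G u ∧
  ∀ K ⊆ G, IsCompact K → ∃ c > 0, ∀ᵐ x ∂(volume.restrict K), c ≤ u x

/-- The Hardy constant `C_H = (2 - N - A)^2 / 4`. -/
def hardyConstant (N : ℕ) (A : ℝ) : ℝ := (2 - (N : ℝ) - A) ^ 2 / 4

end

/-!
Write `λ` for the principal eigenvalue of `Ω` and `C_H` for the Hardy constant. The critical value
`C_H + λ` is the best constant in the Hardy inequality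
`c ∫ Ψ² |x|^(A-2) ≤ ∫ |∇Ψ|² |x|^A` for test functions `Ψ` in the cone, and a positive super-solution
exists exactly when this inequality holds with `c = B + C`.

The spectral side. `principalDirichletEigenvalue` is an infimum of eigenvalues, which says something
only if it is attained. It is identified with the infimum `rayleighInf` of the Rayleigh quotient
over test functions (`principalDirichletEigenvalue_eq`). A minimizing sequence may be taken
nonnegative; extended to a spherical shell it is compact in `L²` by a Rellich argument with mollifiers
(`exists_finite_discretization`, `exists_subseq_tendsto_restrictLp`), and by the parallelogram
identity its gradients converge as well, so that there is a nonnegative minimizer, a weak solution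
of the eigenvalue equation (`exists_principal_eigenfunction`).

Existence for `B + C ≤ C_H + λ`. Let `α ≥ 0` solve `α (α + N - 2) = λ`. The `α`-homogeneous
extension of the principal eigenfunction is harmonic in the cone in the sense of distributions
(`integral_homogeneousExt_mul_coordLaplacian`). Weyl's lemma, proved through averages against radial
kernels whose derivative in the scale is a Laplacian (`exists_harmonic_representative`), makes it a
smooth harmonic function `V`, positive since the cone is connected
(`exists_pos_homogeneous_harmonic`). Then `|x|^(β - α) V` is a positive solution as soon as
`β (β + A + N - 2) = λ - B - C`, and this quadratic equation has a real root precisely when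
`B + C ≤ C_H + λ` (`exists_positive_superSolution`).

Nonexistence for `B + C > C_H + λ`. Testing the equation of a positive super-solution `u` with
`Ψ² / u`, where `u` is mollified to make this a smooth test function, and using Picone's inequality
gives the Hardy inequality with constant `B + C` (`IsPositiveSuperSolution.energy_le`). It is
violated by products `r^(-s) b(log r) ψ(ω)` with `s = (N - 2 + A) / 2`, where `b` varies slowly
and is supported far out, so that `r > ρ`, and `ψ` is close to optimal for the Rayleigh quotient
(`le_of_isPositiveSuperSolution`).
-/

noncomputable section

/-! ### Polar coordinates -/

/-- The direction `x / ‖x‖` of `x ≠ 0`; a fixed point of the sphere at `x = 0`. -/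
def dir {N : ℕ} [NeZero N] (x : Euc N) : UnitSphere N :=
  if h : x = 0 then ⟨EuclideanSpace.single 0 1, by simp⟩
  else ⟨‖x‖⁻¹ • x, by simp [norm_smul, h]⟩

/-- The measure `r^(N-1) dr` on the half line `(0, ∞)`, regarded as a measure on `ℝ`. -/
def radialMeasure (N : ℕ) : Measure ℝ :=
  (volume.restrict (Set.Ioi 0)).withDensity fun r => ENNReal.ofReal (r ^ (N - 1))

section Polar

variable {N : ℕ} [NeZero N]

lemma coe_dir {x : Euc N} (hx : x ≠ 0) : (dir x : Euc N) = ‖x‖⁻¹ • x := by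
  simp [dir, hx]

lemma norm_smul_dir (x : Euc N) : ‖x‖ • (dir x : Euc N) = x := by
  by_cases hx : x = 0
  · simp [hx]
  · rw [coe_dir hx, smul_smul, mul_inv_cancel₀ (norm_ne_zero_iff.2 hx), one_smul]

omit [NeZero N] in
lemma norm_unitSphere (θ : UnitSphere N) : ‖(θ : Euc N)‖ = 1 := by
  simp

omit [NeZero N] in
lemma norm_smul_unitSphere {r : ℝ} (hr : 0 ≤ r) (θ : UnitSphere N) : ‖r • (θ : Euc N)‖ = r := by
  simp [norm_smul, abs_of_nonneg hr]

omit [NeZero N] in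
lemma smul_unitSphere_ne_zero {r : ℝ} (hr : 0 < r) (θ : UnitSphere N) : r • (θ : Euc N) ≠ 0 := by
  rw [← norm_pos_iff, norm_smul_unitSphere hr.le]; exact hr

lemma dir_smul_unitSphere {r : ℝ} (hr : 0 < r) (θ : UnitSphere N) : dir (r • (θ : Euc N)) = θ := by
  apply Subtype.ext
  rw [coe_dir (smul_unitSphere_ne_zero hr θ), norm_smul_unitSphere hr.le, smul_smul,
    inv_mul_cancel₀ hr.ne', one_smul]

lemma dir_smul {t : ℝ} (ht : 0 < t) (x : Euc N) : dir (t • x) = dir x := by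
  by_cases hx : x = 0
  · simp [hx]
  · conv_lhs => rw [← norm_smul_dir x, smul_smul]
    exact dir_smul_unitSphere (mul_pos ht (norm_pos_iff.2 hx)) _

lemma continuousOn_dir : ContinuousOn (dir (N := N)) {0}ᶜ := by
  rw [Topology.IsInducing.subtypeVal.continuousOn_iff]
  have : ContinuousOn (fun x : Euc N => ‖x‖⁻¹ • x) {0}ᶜ :=
    (continuousOn_id.norm.inv₀ fun x hx => norm_ne_zero_iff.2 hx).smul continuousOn_id
  exact this.congr fun x hx => coe_dir hx

lemma measurable_dir : Measurable (dir (N := N)) :=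
  measurable_of_continuousOn_compl_singleton 0 continuousOn_dir

instance : IsFiniteMeasure (surfaceMeasure N) := by unfold surfaceMeasure; infer_instance

instance : (surfaceMeasure N).IsOpenPosMeasure := by unfold surfaceMeasure; infer_instance

instance : SFinite (radialMeasure N) := by unfold radialMeasure; infer_instance

omit [NeZero N] in
lemma map_volumeIoiPow :
    (Measure.volumeIoiPow (N - 1)).map Subtype.val = radialMeasure N := by
  have hme : MeasurableEmbedding (Subtype.val : Set.Ioi (0:ℝ) → ℝ) :=
    MeasurableEmbedding.subtype_coe measurableSet_Ioi
  ext s hs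
  rw [Measure.map_apply measurable_subtype_coe hs, Measure.volumeIoiPow,
    withDensity_apply _ (measurable_subtype_coe hs), radialMeasure, withDensity_apply _ hs,
    ← map_comap_subtype_coe measurableSet_Ioi, hme.restrict_map, hme.lintegral_map]

/-- Polar coordinates: Lebesgue measure on `ℝ^N` is the product of the surface measure of the sphere
and the measure `r^(N-1) dr`. -/
lemma measurePreserving_polar :
    MeasurePreserving (fun x : Euc N => (dir x, ‖x‖)) volume
      ((surfaceMeasure N).prod (radialMeasure N)) := by
  have hm : Measurable fun x : Euc N => (dir x, ‖x‖) := measurable_dir.prodMk measurable_norm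
  refine ⟨hm, ?_⟩
  have h1 := (volume : Measure (Euc N)).measurePreserving_homeomorphUnitSphereProd
  rw [finrank_euclideanSpace_fin] at h1
  have h2 : MeasurePreserving (Subtype.val : Set.Ioi (0:ℝ) → ℝ) (Measure.volumeIoiPow (N - 1))
      (radialMeasure N) := ⟨measurable_subtype_coe, map_volumeIoiPow⟩
  have h3 := ((MeasurePreserving.id (surfaceMeasure N)).prod h2).comp h1
  have hv : (volume : Measure (Euc N)) =
      ((volume : Measure (Euc N)).comap (Subtype.val : ({0}ᶜ : Set (Euc N)) → Euc N)).map
        Subtype.val := by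
    rw [map_comap_subtype_coe (measurableSet_singleton _).compl, restrict_compl_singleton]
  rw [← h3.map_eq]
  conv_lhs => rw [hv]
  rw [Measure.map_map hm measurable_subtype_coe]
  congr 1
  funext x
  refine Prod.ext (Subtype.ext ?_) ?_
  · simp [coe_dir x.2]
  · simp

/-- Polar coordinates, in the direction `(θ, r) ↦ r θ`. -/
lemma measurePreserving_smul_unitSphere :
    MeasurePreserving (fun p : UnitSphere N × ℝ => p.2 • (p.1 : Euc N))
      ((surfaceMeasure N).prod (radialMeasure N)) volume := by
  have hm : Measurable fun p : UnitSphere N × ℝ => p.2 • (p.1 : Euc N) := by fun_prop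
  refine ⟨hm, ?_⟩
  rw [← measurePreserving_polar.map_eq, Measure.map_map hm measurePreserving_polar.measurable]
  have h : (fun p : UnitSphere N × ℝ => p.2 • (p.1 : Euc N)) ∘ (fun x : Euc N => (dir x, ‖x‖)) =
      id := funext norm_smul_dir
  rw [h, Measure.map_id]

omit [NeZero N] in
lemma ae_radialMeasure_pos : ∀ᵐ r ∂(radialMeasure N), 0 < r :=
  (withDensity_absolutelyContinuous _ _).ae_le (ae_restrict_mem measurableSet_Ioi)

omit [NeZero N] in
lemma integral_radialMeasure {F : Type*} [NormedAddCommGroup F] [NormedSpace ℝ F] (a : ℝ → F) :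
    ∫ r, a r ∂(radialMeasure N) = ∫ r in Set.Ioi 0, r ^ (N - 1) • a r := by
  rw [radialMeasure, integral_withDensity_eq_integral_toReal_smul (by fun_prop) (by simp)]
  refine setIntegral_congr_fun measurableSet_Ioi fun r hr => ?_
  rw [ENNReal.toReal_ofReal (pow_nonneg (le_of_lt hr) _)]

omit [NeZero N] in
lemma integrable_radialMeasure_iff {F : Type*} [NormedAddCommGroup F] [NormedSpace ℝ F]
    (a : ℝ → F) :
    Integrable a (radialMeasure N) ↔ IntegrableOn (fun r => r ^ (N - 1) • a r) (Set.Ioi 0) := by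
  rw [radialMeasure, integrable_withDensity_iff_integrable_smul' (by fun_prop) (by simp),
    IntegrableOn]
  refine integrable_congr ?_
  filter_upwards [ae_restrict_mem measurableSet_Ioi] with r hr
  rw [ENNReal.toReal_ofReal (pow_nonneg (le_of_lt hr) _)]

lemma integral_polar {F : Type*} [NormedAddCommGroup F] [NormedSpace ℝ F] {f : Euc N → F}
    (hf : AEStronglyMeasurable f volume) :
    ∫ x, f x = ∫ p, f (p.2 • (p.1 : Euc N)) ∂((surfaceMeasure N).prod (radialMeasure N)) := by
  have h := measurePreserving_smul_unitSphere (N := N)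
  rw [← h.map_eq] at hf ⊢
  exact integral_map h.measurable.aemeasurable hf

lemma integrable_polar_iff {F : Type*} [NormedAddCommGroup F] {f : Euc N → F}
    (hf : AEStronglyMeasurable f volume) :
    Integrable f ↔ Integrable (fun p : UnitSphere N × ℝ => f (p.2 • (p.1 : Euc N)))
      ((surfaceMeasure N).prod (radialMeasure N)) :=
  (measurePreserving_smul_unitSphere.integrable_comp hf).symm

/-- An iterated integral in polar coordinates of a function which is a product of a radial and an
angular function for `r > 0`. -/
lemma integral_polar_mul {f : Euc N → ℝ} (hf : AEStronglyMeasurable f volume) {a : ℝ → ℝ}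
    {b : UnitSphere N → ℝ} (h : ∀ r > 0, ∀ θ : UnitSphere N, f (r • (θ : Euc N)) = b θ * a r) :
    ∫ x, f x = (∫ θ, b θ ∂(surfaceMeasure N)) * ∫ r in Set.Ioi 0, r ^ (N - 1) * a r := by
  rw [integral_polar hf]
  have : ∫ r in Set.Ioi 0, r ^ (N - 1) * a r = ∫ r, a r ∂(radialMeasure N) := by
    rw [integral_radialMeasure]; rfl
  rw [this, ← integral_prod_mul]
  refine integral_congr_ae ?_
  have := (Measure.quasiMeasurePreserving_snd (μ := surfaceMeasure N)
    (ν := radialMeasure N)).ae ae_radialMeasure_pos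
  filter_upwards [this] with p hp
  exact h _ hp _

end Polar

/-! ### Gradients, cut-offs and separated functions -/

section Calculus

variable {N : ℕ}

lemma hasFDerivAt_norm_euc {x : Euc N} (hx : x ≠ 0) :
    HasFDerivAt (fun y : Euc N => ‖y‖) (‖x‖⁻¹ • innerSL ℝ x) x := by
  have h := (hasStrictFDerivAt_norm_sq x).hasFDerivAt.sqrt (by positivity)
  simp only [Real.sqrt_sq (norm_nonneg _)] at h
  have e : ‖x‖⁻¹ • innerSL ℝ x = (1 / (2 * ‖x‖)) • (2 • innerSL ℝ x) := by
    rw [← Nat.cast_smul_eq_nsmul ℝ, smul_smul]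
    congr 1
    push_cast
    field_simp
  rw [e]
  exact h

/-- The gradient is determined by the values of the derivative. -/
lemma gradient_eq_of_hasFDerivAt {f : Euc N → ℝ} {f' : Euc N →L[ℝ] ℝ} {x v : Euc N}
    (h : HasFDerivAt f f' x) (hv : ∀ w, f' w = inner ℝ v w) : gradient f x = v := by
  refine ext_inner_right ℝ fun w => ?_
  rw [inner_gradient_left, h.fderiv, hv]

lemma continuous_gradient {f : Euc N → ℝ} (hf : ContDiff ℝ ∞ f) : Continuous (gradient f) :=
  (InnerProductSpace.toDual ℝ (Euc N)).symm.continuous.comp (hf.continuous_fderiv (by simp))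

lemma contDiff_gradient {f : Euc N → ℝ} (hf : ContDiff ℝ ∞ f) : ContDiff ℝ ∞ (gradient f) :=
  (InnerProductSpace.toDual ℝ (Euc N)).symm.contDiff.comp
    (hf.fderiv_right (m := ∞) (by simp))

lemma gradient_eq_zero_of_notMem_tsupport {f : Euc N → ℝ} {x : Euc N} (hx : x ∉ tsupport f) :
    gradient f x = 0 := by
  have : f =ᶠ[𝓝 x] fun _ => 0 := notMem_tsupport_iff_eventuallyEq.1 hx
  rw [this.gradient_eq]; simp

lemma hasCompactSupport_gradient {f : Euc N → ℝ} (hf : HasCompactSupport f) :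
    HasCompactSupport (gradient f) :=
  HasCompactSupport.intro hf fun _ hx => gradient_eq_zero_of_notMem_tsupport hx

lemma gradient_apply (f : Euc N → ℝ) (x : Euc N) (i : Fin N) :
    gradient f x i = fderiv ℝ f x (EuclideanSpace.single i 1) := by
  rw [← inner_gradient_left, EuclideanSpace.inner_single_right]
  simp

lemma euc_inner_eq_sum (x y : Euc N) : inner ℝ x y = ∑ i, x i * y i := by
  simp [PiLp.inner_apply, mul_comm]

/-- A cut-off function which is `1` near the compact set `K` and supported in the open set `G`. -/
lemma exists_cutoff {K G : Set (Euc N)} (hK : IsCompact K) (hG : IsOpen G) (hKG : K ⊆ G) :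
    ∃ χ : Euc N → ℝ, ContDiff ℝ ∞ χ ∧ HasCompactSupport χ ∧ tsupport χ ⊆ G ∧
      (∀ᶠ x in 𝓝ˢ K, χ x = 1) ∧ ∀ x, χ x ∈ Set.Icc (0:ℝ) 1 := by
  obtain ⟨K', hK', h1, h2⟩ := exists_compact_between hK hG hKG
  obtain ⟨f, hf1, hf0, hf⟩ := exists_contMDiffMap_one_nhds_of_subset_interior
    (modelWithCornersSelf ℝ (Euc N)) (n := (⊤ : ℕ∞)) hK.isClosed h1
  have hs : tsupport f ⊆ K' :=
    closure_minimal (fun x hx => by_contra fun h => hx (hf0 x h)) hK'.isClosed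
  exact ⟨f, f.contMDiff.contDiff, hK'.of_isClosed_subset (isClosed_tsupport _) hs, hs.trans h2,
    hf1, hf⟩

lemma contDiff_mul_of_tsupport_subset {χ u : Euc N → ℝ} {G : Set (Euc N)} (hG : IsOpen G)
    (hχ : ContDiff ℝ ∞ χ) (hs : tsupport χ ⊆ G) (hu : ContDiffOn ℝ ∞ u G) :
    ContDiff ℝ ∞ fun x => χ x * u x := by
  refine contDiff_iff_contDiffAt.2 fun x => ?_
  by_cases hx : x ∈ tsupport χ
  · exact hχ.contDiffAt.mul (hu.contDiffAt (hG.mem_nhds (hs hx)))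
  · have : (fun x => χ x * u x) =ᶠ[𝓝 x] fun _ => 0 := by
      filter_upwards [notMem_tsupport_iff_eventuallyEq.1 hx] with y hy
      simp [hy]
    exact contDiffAt_const.congr_of_eventuallyEq this

/-- A smooth function on an open set agrees near a compact subset with a smooth function on `ℝ^N`
which is compactly supported in the open set. -/
lemma exists_contDiff_extension {K G : Set (Euc N)} (hK : IsCompact K) (hG : IsOpen G)
    (hKG : K ⊆ G) {u : Euc N → ℝ} (hu : ContDiffOn ℝ ∞ u G) :
    ∃ w : Euc N → ℝ, ContDiff ℝ ∞ w ∧ HasCompactSupport w ∧ tsupport w ⊆ G ∧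
      ∀ᶠ x in 𝓝ˢ K, w x = u x := by
  obtain ⟨χ, h1, h2, h3, h4, -⟩ := exists_cutoff hK hG hKG
  refine ⟨fun x => χ x * u x, contDiff_mul_of_tsupport_subset hG h1 h3 hu, h2.mul_right,
    (tsupport_mul_subset_left).trans h3, ?_⟩
  filter_upwards [h4] with x hx
  simp [hx]

/-- Integration by parts against a smooth compactly supported function, in a coordinate
direction. -/
lemma integral_mul_gradient_apply {f g : Euc N → ℝ} (hf : ContDiff ℝ ∞ f) (hg : ContDiff ℝ ∞ g)
    (hs : HasCompactSupport g) (i : Fin N) :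
    ∫ x, f x * gradient g x i = - ∫ x, gradient f x i * g x := by
  simp only [gradient_apply]
  have hf' : Continuous fun x => fderiv ℝ f x (EuclideanSpace.single i 1) :=
    (hf.continuous_fderiv (by simp)).clm_apply continuous_const
  have hg' : Continuous fun x => fderiv ℝ g x (EuclideanSpace.single i 1) :=
    (hg.continuous_fderiv (by simp)).clm_apply continuous_const
  refine integral_mul_fderiv_eq_neg_fderiv_mul_of_integrable ?_ ?_ ?_
    (fun x _ => (hf.differentiable (by simp)) x) (fun x _ => (hg.differentiable (by simp)) x)
  · exact (hf'.mul hg.continuous).integrable_of_hasCompactSupport hs.mul_left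
  · refine (hf.continuous.mul hg').integrable_of_hasCompactSupport
      (HasCompactSupport.mul_left ?_)
    exact hs.fderiv_apply ℝ _
  · exact (hf.continuous.mul hg.continuous).integrable_of_hasCompactSupport hs.mul_left

/-! ### Tangential gradients -/

lemma inner_tangentialGradient (ψ : Euc N → ℝ) (θ : UnitSphere N) :
    inner ℝ (θ : Euc N) (tangentialGradient ψ θ) = 0 := by
  simp [tangentialGradient, inner_sub_right, inner_smul_right]

lemma continuous_tangentialGradient {ψ : Euc N → ℝ} (hψ : ContDiff ℝ ∞ ψ) :
    Continuous (tangentialGradient ψ) := by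
  have := (continuous_gradient hψ).comp (continuous_subtype_val (p := (· ∈ Metric.sphere 0 1)))
  change Continuous fun θ : UnitSphere N => gradient ψ (θ : Euc N) -
    inner ℝ (θ : Euc N) (gradient ψ (θ : Euc N)) • (θ : Euc N)
  simp only [Function.comp_def] at this
  exact this.sub (Continuous.smul (Continuous.inner (𝕜 := ℝ) continuous_subtype_val this)
    continuous_subtype_val)

lemma tangentialGradient_of_gradient_eq {ψ₁ ψ₂ ψ₃ : Euc N → ℝ} {θ : UnitSphere N} {s t : ℝ}
    (h : gradient ψ₁ (θ : Euc N) = s • gradient ψ₂ (θ : Euc N) + t • gradient ψ₃ (θ : Euc N)) :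
    tangentialGradient ψ₁ θ = s • tangentialGradient ψ₂ θ + t • tangentialGradient ψ₃ θ := by
  simp only [tangentialGradient, h, inner_add_right, inner_smul_right]
  module

lemma tangentialGradient_linear_comb {ψ₁ ψ₂ : Euc N → ℝ} (h₁ : ContDiff ℝ ∞ ψ₁)
    (h₂ : ContDiff ℝ ∞ ψ₂) (s t : ℝ) (θ : UnitSphere N) :
    tangentialGradient (fun x => s * ψ₁ x + t * ψ₂ x) θ =
      s • tangentialGradient ψ₁ θ + t • tangentialGradient ψ₂ θ := by
  refine tangentialGradient_of_gradient_eq ?_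
  have d₁ := (h₁.differentiable (by simp) (θ : Euc N)).hasFDerivAt
  have d₂ := (h₂.differentiable (by simp) (θ : Euc N)).hasFDerivAt
  refine gradient_eq_of_hasFDerivAt ((d₁.const_mul s).add (d₂.const_mul t)) fun w => ?_
  simp [inner_add_left, inner_smul_left, inner_gradient_left]

lemma tangentialGradient_comp {ψ : Euc N → ℝ} (hψ : ContDiff ℝ ∞ ψ) {f : ℝ → ℝ} {f' : ℝ}
    {θ : UnitSphere N} (hf : HasDerivAt f f' (ψ (θ : Euc N))) :
    tangentialGradient (fun x => f (ψ x)) θ = f' • tangentialGradient ψ θ := by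
  have : gradient (fun x => f (ψ x)) (θ : Euc N) = f' • gradient ψ (θ : Euc N) := by
    refine gradient_eq_of_hasFDerivAt
      (hf.comp_hasFDerivAt _ (hψ.differentiable (by simp) (θ : Euc N)).hasFDerivAt) fun w => ?_
    simp [inner_smul_left, inner_gradient_left]
  simpa using tangentialGradient_of_gradient_eq (ψ₃ := ψ) (t := 0) (s := f') (by simpa using this)

lemma gradient_comp_smul {η : Euc N → ℝ} (hη : ContDiff ℝ ∞ η) (r : ℝ) (x : Euc N) :
    gradient (fun y => η (r • y)) x = r • gradient η (r • x) := by
  have h := (hη.differentiable (by simp) (r • x)).hasFDerivAt.comp x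
    ((hasFDerivAt_id x).const_smul r)
  refine gradient_eq_of_hasFDerivAt h fun w => ?_
  simp [inner_gradient_left, inner_smul_left]

lemma IsSphereTest.linear_comb {Ω : Set (UnitSphere N)} {ψ₁ ψ₂ : Euc N → ℝ}
    (h₁ : IsSphereTest Ω ψ₁) (h₂ : IsSphereTest Ω ψ₂) (s t : ℝ) :
    IsSphereTest Ω fun x => s * ψ₁ x + t * ψ₂ x := by
  refine ⟨(contDiff_const.mul h₁.1).add (contDiff_const.mul h₂.1), ?_⟩
  refine (tsupport_add _ _).trans (Set.union_subset ?_ ?_)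
  · exact (tsupport_mul_subset_right).trans h₁.2
  · exact (tsupport_mul_subset_right).trans h₂.2

lemma IsSphereTest.comp {Ω : Set (UnitSphere N)} {ψ : Euc N → ℝ} (h : IsSphereTest Ω ψ)
    {f : ℝ → ℝ} (hf : ContDiff ℝ ∞ f) (h0 : f 0 = 0) : IsSphereTest Ω fun x => f (ψ x) :=
  ⟨hf.comp h.1, (tsupport_comp_subset h0 _).trans h.2⟩

/-! ### Products of a radial and an angular function -/

/-- The function `x ↦ a(|x|) ψ(x/|x|)`. -/
def separated (a : ℝ → ℝ) (ψ : Euc N → ℝ) (x : Euc N) : ℝ := a ‖x‖ * ψ (‖x‖⁻¹ • x)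

lemma separated_smul (a : ℝ → ℝ) (ψ : Euc N → ℝ) {r : ℝ} (hr : 0 < r) (θ : UnitSphere N) :
    separated a ψ (r • (θ : Euc N)) = a r * ψ (θ : Euc N) := by
  rw [separated, norm_smul_unitSphere hr.le, smul_smul, inv_mul_cancel₀ hr.ne', one_smul]

lemma contDiff_separated {a : ℝ → ℝ} {ψ : Euc N → ℝ} (ha : ContDiff ℝ ∞ a)
    (h0 : ∀ᶠ r in 𝓝 0, a r = 0) (hψ : ContDiff ℝ ∞ ψ) : ContDiff ℝ ∞ (separated a ψ) := by
  refine contDiff_iff_contDiffAt.2 fun x => ?_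
  by_cases hx : x = 0
  · have : separated a ψ =ᶠ[𝓝 x] fun _ => 0 := by
      have ht : Tendsto (fun y : Euc N => ‖y‖) (𝓝 x) (𝓝 0) := by
        simpa [hx] using (continuous_norm (E := Euc N)).tendsto x
      filter_upwards [ht.eventually h0] with y hy
      simp [separated, hy]
    exact contDiffAt_const.congr_of_eventuallyEq this
  · have hn : ContDiffAt ℝ ∞ (fun y : Euc N => ‖y‖) x := contDiffAt_norm ℝ hx
    exact (ha.contDiffAt.comp x hn).mul
      (hψ.contDiffAt.comp x ((hn.inv (norm_ne_zero_iff.2 hx)).smul contDiffAt_id))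

lemma gradient_separated {a : ℝ → ℝ} {a' : ℝ} {ψ : Euc N → ℝ} {r : ℝ} (hr : 0 < r)
    (ha : HasDerivAt a a' r) (hψ : ContDiff ℝ ∞ ψ) (θ : UnitSphere N) :
    gradient (separated a ψ) (r • (θ : Euc N)) =
      (a' * ψ (θ : Euc N)) • (θ : Euc N) + (a r / r) • tangentialGradient ψ θ := by
  set x : Euc N := r • (θ : Euc N) with hxdef
  have hx : x ≠ 0 := smul_unitSphere_ne_zero hr θ
  have hnx : ‖x‖ = r := norm_smul_unitSphere hr.le θ
  have hn := hasFDerivAt_norm_euc hx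
  have hxθ : ‖x‖⁻¹ • x = (θ : Euc N) := by
    rw [hnx, hxdef, smul_smul, inv_mul_cancel₀ hr.ne', one_smul]
  have h1 : HasFDerivAt (fun y : Euc N => a ‖y‖) (a' • (‖x‖⁻¹ • innerSL ℝ x)) x :=
    (hnx.symm ▸ ha : HasDerivAt a a' ‖x‖).comp_hasFDerivAt x hn
  have h2 : HasFDerivAt (fun y : Euc N => ‖y‖⁻¹ • y) _ x :=
    ((hasDerivAt_inv (norm_ne_zero_iff.2 hx)).comp_hasFDerivAt x hn).smul
    (hasFDerivAt_id x)
  have h3 : HasFDerivAt ψ (fderiv ℝ ψ (θ : Euc N)) ((fun y : Euc N => ‖y‖⁻¹ • y) x) := by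
    simp only [hxθ]; exact (hψ.differentiable (by simp) _).hasFDerivAt
  have h4 := h1.mul (HasFDerivAt.comp (f := fun y : Euc N => ‖y‖⁻¹ • y) x h3 h2)
  refine gradient_eq_of_hasFDerivAt h4 fun w => ?_
  have hxw : inner ℝ x w = r * inner ℝ (θ : Euc N) w := by rw [hxdef, inner_smul_left]; simp
  rw [hnx] at hxθ
  simp [hnx, hxθ, tangentialGradient, inner_add_left, inner_sub_left, inner_smul_left,
    inner_gradient_left, inner_gradient_right, hxw]
  nth_rewrite 1 [hxdef]
  rw [map_smul, smul_eq_mul]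
  field_simp
  ring

end Calculus

/-! ### Mollification in `L^2` -/

section Mollify

open scoped Convolution

variable {N : ℕ}

lemma sq_lintegral_le {α : Type*} [MeasurableSpace α] {P : Measure α} [IsProbabilityMeasure P]
    {h : α → ℝ≥0∞} (hh : AEMeasurable h P) : (∫⁻ x, h x ∂P) ^ 2 ≤ ∫⁻ x, h x ^ 2 ∂P := by
  have := ENNReal.lintegral_mul_le_Lp_mul_Lq P Real.HolderConjugate.two_two hh
    (aemeasurable_const (b := (1 : ℝ≥0∞)))
  simp only [Pi.mul_apply, mul_one, ENNReal.one_rpow, lintegral_const, measure_univ] at this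
  calc (∫⁻ x, h x ∂P) ^ 2 ≤ ((∫⁻ x, h x ^ (2:ℝ) ∂P) ^ (1 / 2 : ℝ)) ^ 2 := by gcongr
    _ = ∫⁻ x, h x ^ 2 ∂P := by
      rw [← ENNReal.rpow_natCast, ← ENNReal.rpow_mul]
      simp

variable {F : Type*} [NormedAddCommGroup F] [NormedSpace ℝ F] [CompleteSpace F]

/-- The mollification error in `L^2` is at most the average of the `L^2` distances to the
translates. -/
lemma lintegral_sub_convolution_le (φ : ContDiffBump (0 : Euc N)) {f : Euc N → F}
    (hf : LocallyIntegrable f) {δ : ℝ≥0∞}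
    (h : ∀ y, ‖y‖ < φ.rOut → ∫⁻ x, ‖f x - f (x - y)‖ₑ ^ 2 ≤ δ) :
    ∫⁻ x, ‖f x - (φ.normed volume ⋆[ContinuousLinearMap.lsmul ℝ ℝ, volume] f) x‖ₑ ^ 2 ≤ δ := by
  set ρ := φ.normed (volume : Measure (Euc N)) with hρ
  have hρc : Continuous ρ := φ.continuous_normed
  have hρm : Measurable fun y => ENNReal.ofReal (ρ y) := hρc.measurable.ennreal_ofReal
  set P := (volume : Measure (Euc N)).withDensity fun y => ENNReal.ofReal (ρ y) with hP
  have hPac : P ≪ volume := withDensity_absolutelyContinuous _ _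
  have hPp : IsProbabilityMeasure P := ⟨by
    rw [hP, withDensity_apply _ .univ, setLIntegral_univ,
      ← ofReal_integral_eq_lintegral_ofReal φ.integrable_normed (ae_of_all _ φ.nonneg_normed),
      φ.integral_normed, ENNReal.ofReal_one]⟩
  have hfm : AEStronglyMeasurable f volume := hf.aestronglyMeasurable
  have hH : AEStronglyMeasurable (fun p : Euc N × Euc N => f p.1 - f (p.1 - p.2))
      (volume.prod P) := by
    refine AEStronglyMeasurable.sub (hfm.comp_quasiMeasurePreserving
      Measure.quasiMeasurePreserving_fst) ?_
    refine AEStronglyMeasurable.mono_ac (Measure.AbsolutelyContinuous.rfl.prod hPac) ?_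
    exact hfm.comp_quasiMeasurePreserving
      (quasiMeasurePreserving_sub volume volume)
  have hHm : ∀ x, AEMeasurable (fun y => ‖f x - f (x - y)‖ₑ) P := fun x =>
    ((aestronglyMeasurable_const.sub (hfm.comp_quasiMeasurePreserving
      (quasiMeasurePreserving_sub_left volume x))).enorm).mono_ac hPac
  have hpt : ∀ x, ‖f x - (ρ ⋆[ContinuousLinearMap.lsmul ℝ ℝ, volume] f) x‖ₑ ^ 2 ≤
      ∫⁻ y, ‖f x - f (x - y)‖ₑ ^ 2 ∂P := fun x => by
    refine le_trans ?_ (sq_lintegral_le (hHm x))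
    gcongr
    have hex : Integrable (fun y => ρ y • f (x - y)) :=
      φ.hasCompactSupport_normed.convolutionExists_left (ContinuousLinearMap.lsmul ℝ ℝ) hρc hf x
    have heq : f x - (ρ ⋆[ContinuousLinearMap.lsmul ℝ ℝ, volume] f) x =
        ∫ y, ρ y • (f x - f (x - y)) := by
      simp only [smul_sub]
      rw [integral_sub (φ.integrable_normed.smul_const _) hex, integral_smul_const,
        φ.integral_normed, one_smul]
      rfl
    have hm : AEMeasurable (fun y => ‖f x - f (x - y)‖ₑ) volume :=
      (aestronglyMeasurable_const.sub (hfm.comp_quasiMeasurePreserving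
        (quasiMeasurePreserving_sub_left volume x))).enorm
    rw [heq, hP, lintegral_withDensity_eq_lintegral_mul₀ hρm.aemeasurable hm]
    refine (enorm_integral_le_lintegral_enorm _).trans (lintegral_mono fun y => ?_)
    rw [enorm_smul, Real.enorm_eq_ofReal (φ.nonneg_normed y)]
    rfl
  calc _ ≤ ∫⁻ x, ∫⁻ y, ‖f x - f (x - y)‖ₑ ^ 2 ∂P := lintegral_mono hpt
    _ = ∫⁻ y, (∫⁻ x, ‖f x - f (x - y)‖ₑ ^ 2) ∂P :=
      lintegral_lintegral_swap (hH.enorm.pow_const 2)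
    _ ≤ ∫⁻ y, δ ∂P := by
      refine lintegral_mono_ae ?_
      rw [hP, ae_withDensity_iff hρm]
      refine ae_of_all _ fun y hy => h y ?_
      have : y ∈ Function.support ρ := fun h0 => hy (by simp [h0])
      rw [φ.support_normed_eq] at this
      simpa using this
    _ = δ := by simp

omit [NormedSpace ℝ F] [CompleteSpace F] in
/-- Translations are continuous in `L^2`. -/
lemma tendsto_lintegral_sub_translate {f : Euc N → F} (hf : MemLp f 2) :
    Tendsto (fun y : Euc N => ∫⁻ x, ‖f x - f (x - y)‖ₑ ^ 2) (𝓝 0) (𝓝 0) := by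
  let g : C(Euc N, C(Euc N, Euc N)) :=
    ContinuousMap.curry ⟨fun p : Euc N × Euc N => p.2 - p.1, by fun_prop⟩
  have hgm : ∀ y, MeasurePreserving (g y) volume volume := fun y => measurePreserving_sub_right _ y
  have h := (tendsto_const_nhds (x := hf.toLp f) (f := 𝓝 (0 : Euc N))).compMeasurePreservingLp
    (g.continuous.tendsto 0) hgm (hgm 0) (by simp)
  have h2 := (tendsto_const_nhds (x := hf.toLp f) (f := 𝓝 (0 : Euc N))).edist h
  have h3 := (ENNReal.continuous_pow 2).tendsto _ |>.comp h2
  have key : ∀ y, (edist (hf.toLp f) (Lp.compMeasurePreserving (g y) (hgm y) (hf.toLp f))) ^ 2 =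
      ∫⁻ x, ‖f x - f (x - y)‖ₑ ^ 2 := fun y => by
    rw [Lp.toLp_compMeasurePreserving hf (hgm y), Lp.edist_toLp_toLp,
      eLpNorm_eq_lintegral_rpow_enorm_toReal (by simp) (by simp), ← ENNReal.rpow_natCast,
      ← ENNReal.rpow_mul]
    simp [g]
  have hz : Lp.compMeasurePreserving (g 0) (hgm 0) (hf.toLp f) = hf.toLp f := by
    rw [Lp.toLp_compMeasurePreserving hf (hgm 0)]
    congr 1
    funext x
    simp [g]
  rw [hz, edist_self] at h3
  simp only [Function.comp_def, key] at h3
  simpa using h3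

/-- A standard sequence of bump functions shrinking to the origin. -/
def bumpSeq (N n : ℕ) : ContDiffBump (0 : Euc N) where
  rIn := 1 / (2 * ((n : ℝ) + 1))
  rOut := 1 / ((n : ℝ) + 1)
  rIn_pos := by positivity
  rIn_lt_rOut := by
    apply one_div_lt_one_div_of_lt <;> linarith [(Nat.cast_nonneg n : (0:ℝ) ≤ n)]

lemma tendsto_bumpSeq_rOut (N : ℕ) : Tendsto (fun n => (bumpSeq N n).rOut) atTop (𝓝 0) :=
  tendsto_one_div_add_atTop_nhds_zero_nat

/-- Mollifications converge in `L^2`. -/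
lemma tendsto_lintegral_sub_convolution {f : Euc N → F} (hf : MemLp f 2) :
    Tendsto (fun n => ∫⁻ x, ‖f x - ((bumpSeq N n).normed volume
      ⋆[ContinuousLinearMap.lsmul ℝ ℝ, volume] f) x‖ₑ ^ 2) atTop (𝓝 0) := by
  rw [ENNReal.tendsto_nhds_zero]
  intro δ hδ
  have h := ENNReal.tendsto_nhds_zero.1 (tendsto_lintegral_sub_translate hf) δ hδ
  obtain ⟨r, hr, hb⟩ := Metric.eventually_nhds_iff.1 h
  filter_upwards [(tendsto_bumpSeq_rOut N).eventually_lt_const hr] with n hn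
  refine lintegral_sub_convolution_le _ (hf.locallyIntegrable (by simp)) fun y hy => ?_
  exact hb (by simpa using hy.trans hn)

/-! ### A Rellich theorem -/

/-- The `L^2` distance to a translate is controlled by the gradient. -/
lemma lintegral_sub_translate_le {f : Euc N → ℝ} (hf : ContDiff ℝ ∞ f) (y : Euc N) :
    ∫⁻ x, ‖f x - f (x - y)‖ₑ ^ 2 ≤ ‖y‖ₑ ^ 2 * ∫⁻ x, ‖gradient f x‖ₑ ^ 2 := by
  have hg := continuous_gradient hf
  have hpt : ∀ x, ‖f x - f (x - y)‖ₑ ^ 2 ≤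
      ∫⁻ t in Set.Icc (0:ℝ) 1, (‖y‖ₑ * ‖gradient f (x - y + t • y)‖ₑ) ^ 2 := fun x => by
    have : IsProbabilityMeasure (volume.restrict (Set.Icc (0:ℝ) 1)) := ⟨by simp⟩
    have hc : Continuous fun t : ℝ => gradient f (x - y + t • y) := by fun_prop
    refine le_trans ?_ (sq_lintegral_le (by fun_prop))
    gcongr
    have hd : ∀ t ∈ Set.uIcc (0:ℝ) 1, HasDerivAt (fun t : ℝ => f (x - y + t • y))
        (inner ℝ (gradient f (x - y + t • y)) y) t := fun t _ => by
      rw [inner_gradient_left]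
      have h1 : HasDerivAt (fun t : ℝ => x - y + t • y) y t := by
        simpa using ((hasDerivAt_id t).smul_const y).const_add (x - y)
      exact ((hf.differentiable (by simp)) _).hasFDerivAt.comp_hasDerivAt t h1
    have hi : Continuous fun t : ℝ => inner ℝ (gradient f (x - y + t • y)) y :=
      hc.inner continuous_const
    have := intervalIntegral.integral_eq_sub_of_hasDerivAt hd (hi.intervalIntegrable _ _)
    simp only [one_smul, sub_add_cancel, zero_smul, add_zero] at this
    rw [← this, intervalIntegral.integral_of_le zero_le_one, ← integral_Icc_eq_integral_Ioc]
    refine (enorm_integral_le_lintegral_enorm _).trans (lintegral_mono fun t => ?_)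
    rw [← enorm_norm, ← enorm_norm y, ← enorm_norm (gradient f _), ← enorm_mul]
    simp only [Real.enorm_eq_ofReal (norm_nonneg _),
      Real.enorm_eq_ofReal (mul_nonneg (norm_nonneg y) (norm_nonneg _))]
    refine ENNReal.ofReal_le_ofReal ?_
    rw [mul_comm]
    exact norm_inner_le_norm _ _
  calc _ ≤ ∫⁻ x, ∫⁻ t in Set.Icc (0:ℝ) 1, (‖y‖ₑ * ‖gradient f (x - y + t • y)‖ₑ) ^ 2 :=
        lintegral_mono hpt
    _ = ∫⁻ t in Set.Icc (0:ℝ) 1, ∫⁻ x, (‖y‖ₑ * ‖gradient f (x - y + t • y)‖ₑ) ^ 2 := by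
        refine lintegral_lintegral_swap (Measurable.aemeasurable ?_)
        have : Continuous fun p : Euc N × ℝ => gradient f (p.1 - y + p.2 • y) := by fun_prop
        exact (this.measurable.enorm.const_mul _).pow_const 2
    _ = ∫⁻ t in Set.Icc (0:ℝ) 1, ‖y‖ₑ ^ 2 * ∫⁻ x, ‖gradient f x‖ₑ ^ 2 := by
        refine lintegral_congr fun t => ?_
        simp only [mul_pow]
        rw [lintegral_const_mul' _ _ (by simp)]
        congr 1
        have := lintegral_add_right_eq_self (μ := (volume : Measure (Euc N)))
          (fun x => ‖gradient f x‖ₑ ^ 2) (-y + t • y)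
        simpa [add_assoc, sub_eq_add_neg] using this
    _ = _ := by simp

end Mollify

section Rellich

open scoped Convolution

variable {N : ℕ}

/-- Smooth functions supported in the ball of radius `R` whose `L^2` norm and Dirichlet energy are
bounded by `M`. -/
structure BoundedEnergy (R M : ℝ) (f : Euc N → ℝ) : Prop where
  contDiff : ContDiff ℝ ∞ f
  eq_zero : ∀ x, R < ‖x‖ → f x = 0
  integral_sq_le : ∫ x, f x ^ 2 ≤ M
  integral_gradient_sq_le : ∫ x, ‖gradient f x‖ ^ 2 ≤ M

lemma lintegral_enorm_sq {α F : Type*} [MeasurableSpace α] {μ : Measure α} [NormedAddCommGroup F]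
    {f : α → F} (hf : Integrable (fun x => ‖f x‖ ^ 2) μ) :
    ∫⁻ x, ‖f x‖ₑ ^ 2 ∂μ = ENNReal.ofReal (∫ x, ‖f x‖ ^ 2 ∂μ) := by
  rw [ofReal_integral_eq_lintegral_ofReal hf (ae_of_all _ fun x => by positivity)]
  refine lintegral_congr fun x => ?_
  rw [ENNReal.ofReal_pow (norm_nonneg _), ofReal_norm]

namespace BoundedEnergy

variable {R M : ℝ} {f g : Euc N → ℝ}

lemma hasCompactSupport (h : BoundedEnergy R M f) : HasCompactSupport f :=
  HasCompactSupport.intro (isCompact_closedBall (0 : Euc N) R) fun x hx => h.eq_zero x (by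
    simpa using hx)

lemma integrable (h : BoundedEnergy R M f) : Integrable f :=
  h.contDiff.continuous.integrable_of_hasCompactSupport h.hasCompactSupport

lemma integrable_sq (h : BoundedEnergy R M f) : Integrable fun x => f x ^ 2 :=
  (h.contDiff.continuous.pow 2).integrable_of_hasCompactSupport
    (HasCompactSupport.intro h.hasCompactSupport fun x hx => by
      simp [image_eq_zero_of_notMem_tsupport hx])

lemma integrable_gradient_sq (h : BoundedEnergy R M f) :
    Integrable fun x => ‖gradient f x‖ ^ 2 :=
  ((continuous_gradient h.contDiff).norm.pow 2).integrable_of_hasCompactSupport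
    (HasCompactSupport.intro h.hasCompactSupport fun x hx => by
      simp [gradient_eq_zero_of_notMem_tsupport hx])

lemma integral_abs_le (h : BoundedEnergy R M f) :
    ∫ x, |f x| ≤ (volume.real (Metric.closedBall (0 : Euc N) R) + M) / 2 := by
  have hb : Integrable ((Metric.closedBall (0 : Euc N) R).indicator fun _ => (1 : ℝ)) :=
    (integrable_indicator_iff Metric.isClosed_closedBall.measurableSet).2
      (integrableOn_const (measure_closedBall_lt_top).ne)
  calc ∫ x, |f x| ≤ ∫ x, ((Metric.closedBall (0 : Euc N) R).indicator (fun _ => (1 : ℝ)) x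
          + f x ^ 2) / 2 := by
        refine integral_mono h.integrable.abs ((hb.add h.integrable_sq).div_const 2) fun x => ?_
        simp only
        by_cases hx : x ∈ Metric.closedBall (0 : Euc N) R
        · rw [Set.indicator_of_mem hx]
          nlinarith [sq_nonneg (|f x| - 1), sq_abs (f x)]
        · rw [h.eq_zero x (by simpa using hx)]
          simp [Set.indicator_of_notMem hx]
    _ = ((∫ x, (Metric.closedBall (0 : Euc N) R).indicator (fun _ => (1 : ℝ)) x)
          + ∫ x, f x ^ 2) / 2 := by
        rw [integral_div, integral_add hb h.integrable_sq]
    _ ≤ _ := by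
        rw [integral_indicator Metric.isClosed_closedBall.measurableSet]
        simp only [integral_const, smul_eq_mul, mul_one, MeasurableSet.univ,
          measureReal_restrict_apply, Set.univ_inter]
        linarith [h.integral_sq_le]

lemma sub (hf : BoundedEnergy R M f) (hg : BoundedEnergy R M g) :
    BoundedEnergy R (4 * M) fun x => f x - g x where
  contDiff := hf.contDiff.sub hg.contDiff
  eq_zero x hx := by simp [hf.eq_zero x hx, hg.eq_zero x hx]
  integral_sq_le := by
    calc ∫ x, (f x - g x) ^ 2 ≤ ∫ x, (2 * f x ^ 2 + 2 * g x ^ 2) := by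
          refine integral_mono_of_nonneg (ae_of_all _ fun x => by positivity)
            ((hf.integrable_sq.const_mul 2).add (hg.integrable_sq.const_mul 2))
            (ae_of_all _ fun x => ?_)
          simp only
          nlinarith [sq_nonneg (f x + g x)]
      _ ≤ 4 * M := by
          rw [integral_add (hf.integrable_sq.const_mul 2) (hg.integrable_sq.const_mul 2),
            integral_const_mul, integral_const_mul]
          linarith [hf.integral_sq_le, hg.integral_sq_le]
  integral_gradient_sq_le := by
    have hgr : ∀ x, gradient (fun x => f x - g x) x = gradient f x - gradient g x := fun x => by
      refine gradient_eq_of_hasFDerivAt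
        (((hf.contDiff.differentiable (by simp)) x).hasFDerivAt.sub
          ((hg.contDiff.differentiable (by simp)) x).hasFDerivAt) fun w => ?_
      simp [inner_sub_left, inner_gradient_left]
    calc ∫ x, ‖gradient (fun x => f x - g x) x‖ ^ 2
        ≤ ∫ x, (2 * ‖gradient f x‖ ^ 2 + 2 * ‖gradient g x‖ ^ 2) := by
          refine integral_mono_of_nonneg (ae_of_all _ fun x => by positivity)
            ((hf.integrable_gradient_sq.const_mul 2).add (hg.integrable_gradient_sq.const_mul 2))
            (ae_of_all _ fun x => ?_)
          simp only [hgr]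
          have := parallelogram_law_with_norm ℝ (gradient f x) (gradient g x)
          nlinarith [mul_self_nonneg ‖gradient f x + gradient g x‖]
      _ ≤ 4 * M := by
          rw [integral_add (hf.integrable_gradient_sq.const_mul 2)
            (hg.integrable_gradient_sq.const_mul 2), integral_const_mul, integral_const_mul]
          linarith [hf.integral_gradient_sq_le, hg.integral_gradient_sq_le]

end BoundedEnergy

/-- Rellich's theorem: the functions of bounded energy form a totally bounded set in `L^2`, here in
the form that finitely many classes of them have arbitrarily small diameter. Two functions are put
into the same class if their mollifications agree approximately at the points of a finite net. -/
lemma exists_finite_discretization (R M : ℝ) {ε : ℝ} (hε : 0 < ε) :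
    ∃ (β : Type) (_ : Finite β) (c : (Euc N → ℝ) → β), ∀ f g : Euc N → ℝ,
      BoundedEnergy R M f → BoundedEnergy R M g → c f = c g → ∫ x, (f x - g x) ^ 2 < ε := by
  obtain ⟨n, hn⟩ : ∃ n : ℕ, (bumpSeq N n).rOut ^ 2 * (4 * M) < ε / 4 := by
    have h := (((tendsto_bumpSeq_rOut N).pow 2).mul_const (4 * M))
    simp only [ne_eq, OfNat.ofNat_ne_zero, not_false_eq_true, zero_pow, zero_mul] at h
    exact (h.eventually_lt_const (by positivity : (0:ℝ) < ε / 4)).exists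
  set φ := bumpSeq N n with hφ
  have hφ1 : φ.rOut ≤ 1 := by
    simp only [hφ, bumpSeq]
    rw [div_le_one (by positivity)]
    linarith [(Nat.cast_nonneg n : (0:ℝ) ≤ n)]
  set ρ := φ.normed (volume : Measure (Euc N)) with hρ
  have hρc : Continuous ρ := φ.continuous_normed
  have hρs : HasCompactSupport ρ := φ.hasCompactSupport_normed
  obtain ⟨Cρ, hCρ⟩ := hρc.bounded_above_of_compact_support hρs
  obtain ⟨Lρ, hLρ⟩ := ContDiff.lipschitzWith_of_hasCompactSupport hρs
    (φ.contDiff_normed (n := 1)) (by simp)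
  set I : ℝ := (volume.real (Metric.closedBall (0 : Euc N) R) + M) / 2 with hI
  have hCρ0 : 0 ≤ Cρ := (norm_nonneg _).trans (hCρ 0)
  set mol : (Euc N → ℝ) → Euc N → ℝ := fun f =>
    (ρ ⋆[ContinuousLinearMap.lsmul ℝ ℝ, volume] f : Euc N → ℝ)
    with hmol
  have hmol_eq : ∀ f x, mol f x = ∫ z, ρ (x - z) * f z := fun f x => by
    simp only [hmol]
    rw [convolution_lsmul_swap]
    rfl
  have hint : ∀ f, BoundedEnergy R M f → ∀ x, Integrable fun z => ρ (x - z) * f z :=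
    fun f hf x => hf.integrable.bdd_mul (by fun_prop) (ae_of_all _ fun z => hCρ (x - z))
  have hbd : ∀ f, BoundedEnergy R M f → ∀ x, |mol f x| ≤ Cρ * I := fun f hf x => by
    rw [hmol_eq]
    calc |∫ z, ρ (x - z) * f z| ≤ ∫ z, Cρ * |f z| := by
          rw [← Real.norm_eq_abs]
          refine norm_integral_le_of_norm_le (hf.integrable.abs.const_mul Cρ)
            (ae_of_all _ fun z => ?_)
          rw [norm_mul]
          exact mul_le_mul_of_nonneg_right (hCρ _) (abs_nonneg _)
      _ ≤ Cρ * I := by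
          rw [integral_const_mul]
          exact mul_le_mul_of_nonneg_left hf.integral_abs_le hCρ0
  have hlip : ∀ f, BoundedEnergy R M f → ∀ x x', |mol f x - mol f x'| ≤ Lρ * I * dist x x' :=
    fun f hf x x' => by
    rw [hmol_eq, hmol_eq, ← integral_sub (hint f hf x) (hint f hf x')]
    calc |∫ z, (ρ (x - z) * f z - ρ (x' - z) * f z)|
        ≤ ∫ z, (Lρ * dist x x') * |f z| := by
          rw [← Real.norm_eq_abs]
          refine norm_integral_le_of_norm_le (hf.integrable.abs.const_mul _)
            (ae_of_all _ fun z => ?_)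
          rw [← sub_mul, norm_mul]
          refine mul_le_mul_of_nonneg_right ?_ (abs_nonneg _)
          rw [← dist_eq_norm]
          exact (hLρ.dist_le_mul _ _).trans (by rw [dist_sub_right])
      _ ≤ Lρ * I * dist x x' := by
          rw [integral_const_mul]
          have := mul_le_mul_of_nonneg_left hf.integral_abs_le
            (mul_nonneg Lρ.2 (dist_nonneg (x := x) (y := x')))
          simp only [NNReal.val_eq_coe] at this
          exact this.trans (le_of_eq (by rw [hI]; ring))
  by_cases hne : ∃ f : Euc N → ℝ, BoundedEnergy R M f
  swap
  · exact ⟨Unit, inferInstance, fun _ => (), fun f _ hf _ _ => (hne ⟨f, hf⟩).elim⟩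
  have hI0 : 0 ≤ I := by
    obtain ⟨f, hf⟩ := hne
    exact (integral_nonneg fun x => abs_nonneg (f x)).trans hf.integral_abs_le
  set W : ℝ := volume.real (Metric.closedBall (0 : Euc N) (R + 1)) with hW
  have hW0 : 0 ≤ W := measureReal_nonneg
  obtain ⟨κ, hκ0, hκ⟩ : ∃ κ : ℝ, 0 < κ ∧ κ ^ 2 * W < ε / 4 := by
    have h : Tendsto (fun κ : ℝ => κ ^ 2 * W) (𝓝[>] 0) (𝓝 0) := by
      have : Tendsto (fun κ : ℝ => κ ^ 2 * W) (𝓝 0) (𝓝 (0 ^ 2 * W)) := by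
        apply Continuous.tendsto; fun_prop
      simpa using this.mono_left nhdsWithin_le_nhds
    obtain ⟨κ, h1, h2⟩ := ((h.eventually_lt_const (by positivity : (0:ℝ) < ε / 4)).and
      self_mem_nhdsWithin).exists
    exact ⟨κ, h2, h1⟩
  set η : ℝ := κ / (4 * (Lρ * I + 1)) with hη
  have hLI : 0 ≤ Lρ * I := mul_nonneg Lρ.2 hI0
  have hη0 : 0 < η := by positivity
  have hηκ : Lρ * I * η ≤ κ / 4 := by
    rw [hη, mul_div_assoc', div_le_div_iff₀ (by positivity) (by positivity)]
    nlinarith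
  obtain ⟨t, -, htf, htc⟩ := (isCompact_closedBall (0 : Euc N) (R + 1)).finite_cover_balls hη0
  obtain ⟨K, hK⟩ := exists_nat_ge (Cρ * I / (κ / 4))
  have hKK : -(K : ℤ) ≤ K := by linarith [Int.natCast_nonneg K]
  have := htf.to_subtype
  have hfin : Finite (t → Set.Icc (-(K : ℤ) - 1) (K + 1)) := inferInstance
  have hmem : ∀ f, BoundedEnergy R M f → ∀ x,
      ⌊mol f x / (κ / 4)⌋ ∈ Set.Icc (-(K : ℤ) - 1) (K + 1) := fun f hf x => by
    have h1 : |mol f x / (κ / 4)| ≤ K := by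
      rw [abs_div, abs_of_pos (by positivity : 0 < κ / 4)]
      exact (div_le_div_of_nonneg_right (hbd f hf x) (by positivity)).trans hK
    obtain ⟨h2, h3⟩ := abs_le.1 h1
    constructor
    · rw [Int.le_floor]; push_cast; linarith
    · refine Int.le_of_lt_add_one (Int.floor_lt.2 ?_)
      push_cast; linarith
  have hKK' : -(K : ℤ) - 1 ≤ K + 1 := by linarith
  refine ⟨t → Set.Icc (-(K : ℤ) - 1) (K + 1), hfin,
    fun f x => Set.projIcc _ _ hKK' ⌊mol f x / (κ / 4)⌋, fun f g hf hg hfg => ?_⟩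
  have hsmall : ∀ x ∈ Metric.closedBall (0 : Euc N) (R + 1), |mol f x - mol g x| ≤ κ :=
    fun x hx => by
    obtain ⟨y, hy, hxy⟩ := Set.mem_iUnion₂.1 (htc hx)
    have h1 := congrArg Subtype.val (congrFun hfg ⟨y, hy⟩)
    simp only [Set.projIcc_of_mem hKK' (hmem f hf y), Set.projIcc_of_mem hKK' (hmem g hg y)] at h1
    have h2 := Int.abs_sub_lt_one_of_floor_eq_floor h1
    rw [← sub_div, abs_div, abs_of_pos (by positivity : 0 < κ / 4),
      div_lt_one (by positivity)] at h2
    have hd : Lρ * I * dist x y ≤ κ / 4 :=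
      (mul_le_mul_of_nonneg_left (le_of_lt hxy) hLI).trans hηκ
    have h3 := (hlip f hf x y).trans hd
    have h4 := (hlip g hg x y).trans hd
    rw [abs_le] at h3 h4 ⊢
    rw [abs_lt] at h2
    constructor <;> linarith
  have hF := hf.sub hg
  set F : Euc N → ℝ := fun x => f x - g x with hFdef
  have hmolF : ∀ x, mol F x = mol f x - mol g x := fun x => by
    rw [hmol_eq, hmol_eq, hmol_eq, ← integral_sub (hint f hf x) (hint g hg x)]
    simp only [hFdef, mul_sub]
  have hmolF0 : ∀ x ∉ Metric.closedBall (0 : Euc N) (R + 1), mol F x = 0 := fun x hx => by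
    rw [hmol_eq]
    refine integral_eq_zero_of_ae (ae_of_all _ fun z => ?_)
    by_cases hz : R < ‖z‖
    · simp [hF.eq_zero z hz]
    · have : x - z ∉ Function.support ρ := by
        rw [φ.support_normed_eq]
        simp only [Metric.mem_closedBall, dist_zero_right, not_le, Metric.mem_ball, not_lt]
          at hx hz ⊢
        linarith [norm_sub_norm_le x z]
      simp [Function.notMem_support.1 this]
  have hmolFc : Continuous (mol F) :=
    hρs.continuous_convolution_left _ hρc hF.integrable.locallyIntegrable
  have hmolFs : HasCompactSupport (mol F) := HasCompactSupport.intro (isCompact_closedBall _ _)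
    hmolF0
  have hmi : Integrable fun x => mol F x ^ 2 :=
    (hmolFc.pow 2).integrable_of_hasCompactSupport
      (HasCompactSupport.intro hmolFs fun x hx => by simp [image_eq_zero_of_notMem_tsupport hx])
  have hds : HasCompactSupport fun x => F x - mol F x := hF.hasCompactSupport.sub hmolFs
  have hdi : Integrable fun x => (F x - mol F x) ^ 2 :=
    ((hF.contDiff.continuous.sub hmolFc).pow 2).integrable_of_hasCompactSupport
      (HasCompactSupport.intro hds fun x hx => by
        rw [Pi.pow_apply, Pi.sub_apply]
        have := image_eq_zero_of_notMem_tsupport hx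
        simp [this])
  have h1 : ∫ x, (F x - mol F x) ^ 2 ≤ φ.rOut ^ 2 * (4 * M) := by
    have h := lintegral_sub_convolution_le φ hF.integrable.locallyIntegrable
      (δ := ENNReal.ofReal (φ.rOut ^ 2 * (4 * M))) fun y hy => by
        refine (lintegral_sub_translate_le hF.contDiff y).trans ?_
        rw [lintegral_enorm_sq hF.integrable_gradient_sq, ENNReal.ofReal_mul (by positivity)]
        gcongr
        · rw [← ofReal_norm, ENNReal.ofReal_pow φ.rOut_pos.le]
          gcongr
        · exact hF.integral_gradient_sq_le
    rw [lintegral_enorm_sq (by simpa using hdi)] at h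
    have hM : 0 ≤ 4 * M := (integral_nonneg fun x => sq_nonneg _).trans hF.integral_sq_le
    simpa using (ENNReal.ofReal_le_ofReal_iff (by positivity)).1 h
  have h2 : ∫ x, mol F x ^ 2 ≤ κ ^ 2 * W := by
    rw [← setIntegral_eq_integral_of_forall_compl_eq_zero
      (s := Metric.closedBall (0 : Euc N) (R + 1))
      fun x hx => by rw [hmolF0 x hx]; simp]
    refine (le_abs_self _).trans ?_
    rw [← Real.norm_eq_abs]
    refine norm_setIntegral_le_of_norm_le_const measure_closedBall_lt_top fun x hx => ?_
    rw [norm_pow, Real.norm_eq_abs, hmolF]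
    exact pow_le_pow_left₀ (abs_nonneg _) (hsmall x hx) 2
  calc ∫ x, F x ^ 2 ≤ ∫ x, (2 * (F x - mol F x) ^ 2 + 2 * mol F x ^ 2) := by
        refine integral_mono hF.integrable_sq ((hdi.const_mul 2).add (hmi.const_mul 2)) fun x => ?_
        simp only
        nlinarith [sq_nonneg (F x - 2 * mol F x)]
    _ = 2 * (∫ x, (F x - mol F x) ^ 2) + 2 * ∫ x, mol F x ^ 2 := by
        rw [integral_add (hdi.const_mul 2) (hmi.const_mul 2), integral_const_mul,
          integral_const_mul]
    _ < ε := by linarith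

end Rellich

/-! ### Energies of separated functions -/

section SeparatedEnergy

variable {N : ℕ}

lemma integrable_of_continuousOn_Icc {f : ℝ → ℝ} {p q : ℝ} (hf : ContinuousOn f (Set.Icc p q))
    (h0 : ∀ r ∉ Set.Icc p q, f r = 0) : Integrable f := by
  rw [← integrableOn_iff_integrable_of_support_subset (s := Set.Icc p q)
    (fun r hr => by_contra fun h => hr (h0 r h))]
  exact hf.integrableOn_Icc

lemma deriv_eq_zero_of_notMem_Icc {a : ℝ → ℝ} {p q : ℝ} (h0 : ∀ r ∉ Set.Icc p q, a r = 0) {r : ℝ}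
    (hr : r ∉ Set.Icc p q) : deriv a r = 0 := by
  have : a =ᶠ[𝓝 r] fun _ => 0 := by
    filter_upwards [isClosed_Icc.isOpen_compl.mem_nhds hr] with s hs
    exact h0 s hs
  rw [this.deriv_eq, deriv_const]

lemma eventually_eq_zero_of_Icc {a : ℝ → ℝ} {p q : ℝ} (hp : 0 < p)
    (h0 : ∀ r ∉ Set.Icc p q, a r = 0) : ∀ᶠ r in 𝓝 0, a r = 0 := by
  filter_upwards [gt_mem_nhds hp] with r hr
  exact h0 r fun h => absurd h.1 (not_le.2 hr)

lemma integrable_sphere {F : Type*} [NormedAddCommGroup F] {f : UnitSphere N → F}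
    (hf : Continuous f) : Integrable f (surfaceMeasure N) :=
  hf.integrable_of_hasCompactSupport (HasCompactSupport.of_compactSpace f)

variable [NeZero N]

/-- The variant of `integral_polar_mul` for a sum of two products. -/
lemma integral_polar_mul_add {f : Euc N → ℝ} (hf : AEStronglyMeasurable f volume) {a₁ a₂ : ℝ → ℝ}
    {b₁ b₂ : UnitSphere N → ℝ} (hb₁ : Integrable b₁ (surfaceMeasure N))
    (hb₂ : Integrable b₂ (surfaceMeasure N))
    (ha₁ : IntegrableOn (fun r => r ^ (N - 1) * a₁ r) (Set.Ioi 0))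
    (ha₂ : IntegrableOn (fun r => r ^ (N - 1) * a₂ r) (Set.Ioi 0))
    (h : ∀ r > 0, ∀ θ : UnitSphere N, f (r • (θ : Euc N)) = b₁ θ * a₁ r + b₂ θ * a₂ r) :
    ∫ x, f x = (∫ θ, b₁ θ ∂(surfaceMeasure N)) * (∫ r in Set.Ioi 0, r ^ (N - 1) * a₁ r) +
      (∫ θ, b₂ θ ∂(surfaceMeasure N)) * ∫ r in Set.Ioi 0, r ^ (N - 1) * a₂ r := by
  have e : ∀ a : ℝ → ℝ, ∫ r in Set.Ioi 0, r ^ (N - 1) * a r = ∫ r, a r ∂(radialMeasure N) :=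
    fun a => by rw [integral_radialMeasure]; rfl
  have i₁ := hb₁.mul_prod ((integrable_radialMeasure_iff a₁).2 ha₁)
  have i₂ := hb₂.mul_prod ((integrable_radialMeasure_iff a₂).2 ha₂)
  rw [integral_polar hf, e, e, ← integral_prod_mul, ← integral_prod_mul, ← integral_add i₁ i₂]
  refine integral_congr_ae ?_
  have := (Measure.quasiMeasurePreserving_snd (μ := surfaceMeasure N)
    (ν := radialMeasure N)).ae ae_radialMeasure_pos
  filter_upwards [this] with p hp
  exact h _ hp _

/-- The weighted `L^2` norm of a separated function. -/
lemma integral_separated_sq {a w : ℝ → ℝ} {ψ : Euc N → ℝ} {p q : ℝ} (hp : 0 < p)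
    (ha : ContDiff ℝ ∞ a) (h0 : ∀ r ∉ Set.Icc p q, a r = 0) (hψ : ContDiff ℝ ∞ ψ)
    (hw : Measurable w) :
    ∫ x, separated a ψ x ^ 2 * w ‖x‖ = (∫ θ, ψ (θ : Euc N) ^ 2 ∂(surfaceMeasure N)) *
      ∫ r in Set.Ioi 0, r ^ (N - 1) * (a r ^ 2 * w r) := by
  have hs := contDiff_separated ha (eventually_eq_zero_of_Icc hp h0) hψ
  refine integral_polar_mul ?_ fun r hr θ => ?_
  · exact ((hs.continuous.measurable.pow_const 2).mul
      (hw.comp measurable_norm)).aestronglyMeasurable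
  · rw [separated_smul a ψ hr, norm_smul_unitSphere hr.le]
    ring

/-- The weighted Dirichlet energy of a separated function. -/
lemma integral_gradient_separated_sq {a w : ℝ → ℝ} {ψ : Euc N → ℝ} {p q : ℝ} (hp : 0 < p)
    (ha : ContDiff ℝ ∞ a) (h0 : ∀ r ∉ Set.Icc p q, a r = 0) (hψ : ContDiff ℝ ∞ ψ)
    (hw : Measurable w) (hwc : ContinuousOn w (Set.Ioi 0)) :
    ∫ x, ‖gradient (separated a ψ) x‖ ^ 2 * w ‖x‖ =
      (∫ θ, ψ (θ : Euc N) ^ 2 ∂(surfaceMeasure N)) *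
        (∫ r in Set.Ioi 0, r ^ (N - 1) * (deriv a r ^ 2 * w r)) +
      (∫ θ, ‖tangentialGradient ψ θ‖ ^ 2 ∂(surfaceMeasure N)) *
        ∫ r in Set.Ioi 0, r ^ (N - 1) * ((a r / r) ^ 2 * w r) := by
  have hs := contDiff_separated ha (eventually_eq_zero_of_Icc hp h0) hψ
  have hsub : Set.Icc p q ⊆ Set.Ioi 0 := fun r hr => hp.trans_le hr.1
  have hwc' := hwc.mono hsub
  refine integral_polar_mul_add ?_ ?_ ?_ ?_ ?_ fun r hr θ => ?_
  · exact (((continuous_gradient hs).norm.measurable.pow_const 2).mul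
      (hw.comp measurable_norm)).aestronglyMeasurable
  · exact integrable_sphere ((hψ.continuous.comp continuous_subtype_val).pow 2)
  · exact integrable_sphere ((continuous_tangentialGradient hψ).norm.pow 2)
  · refine (integrable_of_continuousOn_Icc (p := p) (q := q) ?_ fun r hr => ?_).integrableOn
    · exact (continuousOn_id.pow _).mul
        (((ha.continuous_deriv (by simp)).continuousOn.pow 2).mul hwc')
    · simp [deriv_eq_zero_of_notMem_Icc h0 hr]
  · refine (integrable_of_continuousOn_Icc (p := p) (q := q) ?_ fun r hr => ?_).integrableOn
    · exact (continuousOn_id.pow _).mul (((ha.continuous.continuousOn.div continuousOn_id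
        fun r hr => (hsub hr).ne').pow 2).mul hwc')
    · simp [h0 r hr]
  · rw [gradient_separated hr (ha.differentiable (by simp) r).hasDerivAt hψ,
      norm_smul_unitSphere hr.le, norm_add_sq_real, norm_smul, norm_smul, norm_unitSphere,
      inner_smul_left, inner_smul_right, inner_tangentialGradient]
    simp only [mul_zero, add_zero, mul_one, mul_pow, Real.norm_eq_abs, sq_abs]
    ring

end SeparatedEnergy

/-! ### The principal eigenvalue of the sphere -/

section Sphere

variable {N : ℕ}

lemma memLp_sphere {F : Type*} [NormedAddCommGroup F] {f : UnitSphere N → F}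
    (hf : Continuous f) : MemLp f 2 (surfaceMeasure N) :=
  hf.memLp_of_hasCompactSupport (HasCompactSupport.of_compactSpace f)

/-- The restriction to the sphere of a smooth function, as an element of `L^2`. -/
def restrictLp (ψ : Euc N → ℝ) (h : ContDiff ℝ ∞ ψ) : Lp ℝ 2 (surfaceMeasure N) :=
  (memLp_sphere (f := fun θ : UnitSphere N => ψ (θ : Euc N))
    (h.continuous.comp continuous_subtype_val)).toLp _

/-- The tangential gradient of a smooth function, as an element of `L^2`. -/
def tangentialLp (ψ : Euc N → ℝ) (h : ContDiff ℝ ∞ ψ) : Lp (Euc N) 2 (surfaceMeasure N) :=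
  (memLp_sphere (continuous_tangentialGradient h)).toLp _

lemma inner_toLp {α F : Type*} [MeasurableSpace α] {μ : Measure α} [NormedAddCommGroup F]
    [InnerProductSpace ℝ F] {f g : α → F} (hf : MemLp f 2 μ) (hg : MemLp g 2 μ) :
    inner ℝ (hf.toLp f) (hg.toLp g) = ∫ x, inner ℝ (f x) (g x) ∂μ := by
  rw [L2.inner_def]
  refine integral_congr_ae ?_
  filter_upwards [hf.coeFn_toLp, hg.coeFn_toLp] with x h1 h2
  rw [h1, h2]

lemma norm_restrictLp_sq {ψ : Euc N → ℝ} (h : ContDiff ℝ ∞ ψ) :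
    ‖restrictLp ψ h‖ ^ 2 = ∫ θ, ψ (θ : Euc N) ^ 2 ∂(surfaceMeasure N) := by
  rw [← real_inner_self_eq_norm_sq, restrictLp, inner_toLp]
  simp [sq]

lemma norm_tangentialLp_sq {ψ : Euc N → ℝ} (h : ContDiff ℝ ∞ ψ) :
    ‖tangentialLp ψ h‖ ^ 2 = ∫ θ, ‖tangentialGradient ψ θ‖ ^ 2 ∂(surfaceMeasure N) := by
  rw [← real_inner_self_eq_norm_sq, tangentialLp, inner_toLp]
  simp

lemma contDiff_linear_comb {ψ₁ ψ₂ : Euc N → ℝ} (h₁ : ContDiff ℝ ∞ ψ₁) (h₂ : ContDiff ℝ ∞ ψ₂)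
    (s t : ℝ) : ContDiff ℝ ∞ fun x => s * ψ₁ x + t * ψ₂ x :=
  (contDiff_const.mul h₁).add (contDiff_const.mul h₂)

lemma restrictLp_linear_comb {ψ₁ ψ₂ : Euc N → ℝ} (h₁ : ContDiff ℝ ∞ ψ₁) (h₂ : ContDiff ℝ ∞ ψ₂)
    (s t : ℝ) : restrictLp (fun x => s * ψ₁ x + t * ψ₂ x) (contDiff_linear_comb h₁ h₂ s t) =
      s • restrictLp ψ₁ h₁ + t • restrictLp ψ₂ h₂ := by
  rw [restrictLp, restrictLp, restrictLp, ← MemLp.toLp_const_smul, ← MemLp.toLp_const_smul,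
    ← MemLp.toLp_add]
  rfl

lemma tangentialLp_linear_comb {ψ₁ ψ₂ : Euc N → ℝ} (h₁ : ContDiff ℝ ∞ ψ₁)
    (h₂ : ContDiff ℝ ∞ ψ₂) (s t : ℝ) :
    tangentialLp (fun x => s * ψ₁ x + t * ψ₂ x) (contDiff_linear_comb h₁ h₂ s t) =
      s • tangentialLp ψ₁ h₁ + t • tangentialLp ψ₂ h₂ := by
  rw [tangentialLp, tangentialLp, tangentialLp, ← MemLp.toLp_const_smul, ← MemLp.toLp_const_smul,
    ← MemLp.toLp_add]
  congr 1
  funext θ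
  exact tangentialGradient_linear_comb h₁ h₂ s t θ

/-- The infimum of the Rayleigh quotient over the test functions in `C_c^∞(Ω)`. -/
def rayleighInf (Ω : Set (UnitSphere N)) : ℝ :=
  sInf {q | ∃ (ψ : Euc N → ℝ) (h : IsSphereTest Ω ψ),
    ‖restrictLp ψ h.1‖ = 1 ∧ q = ‖tangentialLp ψ h.1‖ ^ 2}

lemma rayleighInf_bddBelow (Ω : Set (UnitSphere N)) :
    BddBelow {q | ∃ (ψ : Euc N → ℝ) (h : IsSphereTest Ω ψ),
      ‖restrictLp ψ h.1‖ = 1 ∧ q = ‖tangentialLp ψ h.1‖ ^ 2} :=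
  ⟨0, by rintro q ⟨ψ, h, -, rfl⟩; positivity⟩

lemma rayleighInf_nonneg (Ω : Set (UnitSphere N)) : 0 ≤ rayleighInf Ω :=
  Real.sInf_nonneg (by rintro q ⟨ψ, h, -, rfl⟩; positivity)

lemma exists_normalized {Ω : Set (UnitSphere N)} {ψ : Euc N → ℝ} (h : IsSphereTest Ω ψ)
    (hn : ‖restrictLp ψ h.1‖ ≠ 0) :
    ∃ (ψ' : Euc N → ℝ) (h' : IsSphereTest Ω ψ'), ‖restrictLp ψ' h'.1‖ = 1 ∧
      ‖tangentialLp ψ' h'.1‖ ^ 2 = ‖tangentialLp ψ h.1‖ ^ 2 / ‖restrictLp ψ h.1‖ ^ 2 := by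
  refine ⟨_, h.linear_comb h ‖restrictLp ψ h.1‖⁻¹ 0, ?_, ?_⟩
  · rw [restrictLp_linear_comb h.1 h.1, zero_smul, add_zero, norm_smul, norm_inv, norm_norm,
      inv_mul_cancel₀ hn]
  · rw [tangentialLp_linear_comb h.1 h.1, zero_smul, add_zero, norm_smul, norm_inv, norm_norm,
      mul_pow, inv_pow, inv_mul_eq_div]

lemma rayleighInf_mul_le {Ω : Set (UnitSphere N)} {ψ : Euc N → ℝ} (h : IsSphereTest Ω ψ) :
    rayleighInf Ω * ‖restrictLp ψ h.1‖ ^ 2 ≤ ‖tangentialLp ψ h.1‖ ^ 2 := by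
  by_cases hn : ‖restrictLp ψ h.1‖ = 0
  · rw [hn]; simp
  · obtain ⟨ψ', h', h1, h2⟩ := exists_normalized h hn
    have := csInf_le (rayleighInf_bddBelow Ω) ⟨ψ', h', h1, h2.symm⟩
    rwa [le_div_iff₀ (by positivity)] at this

lemma exists_sphereTest_norm_eq_one {Ω : Set (UnitSphere N)} (hΩ : IsOpen Ω) (hne : Ω.Nonempty) :
    ∃ (ψ : Euc N → ℝ) (h : IsSphereTest Ω ψ), ‖restrictLp ψ h.1‖ = 1 := by
  obtain ⟨θ, hθ⟩ := hne
  obtain ⟨ε, hε, hb⟩ := Metric.isOpen_iff.1 hΩ θ hθ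
  let φ : ContDiffBump (θ : Euc N) := ⟨ε / 4, ε / 2, by positivity, by linarith⟩
  have hφ : IsSphereTest Ω φ := by
    refine ⟨φ.contDiff, fun x hx => hb ?_⟩
    have h1 := tsupport_comp_subset_preimage (φ : Euc N → ℝ)
      (f := fun θ : UnitSphere N => (θ : Euc N)) continuous_subtype_val hx
    rw [Set.mem_preimage, φ.tsupport_eq] at h1
    have : dist (x : Euc N) θ ≤ ε / 2 := h1
    rw [Metric.mem_ball, Subtype.dist_eq]
    linarith
  have hn : ‖restrictLp φ hφ.1‖ ≠ 0 := by
    have hc : Continuous fun x : UnitSphere N => φ (x : Euc N) ^ 2 :=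
      (φ.continuous.comp continuous_subtype_val).pow 2
    have hpos : 0 < ∫ x : UnitSphere N, φ (x : Euc N) ^ 2 ∂(surfaceMeasure N) := by
      refine hc.integral_pos_of_hasCompactSupport_nonneg_nonzero
        (HasCompactSupport.of_compactSpace _) (fun x => sq_nonneg _) (x := θ) ?_
      simp [φ.one_of_mem_closedBall (Metric.mem_closedBall_self (by positivity))]
    rw [← norm_restrictLp_sq hφ.1] at hpos
    intro h0
    simp [h0] at hpos
  obtain ⟨ψ', h', h1, -⟩ := exists_normalized hφ hn
  exact ⟨ψ', h', h1⟩

end Sphere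

/-! ### Existence of a nonnegative principal eigenfunction -/

section Minimizer

variable {N : ℕ} [NeZero N]

lemma exists_radial_profile (N : ℕ) : ∃ a : ℝ → ℝ, ContDiff ℝ ∞ a ∧
    (∀ r ∉ Set.Icc (1:ℝ) 3, a r = 0) ∧ 0 < ∫ r in Set.Ioi 0, r ^ (N - 1) * (a r ^ 2 * 1) := by
  let φ : ContDiffBump (2 : ℝ) := ⟨1 / 2, 1, by norm_num, by norm_num⟩
  have h0 : ∀ r ∉ Set.Icc (1:ℝ) 3, φ r = 0 := fun r hr => by
    refine φ.zero_of_le_dist ?_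
    rw [Set.mem_Icc, not_and_or, not_le, not_le] at hr
    change (1:ℝ) ≤ |r - 2|
    rw [le_abs]
    rcases hr with hr | hr
    · right; linarith
    · left; linarith
  refine ⟨φ, φ.contDiff, h0, ?_⟩
  rw [setIntegral_eq_integral_of_forall_compl_eq_zero]
  · have hc : Continuous fun r : ℝ => r ^ (N - 1) * (φ r ^ 2 * 1) := by
      have := φ.continuous
      fun_prop
    refine (hc.integral_pos_of_hasCompactSupport_nonneg_nonzero ?_ ?_ (x := 2) ?_)
    · exact HasCompactSupport.intro (isCompact_Icc (a := (1:ℝ)) (b := 3)) fun r hr => by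
        simp [h0 r hr]
    · intro r
      by_cases hr : r ∈ Set.Icc (1:ℝ) 3
      · have : 0 ≤ r := by linarith [hr.1]
        positivity
      · simp [h0 r hr]
    · simp [φ.one_of_mem_closedBall (Metric.mem_closedBall_self (by norm_num))]
  · intro r hr
    rw [h0 r fun h => hr (Set.mem_Ioi.2 (by linarith [h.1]))]
    simp

/-- Rellich's theorem on the sphere. -/
lemma exists_subseq_tendsto_restrictLp {ψ : ℕ → Euc N → ℝ} (h : ∀ n, ContDiff ℝ ∞ (ψ n)) {M : ℝ}
    (h0 : ∀ n, ‖restrictLp (ψ n) (h n)‖ ^ 2 ≤ M) (h1 : ∀ n, ‖tangentialLp (ψ n) (h n)‖ ^ 2 ≤ M) :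
    ∃ (Φ : Lp ℝ 2 (surfaceMeasure N)) (k : ℕ → ℕ), StrictMono k ∧
      Tendsto (fun n => restrictLp (ψ (k n)) (h (k n))) atTop (𝓝 Φ) := by
  obtain ⟨a, ha, ha0, hc⟩ := exists_radial_profile N
  set c : ℝ := ∫ r in Set.Ioi 0, r ^ (N - 1) * (a r ^ 2 * 1) with hcdef
  set c₁ : ℝ := ∫ r in Set.Ioi 0, r ^ (N - 1) * (deriv a r ^ 2 * 1) with hc₁
  set c₂ : ℝ := ∫ r in Set.Ioi 0, r ^ (N - 1) * ((a r / r) ^ 2 * 1) with hc₂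
  have hc₁0 : 0 ≤ c₁ := setIntegral_nonneg measurableSet_Ioi fun r hr => by
    have : 0 < r := hr
    positivity
  have hc₂0 : 0 ≤ c₂ := setIntegral_nonneg measurableSet_Ioi fun r hr => by
    have : 0 < r := hr
    positivity
  have hsq : ∀ φ : Euc N → ℝ, ∀ hφ : ContDiff ℝ ∞ φ,
      ∫ x, separated a φ x ^ 2 = ‖restrictLp φ hφ‖ ^ 2 * c := fun φ hφ => by
    rw [norm_restrictLp_sq, ← integral_separated_sq one_pos ha ha0 hφ measurable_const]
    simp
  have hbe : ∀ n, BoundedEnergy 3 (M * c + (M * c₁ + M * c₂)) (separated a (ψ n)) := fun n => by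
    have hM : 0 ≤ M := (sq_nonneg _).trans (h0 n)
    refine ⟨contDiff_separated ha (eventually_eq_zero_of_Icc one_pos ha0) (h n),
      fun x hx => ?_, ?_, ?_⟩
    · rw [separated, ha0 _ fun h => absurd h.2 (not_le.2 hx), zero_mul]
    · rw [hsq _ (h n)]
      have := mul_le_mul_of_nonneg_right (h0 n) hc.le
      have : 0 ≤ M * c₁ + M * c₂ := by positivity
      linarith
    · have := integral_gradient_separated_sq one_pos ha ha0 (h n) (w := fun _ => 1)
        measurable_const continuousOn_const
      simp only [← norm_restrictLp_sq (h n), ← norm_tangentialLp_sq (h n)] at this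
      rw [← hc₁, ← hc₂] at this
      simp only [mul_one] at this
      rw [this]
      have e1 := mul_le_mul_of_nonneg_right (h0 n) hc₁0
      have e2 := mul_le_mul_of_nonneg_right (h1 n) hc₂0
      have : 0 ≤ M * c := by positivity
      linarith
  have htb : TotallyBounded (Set.range fun n => restrictLp (ψ n) (h n)) := by
    refine Metric.totallyBounded_of_finite_discretization fun ε hε => ?_
    obtain ⟨β, hβ, col, hcol⟩ := exists_finite_discretization (N := N) 3
      (M * c + (M * c₁ + M * c₂)) (ε := ε ^ 2 * c) (by positivity)
    choose idx hidx using fun x : Set.range fun n => restrictLp (ψ n) (h n) => x.2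
    refine ⟨β, Fintype.ofFinite β, fun x => col (separated a (ψ (idx x))), fun x y hxy => ?_⟩
    have h2 := hcol _ _ (hbe _) (hbe _) hxy
    have e : ∀ z, separated a (ψ (idx x)) z - separated a (ψ (idx y)) z =
        separated a (fun z => 1 * ψ (idx x) z + (-1) * ψ (idx y) z) z := fun z => by
      simp only [separated]; ring
    simp only [e] at h2
    rw [hsq _ (contDiff_linear_comb (h _) (h _) _ _), restrictLp_linear_comb (h _) (h _)] at h2
    have h3 := lt_of_mul_lt_mul_right h2 hc.le
    have h4 := (abs_lt_of_sq_lt_sq h3 hε.le)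
    rw [abs_norm, one_smul, neg_one_smul, ← sub_eq_add_neg, ← dist_eq_norm] at h4
    simp only at hidx
    rwa [hidx x, hidx y] at h4
  have hcpt : IsCompact (closure (Set.range fun n => restrictLp (ψ n) (h n))) :=
    isCompact_iff_totallyBounded_isComplete.2 ⟨htb.closure, isClosed_closure.isComplete⟩
  obtain ⟨Φ, -, k, hk, ht⟩ := hcpt.tendsto_subseq
    (x := fun n => restrictLp (ψ n) (h n)) fun n => subset_closure ⟨n, rfl⟩
  exact ⟨Φ, k, hk, ht⟩

omit [NeZero N] in
/-- `√(s² + δ²) - δ` is a smooth nonnegative substitute for `|s|`. -/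
lemma smoothAbs_properties {δ : ℝ} (hδ : 0 < δ) :
    ContDiff ℝ ∞ (fun s : ℝ => √(s ^ 2 + δ ^ 2) - δ) ∧
    (∀ s : ℝ, 0 ≤ √(s ^ 2 + δ ^ 2) - δ) ∧
    (∀ s : ℝ, (√(s ^ 2 + δ ^ 2) - δ) ^ 2 ≤ s ^ 2) ∧
    (∀ s : ℝ, s ^ 2 - δ * (1 + s ^ 2) ≤ (√(s ^ 2 + δ ^ 2) - δ) ^ 2) ∧
    (∀ s : ℝ, ∃ d : ℝ, |d| ≤ 1 ∧ HasDerivAt (fun s : ℝ => √(s ^ 2 + δ ^ 2) - δ) d s) := by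
  have hpos : ∀ s : ℝ, 0 < s ^ 2 + δ ^ 2 := fun s => by positivity
  have hge : ∀ s : ℝ, δ ≤ √(s ^ 2 + δ ^ 2) := fun s =>
    Real.le_sqrt_of_sq_le (by nlinarith [sq_nonneg s])
  have hsq : ∀ s : ℝ, √(s ^ 2 + δ ^ 2) ^ 2 = s ^ 2 + δ ^ 2 := fun s => Real.sq_sqrt (hpos s).le
  refine ⟨?_, fun s => sub_nonneg.2 (hge s), fun s => ?_, fun s => ?_, fun s => ?_⟩
  · exact (ContDiff.sqrt (by fun_prop) fun s => (hpos s).ne').sub contDiff_const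
  · nlinarith [hsq s, hge s]
  · have h1 : √(s ^ 2 + δ ^ 2) ≤ |s| + δ := by
      refine Real.sqrt_le_iff.2 ⟨by positivity, ?_⟩
      nlinarith [sq_abs s, mul_nonneg (abs_nonneg s) hδ.le]
    nlinarith [hsq s, hge s, sq_abs s, sq_nonneg (|s| - 1), mul_nonneg hδ.le (sq_nonneg (|s| - 1))]
  · refine ⟨s / √(s ^ 2 + δ ^ 2), ?_, ?_⟩
    · rw [abs_div, abs_of_nonneg (Real.sqrt_nonneg _), div_le_one (Real.sqrt_pos.2 (hpos s))]
      exact Real.abs_le_sqrt (by nlinarith [sq_nonneg δ])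
    · have h1 : HasDerivAt (fun s : ℝ => s ^ 2 + δ ^ 2) (2 * s) s := by
        simpa using (hasDerivAt_pow 2 s).add_const (δ ^ 2)
      exact ((h1.sqrt (hpos s).ne').sub_const δ).congr_deriv (mul_div_mul_left _ _ two_ne_zero)

omit [NeZero N] in
lemma exists_nonneg_minimizing_sequence {Ω : Set (UnitSphere N)} (hΩ : IsOpen Ω)
    (hne : Ω.Nonempty) :
    ∃ (ψ : ℕ → Euc N → ℝ) (h : ∀ n, IsSphereTest Ω (ψ n)), (∀ n x, 0 ≤ ψ n x) ∧
      (∀ n, ‖restrictLp (ψ n) (h n).1‖ ^ 2 ≤ 1) ∧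
      Tendsto (fun n => ‖restrictLp (ψ n) (h n).1‖ ^ 2) atTop (𝓝 1) ∧
      (∀ n, ‖tangentialLp (ψ n) (h n).1‖ ^ 2 ≤ rayleighInf Ω + 1) ∧
      Tendsto (fun n => ‖tangentialLp (ψ n) (h n).1‖ ^ 2) atTop (𝓝 (rayleighInf Ω)) := by
  set lam := rayleighInf Ω with hlam
  have hex : ∀ n : ℕ, ∃ (ψ : Euc N → ℝ) (h : IsSphereTest Ω ψ), ‖restrictLp ψ h.1‖ = 1 ∧
      ‖tangentialLp ψ h.1‖ ^ 2 < lam + 1 / ((n : ℝ) + 1) := fun n => by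
    obtain ⟨ψ₀, h₀, hn₀⟩ := exists_sphereTest_norm_eq_one hΩ hne
    have hne' : {q | ∃ (ψ : Euc N → ℝ) (h : IsSphereTest Ω ψ),
        ‖restrictLp ψ h.1‖ = 1 ∧ q = ‖tangentialLp ψ h.1‖ ^ 2}.Nonempty :=
      ⟨_, ψ₀, h₀, hn₀, rfl⟩
    obtain ⟨q, ⟨ψ, h, h1, rfl⟩, h2⟩ := exists_lt_of_csInf_lt hne'
      (show rayleighInf Ω < lam + 1 / ((n : ℝ) + 1) from lt_add_of_pos_right _ (by positivity))
    exact ⟨ψ, h, h1, h2⟩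
  choose χ hχ hχ1 hχ2 using hex
  have hδ : ∀ n : ℕ, 0 < 1 / ((n : ℝ) + 1) := fun n => by positivity
  have hδ1 : ∀ n : ℕ, 1 / ((n : ℝ) + 1) ≤ 1 := fun n => by
    rw [div_le_one (by positivity)]
    linarith [(Nat.cast_nonneg n : (0:ℝ) ≤ n)]
  set ψ : ℕ → Euc N → ℝ := fun n x =>
    √(χ n x ^ 2 + (1 / ((n : ℝ) + 1)) ^ 2) - 1 / ((n : ℝ) + 1) with hψdef
  have hψ : ∀ n, IsSphereTest Ω (ψ n) := fun n =>
    (hχ n).comp (smoothAbs_properties (hδ n)).1 (by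
      rw [zero_pow two_ne_zero, zero_add, Real.sqrt_sq (hδ n).le, sub_self])
  have hi : ∀ f : Euc N → ℝ, ContDiff ℝ ∞ f →
      Integrable (fun θ : UnitSphere N => f (θ : Euc N) ^ 2) (surfaceMeasure N) := fun f hf =>
    integrable_sphere ((hf.continuous.comp continuous_subtype_val).pow 2)
  have hit : ∀ f : Euc N → ℝ, ContDiff ℝ ∞ f →
      Integrable (fun θ : UnitSphere N => ‖tangentialGradient f θ‖ ^ 2) (surfaceMeasure N) :=
    fun f hf => integrable_sphere ((continuous_tangentialGradient hf).norm.pow 2)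
  have hle : ∀ n, ‖restrictLp (ψ n) (hψ n).1‖ ^ 2 ≤ 1 := fun n => by
    refine le_trans ?_ (show ‖restrictLp (χ n) (hχ n).1‖ ^ 2 ≤ 1 by rw [hχ1]; norm_num)
    rw [norm_restrictLp_sq, norm_restrictLp_sq]
    exact integral_mono (hi _ (hψ n).1) (hi _ (hχ n).1) fun θ =>
      (smoothAbs_properties (hδ n)).2.2.1 _
  have hge : ∀ n : ℕ, 1 - 1 / ((n : ℝ) + 1) * ((surfaceMeasure N).real Set.univ + 1) ≤
      ‖restrictLp (ψ n) (hψ n).1‖ ^ 2 := fun n => by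
    have h1 : (1:ℝ) = ∫ θ, χ n (θ : Euc N) ^ 2 ∂(surfaceMeasure N) := by
      rw [← norm_restrictLp_sq (hχ n).1, hχ1]; norm_num
    have h2 : ∫ θ, (χ n (θ : Euc N) ^ 2 - 1 / ((n : ℝ) + 1) * (1 + χ n (θ : Euc N) ^ 2))
        ∂(surfaceMeasure N) ≤ ‖restrictLp (ψ n) (hψ n).1‖ ^ 2 := by
      rw [norm_restrictLp_sq]
      refine integral_mono ((hi _ (hχ n).1).sub (((integrable_const 1).add
        (hi _ (hχ n).1)).const_mul _)) (hi _ (hψ n).1) fun θ => ?_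
      exact (smoothAbs_properties (hδ n)).2.2.2.1 _
    have h3 : Integrable (fun θ : UnitSphere N => 1 + χ n (θ : Euc N) ^ 2) (surfaceMeasure N) :=
      (integrable_const 1).add (hi _ (hχ n).1)
    rw [integral_sub (hi _ (hχ n).1) (h3.const_mul _), integral_const_mul,
      integral_add (integrable_const 1) (hi _ (hχ n).1), ← h1] at h2
    simpa using h2
  have htan : ∀ n, ‖tangentialLp (ψ n) (hψ n).1‖ ^ 2 ≤ lam + 1 / ((n : ℝ) + 1) := fun n => by
    refine le_trans ?_ (hχ2 n).le
    rw [norm_tangentialLp_sq, norm_tangentialLp_sq]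
    refine integral_mono (hit _ (hψ n).1) (hit _ (hχ n).1) fun θ => ?_
    obtain ⟨d, hd1, hd2⟩ := (smoothAbs_properties (hδ n)).2.2.2.2 (χ n (θ : Euc N))
    simp only
    rw [hψdef]
    simp only
    rw [tangentialGradient_comp (hχ n).1 hd2, norm_smul, mul_pow, Real.norm_eq_abs]
    have : |d| ^ 2 ≤ 1 := pow_le_one₀ (abs_nonneg d) hd1
    nlinarith [sq_nonneg ‖tangentialGradient (χ n) θ‖]
  have hlim : Tendsto (fun n : ℕ => 1 / ((n : ℝ) + 1)) atTop (𝓝 0) :=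
    tendsto_one_div_add_atTop_nhds_zero_nat
  have hnorm : Tendsto (fun n => ‖restrictLp (ψ n) (hψ n).1‖ ^ 2) atTop (𝓝 1) := by
    refine tendsto_of_tendsto_of_tendsto_of_le_of_le ?_ tendsto_const_nhds hge hle
    simpa using (hlim.mul_const ((surfaceMeasure N).real Set.univ + 1)).const_sub 1
  refine ⟨ψ, hψ, fun n x => (smoothAbs_properties (hδ n)).2.1 _, hle, hnorm,
    fun n => (htan n).trans (by linarith [hδ1 n]), ?_⟩
  refine tendsto_of_tendsto_of_tendsto_of_le_of_le ?_ ?_ (fun n => rayleighInf_mul_le (hψ n)) htan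
  · simpa using hnorm.const_mul (rayleighInf Ω)
  · simpa using hlim.const_add lam

end Minimizer

section Eigenfunction

variable {N : ℕ}

lemma IsSphereH10.exists_tendsto {Ω : Set (UnitSphere N)} {φ : UnitSphere N → ℝ}
    {g : UnitSphere N → Euc N} (h : IsSphereH10 Ω φ g) :
    ∃ (ψ : ℕ → Euc N → ℝ) (hψ : ∀ n, IsSphereTest Ω (ψ n)),
      Tendsto (fun n => restrictLp (ψ n) (hψ n).1) atTop (𝓝 (h.1.toLp φ)) ∧
      Tendsto (fun n => tangentialLp (ψ n) (hψ n).1) atTop (𝓝 (h.2.1.toLp g)) := by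
  obtain ⟨h1, h2, ψ, hψ, t1, t2⟩ := h
  refine ⟨ψ, hψ, ?_, ?_⟩
  · exact (Lp.tendsto_Lp_iff_tendsto_eLpNorm'' _ _ φ h1).2 t1
  · exact (Lp.tendsto_Lp_iff_tendsto_eLpNorm'' _ _ g h2).2 t2

lemma isSphereH10_of_tendsto {Ω : Set (UnitSphere N)} {Φ : Lp ℝ 2 (surfaceMeasure N)}
    {G : Lp (Euc N) 2 (surfaceMeasure N)} {ψ : ℕ → Euc N → ℝ} (hψ : ∀ n, IsSphereTest Ω (ψ n))
    (h1 : Tendsto (fun n => restrictLp (ψ n) (hψ n).1) atTop (𝓝 Φ))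
    (h2 : Tendsto (fun n => tangentialLp (ψ n) (hψ n).1) atTop (𝓝 G)) : IsSphereH10 Ω Φ G := by
  refine ⟨Lp.memLp Φ, Lp.memLp G, ψ, hψ, ?_, ?_⟩
  · exact (Lp.tendsto_Lp_iff_tendsto_eLpNorm'' _ (fun n => memLp_sphere
      ((hψ n).1.continuous.comp continuous_subtype_val)) Φ (Lp.memLp Φ)).1 (by
        rw [Lp.toLp_coeFn]; exact h1)
  · exact (Lp.tendsto_Lp_iff_tendsto_eLpNorm'' _ (fun n => memLp_sphere
      (continuous_tangentialGradient (hψ n).1)) G (Lp.memLp G)).1 (by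
        rw [Lp.toLp_coeFn]; exact h2)

/-- Closed pointwise constraints pass to limits in `L^2`. -/
lemma ae_mem_of_tendsto_eLpNorm {α F : Type*} [MeasurableSpace α] {μ : Measure α}
    [NormedAddCommGroup F] {f : ℕ → α → F} {f₀ : α → F}
    (hf : ∀ n, AEStronglyMeasurable (f n) μ) (hf₀ : AEStronglyMeasurable f₀ μ)
    (h : Tendsto (fun n => eLpNorm (fun x => f n x - f₀ x) 2 μ) atTop (𝓝 0)) {C : α → Set F}
    (hC : ∀ x, IsClosed (C x)) (hmem : ∀ n x, f n x ∈ C x) : ∀ᵐ x ∂μ, f₀ x ∈ C x := by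
  obtain ⟨k, -, hk⟩ :=
    (tendstoInMeasure_of_tendsto_eLpNorm two_ne_zero hf hf₀ h).exists_seq_tendsto_ae
  filter_upwards [hk] with x hx
  exact (hC x).mem_of_tendsto hx (Eventually.of_forall fun n => hmem _ x)

lemma IsSphereH10.ae_eq_zero {Ω : Set (UnitSphere N)} {φ : UnitSphere N → ℝ}
    {g : UnitSphere N → Euc N} (h : IsSphereH10 Ω φ g) :
    ∀ᵐ θ ∂(surfaceMeasure N), θ ∉ Ω → φ θ = 0 := by
  obtain ⟨h1, h2, ψ, hψ, t1, t2⟩ := h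
  have := ae_mem_of_tendsto_eLpNorm (fun n => (memLp_sphere ((hψ n).1.continuous.comp
    continuous_subtype_val)).1) h1.1 t1 (C := fun θ => {s | θ ∉ Ω → s = 0}) (fun θ => ?_)
    (fun n θ hθ => ?_)
  · exact this
  · by_cases hθ : θ ∈ Ω
    · simp [hθ]
    · simp [hθ]
  · exact image_eq_zero_of_notMem_tsupport (f := fun θ : UnitSphere N => ψ n (θ : Euc N))
      fun hh => hθ ((hψ n).2 hh)

lemma IsSphereH10.ae_inner_eq_zero {Ω : Set (UnitSphere N)} {φ : UnitSphere N → ℝ}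
    {g : UnitSphere N → Euc N} (h : IsSphereH10 Ω φ g) :
    ∀ᵐ θ : UnitSphere N ∂(surfaceMeasure N), inner ℝ (θ : Euc N) (g θ) = 0 := by
  obtain ⟨h1, h2, ψ, hψ, t1, t2⟩ := h
  exact ae_mem_of_tendsto_eLpNorm (fun n => (memLp_sphere
    (continuous_tangentialGradient (hψ n).1)).1) h2.1 t2
    (C := fun θ => {v | inner ℝ (θ : Euc N) v = 0})
    (fun θ => isClosed_eq (by fun_prop) continuous_const)
    (fun n θ => inner_tangentialGradient _ _)

lemma IsSphereH10.rayleighInf_mul_le {Ω : Set (UnitSphere N)} {φ : UnitSphere N → ℝ}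
    {g : UnitSphere N → Euc N} (h : IsSphereH10 Ω φ g) :
    rayleighInf Ω * ‖h.1.toLp φ‖ ^ 2 ≤ ‖h.2.1.toLp g‖ ^ 2 := by
  obtain ⟨ψ, hψ, t1, t2⟩ := h.exists_tendsto
  exact le_of_tendsto_of_tendsto' ((t1.norm.pow 2).const_mul _) (t2.norm.pow 2)
    fun n => _root_.rayleighInf_mul_le (hψ n)

/-- Every Dirichlet eigenvalue is at least the infimum of the Rayleigh quotient. -/
lemma rayleighInf_le_of_isDirichletEigenvalue {Ω : Set (UnitSphere N)} {lam : ℝ}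
    (h : IsDirichletEigenvalue Ω lam) : rayleighInf Ω ≤ lam := by
  obtain ⟨φ, g, hH, hne, hweak⟩ := h
  have hpos : 0 < ‖hH.1.toLp φ‖ := by
    rw [norm_pos_iff]
    intro h0
    exact hne (hH.1.coeFn_toLp.symm.trans (by rw [h0]; exact Lp.coeFn_zero _ _ _))
  obtain ⟨ψ, hψ, t1, t2⟩ := hH.exists_tendsto
  have e : ∀ n, inner ℝ (hH.2.1.toLp g) (tangentialLp (ψ n) (hψ n).1) =
      lam * inner ℝ (hH.1.toLp φ) (restrictLp (ψ n) (hψ n).1) := fun n => by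
    rw [tangentialLp, restrictLp, inner_toLp, inner_toLp, hweak _ (hψ n)]
    simp [mul_comm]
  have l1 := (tendsto_const_nhds (x := hH.2.1.toLp g)).inner (𝕜 := ℝ) t2
  have l2 := ((tendsto_const_nhds (x := hH.1.toLp φ)).inner (𝕜 := ℝ) t1).const_mul lam
  simp only [e] at l1
  have := tendsto_nhds_unique l1 l2
  rw [real_inner_self_eq_norm_sq, real_inner_self_eq_norm_sq] at this
  have h2 := hH.rayleighInf_mul_le
  rw [this] at h2
  exact le_of_mul_le_mul_right h2 (by positivity)

variable [NeZero N]

/-- The infimum of the Rayleigh quotient is attained at a nonnegative function, which is an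
eigenfunction. -/
lemma exists_principal_eigenfunction {Ω : Set (UnitSphere N)} (hΩ : IsOpen Ω)
    (hne : Ω.Nonempty) :
    ∃ (φ : UnitSphere N → ℝ) (g : UnitSphere N → Euc N), IsSphereH10 Ω φ g ∧
      (∀ᵐ θ ∂(surfaceMeasure N), 0 ≤ φ θ) ∧ ¬ (φ =ᵐ[surfaceMeasure N] 0) ∧
      ∀ ψ : Euc N → ℝ, IsSphereTest Ω ψ →
        ∫ θ, inner ℝ (g θ) (tangentialGradient ψ θ) ∂(surfaceMeasure N) =
          rayleighInf Ω * ∫ θ, φ θ * ψ (θ : Euc N) ∂(surfaceMeasure N) := by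
  set lam := rayleighInf Ω with hlam
  have hlam0 : 0 ≤ lam := rayleighInf_nonneg Ω
  obtain ⟨χ, hχ, hχ0, b0, t0, b1, t1⟩ := exists_nonneg_minimizing_sequence hΩ hne
  obtain ⟨Φ, k, hk, hΦ⟩ := exists_subseq_tendsto_restrictLp (fun n => (hχ n).1) (M := lam + 1)
    (fun n => (b0 n).trans (by linarith)) b1
  set u : ℕ → Lp ℝ 2 (surfaceMeasure N) := fun n => restrictLp (χ (k n)) (hχ (k n)).1 with hu
  set v : ℕ → Lp (Euc N) 2 (surfaceMeasure N) := fun n => tangentialLp (χ (k n)) (hχ (k n)).1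
    with hv
  have t0' : Tendsto (fun n => ‖u n‖ ^ 2) atTop (𝓝 1) := t0.comp hk.tendsto_atTop
  have t1' : Tendsto (fun n => ‖v n‖ ^ 2) atTop (𝓝 lam) := t1.comp hk.tendsto_atTop
  -- By the parallelogram law the gradients of a minimizing sequence which converges in `L^2` form
  -- a Cauchy sequence.
  have hpar : ∀ m n, ‖v m - v n‖ ^ 2 ≤ 2 * (‖v m‖ ^ 2 - lam * ‖u m‖ ^ 2) +
      2 * (‖v n‖ ^ 2 - lam * ‖u n‖ ^ 2) + lam * ‖u m - u n‖ ^ 2 := fun m n => by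
    have h1 := rayleighInf_mul_le ((hχ (k m)).linear_comb (hχ (k n)) 1 1)
    rw [restrictLp_linear_comb (hχ (k m)).1 (hχ (k n)).1,
      tangentialLp_linear_comb (hχ (k m)).1 (hχ (k n)).1] at h1
    simp only [one_smul] at h1
    have h2 := parallelogram_law_with_norm ℝ (v m) (v n)
    have h3 := parallelogram_law_with_norm ℝ (u m) (u n)
    have h1' : lam * ‖u m + u n‖ ^ 2 ≤ ‖v m + v n‖ ^ 2 := h1
    have h3' : lam * ‖u m + u n‖ ^ 2 =
        lam * (2 * ‖u m‖ ^ 2 + 2 * ‖u n‖ ^ 2 - ‖u m - u n‖ ^ 2) := by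
      congr 1; linarith
    nlinarith
  have hcau : CauchySeq v := by
    have hd : Tendsto (fun n => ‖v n‖ ^ 2 - lam * ‖u n‖ ^ 2) atTop (𝓝 0) := by
      simpa using t1'.sub (t0'.const_mul lam)
    have hd1 : Tendsto (fun p : ℕ × ℕ => 2 * (‖v p.1‖ ^ 2 - lam * ‖u p.1‖ ^ 2) +
        2 * (‖v p.2‖ ^ 2 - lam * ‖u p.2‖ ^ 2) + lam * ‖u p.1 - u p.2‖ ^ 2) atTop (𝓝 0) := by
      rw [← prod_atTop_atTop_eq]
      have e1 := (hd.comp (tendsto_fst (f := atTop (α := ℕ)) (g := atTop (α := ℕ)))).const_mul 2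
      have e2 := (hd.comp (tendsto_snd (f := atTop (α := ℕ)) (g := atTop (α := ℕ)))).const_mul 2
      have e3 := (((hΦ.comp (tendsto_fst (f := atTop (α := ℕ)) (g := atTop (α := ℕ)))).sub
        (hΦ.comp (tendsto_snd (f := atTop (α := ℕ)) (g := atTop (α := ℕ))))).norm.pow
          2).const_mul lam
      simpa using (e1.add e2).add e3
    rw [cauchySeq_iff_tendsto_dist_atTop_0]
    have hs : Tendsto (fun p : ℕ × ℕ => dist (v p.1) (v p.2) ^ 2) atTop (𝓝 0) :=
      squeeze_zero (fun p => sq_nonneg _) (fun p => by rw [dist_eq_norm]; exact hpar _ _) hd1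
    simpa [Real.sqrt_sq dist_nonneg] using hs.sqrt
  obtain ⟨G, hG⟩ := cauchySeq_tendsto_of_complete hcau
  have hΦ' : Tendsto u atTop (𝓝 Φ) := hΦ
  have hnΦ : ‖Φ‖ ^ 2 = 1 := tendsto_nhds_unique (hΦ'.norm.pow 2) t0'
  have hnG : ‖G‖ ^ 2 = lam := tendsto_nhds_unique (hG.norm.pow 2) t1'
  have hH : IsSphereH10 Ω Φ G := isSphereH10_of_tendsto (fun n => hχ (k n)) hΦ hG
  refine ⟨Φ, G, hH, ?_, ?_, fun ψ hψ => ?_⟩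
  · have := (Lp.tendsto_Lp_iff_tendsto_eLpNorm'' _ (fun n => memLp_sphere
      ((hχ (k n)).1.continuous.comp continuous_subtype_val)) Φ (Lp.memLp Φ)).1 (by
        rw [Lp.toLp_coeFn]; exact hΦ)
    exact ae_mem_of_tendsto_eLpNorm (fun n => (memLp_sphere ((hχ (k n)).1.continuous.comp
      continuous_subtype_val)).1) (Lp.memLp Φ).1 this (C := fun θ => Set.Ici 0)
      (fun θ => isClosed_Ici) (fun n θ => hχ0 _ _)
  · intro h0
    have : Φ = 0 := Lp.ext (h0.trans (Lp.coeFn_zero _ _ _).symm)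
    rw [this] at hnΦ
    simp at hnΦ
  · set P := restrictLp ψ hψ.1 with hP
    set Q := tangentialLp ψ hψ.1 with hQ
    have key : ∀ t : ℝ, lam * ‖Φ + t • P‖ ^ 2 ≤ ‖G + t • Q‖ ^ 2 := fun t => by
      refine le_of_tendsto_of_tendsto' (((hΦ'.add_const (t • P)).norm.pow 2).const_mul lam)
        ((hG.add_const (t • Q)).norm.pow 2) fun n => ?_
      have h1 := rayleighInf_mul_le ((hχ (k n)).linear_comb hψ 1 t)
      rw [restrictLp_linear_comb (hχ (k n)).1 hψ.1,
        tangentialLp_linear_comb (hχ (k n)).1 hψ.1] at h1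
      simp only [one_smul] at h1
      exact h1
    have hquad : ∀ t : ℝ, 0 ≤ (‖Q‖ ^ 2 - lam * ‖P‖ ^ 2) * (t * t) +
        2 * (inner ℝ G Q - lam * inner ℝ Φ P) * t + 0 := fun t => by
      have := key t
      rw [norm_add_sq_real, norm_add_sq_real, hnΦ, hnG, norm_smul, norm_smul, inner_smul_right,
        inner_smul_right, mul_pow, mul_pow, Real.norm_eq_abs, sq_abs] at this
      nlinarith
    have hdisc := discrim_le_zero hquad
    rw [discrim] at hdisc
    have hz : inner ℝ G Q - lam * inner ℝ Φ P = 0 := by nlinarith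
    have e1 : inner ℝ G Q = ∫ θ, inner ℝ (G θ) (tangentialGradient ψ θ) ∂(surfaceMeasure N) := by
      rw [hQ, tangentialLp, ← inner_toLp (Lp.memLp G), Lp.toLp_coeFn]
    have e2 : inner ℝ Φ P = ∫ θ, Φ θ * ψ (θ : Euc N) ∂(surfaceMeasure N) := by
      rw [hP, restrictLp]
      have := inner_toLp (Lp.memLp Φ) (memLp_sphere (f := fun θ : UnitSphere N => ψ (θ : Euc N))
        (hψ.1.continuous.comp continuous_subtype_val))
      rw [Lp.toLp_coeFn] at this
      rw [this]
      simp [mul_comm]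
    rw [← e1, ← e2]
    linarith

/-- The principal Dirichlet eigenvalue is the infimum of the Rayleigh quotient. -/
lemma principalDirichletEigenvalue_eq {Ω : Set (UnitSphere N)} (hΩ : IsOpen Ω)
    (hne : Ω.Nonempty) : principalDirichletEigenvalue Ω = rayleighInf Ω := by
  obtain ⟨φ, g, h1, -, h2, h3⟩ := exists_principal_eigenfunction hΩ hne
  exact IsLeast.csInf_eq ⟨⟨φ, g, h1, h2, h3⟩, fun lam h =>
    rayleighInf_le_of_isDirichletEigenvalue h⟩

end Eigenfunction

/-! ### The homogeneous extension of an eigenfunction is weakly harmonic -/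

/-- The Laplacian `∑ ∂ᵢ∂ᵢ η` in Euclidean coordinates. -/
def coordLaplacian {N : ℕ} (η : Euc N → ℝ) (x : Euc N) : ℝ :=
  ∑ i, gradient (fun y => gradient η y i) x i

section WeaklyHarmonic

variable {N : ℕ}

lemma contDiff_gradient_apply {f : Euc N → ℝ} (hf : ContDiff ℝ ∞ f) (i : Fin N) :
    ContDiff ℝ ∞ fun x => gradient f x i :=
  (EuclideanSpace.proj i : Euc N →L[ℝ] ℝ).contDiff.comp (contDiff_gradient hf)

lemma tsupport_gradient_apply_subset (f : Euc N → ℝ) (i : Fin N) :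
    tsupport (fun x => gradient f x i) ⊆ tsupport f :=
  closure_minimal (fun x hx => by_contra fun h => hx (by
    simp [gradient_eq_zero_of_notMem_tsupport h])) (isClosed_tsupport f)

lemma hasCompactSupport_gradient_apply {f : Euc N → ℝ} (hf : HasCompactSupport f) (i : Fin N) :
    HasCompactSupport fun x => gradient f x i :=
  hf.of_isClosed_subset (isClosed_tsupport _) (tsupport_gradient_apply_subset f i)

lemma continuous_coordLaplacian {η : Euc N → ℝ} (hη : ContDiff ℝ ∞ η) :
    Continuous (coordLaplacian η) :=
  continuous_finsetSum _ fun i _ =>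
    (contDiff_gradient_apply (contDiff_gradient_apply hη i) i).continuous

lemma coordLaplacian_eq_zero_of_notMem_tsupport {η : Euc N → ℝ} {x : Euc N}
    (hx : x ∉ tsupport η) : coordLaplacian η x = 0 := by
  refine Finset.sum_eq_zero fun i _ => ?_
  rw [gradient_eq_zero_of_notMem_tsupport fun h => hx (tsupport_gradient_apply_subset η i h)]
  rfl

lemma hasCompactSupport_coordLaplacian {η : Euc N → ℝ} (hη : HasCompactSupport η) :
    HasCompactSupport (coordLaplacian η) :=
  HasCompactSupport.intro hη fun _ hx => coordLaplacian_eq_zero_of_notMem_tsupport hx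

lemma integral_mul_coordLaplacian {f η : Euc N → ℝ} (hf : ContDiff ℝ ∞ f) (hη : ContDiff ℝ ∞ η)
    (hs : HasCompactSupport η) :
    ∫ x, f x * coordLaplacian η x = - ∫ x, inner ℝ (gradient f x) (gradient η x) := by
  simp only [coordLaplacian, Finset.mul_sum, euc_inner_eq_sum]
  rw [integral_finsetSum, integral_finsetSum, ← Finset.sum_neg_distrib]
  · exact Finset.sum_congr rfl fun i _ => integral_mul_gradient_apply hf
      (contDiff_gradient_apply hη i) (hasCompactSupport_gradient_apply hs i) i
  · intro i _
    exact ((contDiff_gradient_apply hf i).continuous.mul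
      (contDiff_gradient_apply hη i).continuous).integrable_of_hasCompactSupport
        (hasCompactSupport_gradient_apply hs i).mul_left
  · intro i _
    exact (hf.continuous.mul (contDiff_gradient_apply
      (contDiff_gradient_apply hη i) i).continuous).integrable_of_hasCompactSupport
        (hasCompactSupport_gradient_apply (hasCompactSupport_gradient_apply hs i) i).mul_left

/-- The radial moment `θ ↦ ∫ b(r) w(rθ) r^(N-1) dr`. -/
def radialMoment {F : Type*} [NormedAddCommGroup F] [NormedSpace ℝ F] (b : ℝ → ℝ) (w : Euc N → F)
    (θ : UnitSphere N) : F :=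
  ∫ r, b r • w (r • (θ : Euc N)) ∂(radialMeasure N)

section Moment

variable {F : Type*} [NormedAddCommGroup F] [InnerProductSpace ℝ F] [FiniteDimensional ℝ F]
  {b : ℝ → ℝ} {w : Euc N → F} {C : ℝ}

omit [FiniteDimensional ℝ F] in
lemma continuous_radialMoment (hb : Integrable b (radialMeasure N)) (hw : Continuous w)
    (hC : ∀ x, ‖w x‖ ≤ C) : Continuous (radialMoment (N := N) b w) := by
  refine continuous_of_dominated (bound := fun r => |b r| * C) (fun θ => ?_)
    (fun θ => ae_of_all _ fun r => ?_) (hb.abs.mul_const C) (ae_of_all _ fun r => ?_)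
  · exact hb.aestronglyMeasurable.smul
      (hw.comp (continuous_id.smul continuous_const)).aestronglyMeasurable
  · rw [norm_smul]
    exact mul_le_mul_of_nonneg_left (hC _) (abs_nonneg _)
  · exact (hw.comp (continuous_subtype_val.const_smul r)).const_smul (b r)

lemma integrable_inner_radial {f : UnitSphere N → F} (hf : MemLp f 2 (surfaceMeasure N))
    (hb : Integrable b (radialMeasure N)) (hw : Continuous w) (hC : ∀ x, ‖w x‖ ≤ C) :
    Integrable (fun p : UnitSphere N × ℝ => inner ℝ (f p.1) (b p.2 • w (p.2 • (p.1 : Euc N))))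
      ((surfaceMeasure N).prod (radialMeasure N)) := by
  have h1 : Integrable f (surfaceMeasure N) := hf.integrable (by norm_num)
  refine (((h1.norm.mul_prod hb.abs).mul_const C)).mono' ?_ (ae_of_all _ fun p => ?_)
  · exact h1.aestronglyMeasurable.comp_fst.inner (hb.aestronglyMeasurable.comp_snd.smul
      (hw.comp (by fun_prop)).aestronglyMeasurable)
  · calc _ ≤ ‖f p.1‖ * ‖b p.2 • w (p.2 • (p.1 : Euc N))‖ := norm_inner_le_norm _ _
      _ ≤ ‖f p.1‖ * (|b p.2| * C) := by
        rw [norm_smul]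
        gcongr
        · exact le_of_eq (Real.norm_eq_abs _)
        · exact hC _
      _ = _ := by ring

lemma integral_inner_radial {f : UnitSphere N → F} (hf : MemLp f 2 (surfaceMeasure N))
    (hb : Integrable b (radialMeasure N)) (hw : Continuous w) (hC : ∀ x, ‖w x‖ ≤ C) :
    ∫ p, inner ℝ (f p.1) (b p.2 • w (p.2 • (p.1 : Euc N)))
      ∂((surfaceMeasure N).prod (radialMeasure N)) =
    ∫ θ, inner ℝ (f θ) (radialMoment b w θ) ∂(surfaceMeasure N) := by
  rw [integral_prod _ (integrable_inner_radial hf hb hw hC)]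
  refine integral_congr_ae (ae_of_all _ fun θ => ?_)
  exact integral_inner ((hb.smul_bdd C (hw.comp (by fun_prop)).aestronglyMeasurable
    (ae_of_all _ fun r => hC _))) (f θ)

end Moment

lemma norm_le_of_hasCompactSupport {F : Type*} [NormedAddCommGroup F] {w : Euc N → F}
    (hw : Continuous w) (hs : HasCompactSupport w) : ∃ C, ∀ x, ‖w x‖ ≤ C :=
  hw.bounded_above_of_compact_support hs

/-- A smooth compactly supported modification of `r ↦ r^α` which is unchanged near `[p, q]`. -/
lemma exists_rpow_cutoff {p q : ℝ} (hp : 0 < p) (hpq : p ≤ q) (α : ℝ) :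
    ∃ a : ℝ → ℝ, ContDiff ℝ ∞ a ∧ (∀ r ∉ Set.Icc (p / 2) (q + p), a r = 0) ∧
      ∀ r ∈ Set.Icc p q, a =ᶠ[𝓝 r] fun s => s ^ α := by
  let χ : ContDiffBump ((p + q) / 2 : ℝ) :=
    ⟨(q - p) / 2 + p / 4, (q - p) / 2 + p / 2, by linarith, by linarith⟩
  have h0 : ∀ r ∉ Set.Icc (p / 2) (q + p), χ r = 0 := fun r hr => by
    refine χ.zero_of_le_dist ?_
    rw [Set.mem_Icc, not_and_or, not_le, not_le] at hr
    change (q - p) / 2 + p / 2 ≤ |r - (p + q) / 2|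
    rw [le_abs]
    rcases hr with hr | hr
    · right; linarith
    · left; linarith
  refine ⟨fun r => χ r * r ^ α, contDiff_iff_contDiffAt.2 fun r => ?_, fun r hr => by
    simp [h0 r hr], fun r hr => ?_⟩
  · by_cases hr : r = 0
    · have : (fun r => χ r * r ^ α) =ᶠ[𝓝 r] fun _ => 0 := by
        filter_upwards [gt_mem_nhds (show r < p / 2 by rw [hr]; positivity)] with s hs
        rw [h0 s fun h => absurd h.1 (not_le.2 hs), zero_mul]
      exact contDiffAt_const.congr_of_eventuallyEq this
    · exact χ.contDiffAt.mul (Real.contDiffAt_rpow_const_of_ne hr)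
  · have hb : r ∈ Metric.ball ((p + q) / 2) ((q - p) / 2 + p / 4) := by
      rw [Metric.mem_ball, Real.dist_eq, abs_lt]
      constructor <;> linarith [hr.1, hr.2]
    filter_upwards [Metric.isOpen_ball.mem_nhds hb] with s hs
    rw [χ.one_of_mem_closedBall (Metric.ball_subset_closedBall hs), one_mul]

lemma integrable_radialMeasure_of_Icc {b : ℝ → ℝ} {p q : ℝ} (hb : ContinuousOn b (Set.Icc p q))
    (h0 : ∀ r ∉ Set.Icc p q, b r = 0) : Integrable b (radialMeasure N) := by
  rw [integrable_radialMeasure_iff]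
  refine (integrable_of_continuousOn_Icc (p := p) (q := q)
    ((continuousOn_id.pow _).smul hb) fun r hr => ?_).integrableOn
  simp [h0 r hr]

/-- Integration by parts in the radial direction: `r^α` is an eigenfunction of the radial part of
the Laplacian. -/
lemma radialMoment_deriv [NeZero N] {η : Euc N → ℝ} (hη : ContDiff ℝ ∞ η) {p q α : ℝ} (hp : 0 < p)
    (hsupp : ∀ x ∈ tsupport η, ‖x‖ ∈ Set.Icc p q) {a : ℝ → ℝ} (ha : ContDiff ℝ ∞ a)
    (ha0 : ∀ r ∉ Set.Icc (p / 2) (q + p), a r = 0)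
    (haα : ∀ r ∈ Set.Icc p q, a =ᶠ[𝓝 r] fun s => s ^ α) (θ : UnitSphere N) :
    radialMoment (fun r => deriv a r / r) (fun x => inner ℝ x (gradient η x)) θ =
      -(α * (α + N - 2)) * radialMoment (fun r => a r / r ^ 2) η θ := by
  set u : ℝ → ℝ := fun r => r ^ (N - 1) * deriv a r with hu
  set h : ℝ → ℝ := fun r => η (r • (θ : Euc N)) with hh
  have hda : ContDiff ℝ ∞ (deriv a) := ContDiff.deriv' (n := ∞) (by simpa using ha)
  have huc : ContDiff ℝ ∞ u := (contDiff_id.pow _).mul hda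
  have hhc : ContDiff ℝ ∞ h := hη.comp (contDiff_id.smul contDiff_const)
  have hd : ∀ r, HasDerivAt h (inner ℝ (θ : Euc N) (gradient η (r • (θ : Euc N)))) r := fun r => by
    have h1 : HasDerivAt (fun r : ℝ => r • (θ : Euc N)) (θ : Euc N) r := by
      simpa using (hasDerivAt_id r).smul_const (θ : Euc N)
    have := ((hη.differentiable (by simp)) (r • (θ : Euc N))).hasFDerivAt.comp_hasDerivAt r h1
    rwa [← inner_gradient_left, real_inner_comm] at this
  have hda0 : ∀ r ∉ Set.Icc (p / 2) (q + p), deriv a r = 0 := fun r hr =>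
    deriv_eq_zero_of_notMem_Icc ha0 hr
  have hu0 : ∀ r ∉ Set.Icc (p / 2) (q + p), u r = 0 := fun r hr => by simp [hu, hda0 r hr]
  have hus : HasCompactSupport u := HasCompactSupport.intro isCompact_Icc hu0
  have hpos : ∀ r ∉ Set.Ioi (0:ℝ), r ∉ Set.Icc (p / 2) (q + p) := fun r hr hr' =>
    hr (Set.mem_Ioi.2 (by linarith [hr'.1]))
  have e1 : radialMoment (fun r => deriv a r / r) (fun x => inner ℝ x (gradient η x)) θ =
      ∫ r, u r * deriv h r := by
    rw [radialMoment, integral_radialMeasure,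
      ← setIntegral_eq_integral_of_forall_compl_eq_zero (s := Set.Ioi (0:ℝ))
        (f := fun r => u r * deriv h r) (fun r hr => by rw [hu0 r (hpos r hr), zero_mul])]
    refine setIntegral_congr_fun measurableSet_Ioi fun r hr => ?_
    have hr : (0:ℝ) < r := hr
    simp only [hu, (hd r).deriv, smul_eq_mul, inner_smul_left, RCLike.conj_to_real]
    field_simp
  have e2 : (α * (α + N - 2)) * radialMoment (fun r => a r / r ^ 2) η θ =
      ∫ r, deriv u r * h r := by
    rw [radialMoment, integral_radialMeasure, ← integral_const_mul,
      ← setIntegral_eq_integral_of_forall_compl_eq_zero (s := Set.Ioi (0:ℝ))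
        (f := fun r => deriv u r * h r) (fun r hr => by
          rw [deriv_eq_zero_of_notMem_Icc hu0 (hpos r hr), zero_mul])]
    refine setIntegral_congr_fun measurableSet_Ioi fun r hr => ?_
    have hr : (0:ℝ) < r := hr
    simp only [smul_eq_mul]
    change _ * (_ * (_ * h r)) = _
    by_cases hhr : h r = 0
    · simp [hhr]
    have hrI : r ∈ Set.Icc p q := by
      have := hsupp _ (subset_tsupport η (Function.mem_support.2 hhr))
      rwa [norm_smul_unitSphere hr.le] at this
    have hN : ((N - 1 : ℕ) : ℝ) = N - 1 := by
      rw [Nat.cast_sub (NeZero.one_le), Nat.cast_one]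
    have hev : u =ᶠ[𝓝 r] fun s => α * s ^ ((N : ℝ) + α - 2) := by
      filter_upwards [(haα r hrI).deriv, lt_mem_nhds hr] with s hs hs0
      simp only [hu]
      rw [hs, (Real.hasDerivAt_rpow_const (Or.inl hs0.ne')).deriv, ← Real.rpow_natCast, hN,
        mul_left_comm, ← Real.rpow_add hs0]
      congr 2
      ring
    rw [hev.deriv_eq, ((Real.hasDerivAt_rpow_const (Or.inl hr.ne')).const_mul α).deriv,
      (haα r hrI).eq_of_nhds, ← Real.rpow_natCast r (N - 1), hN, ← Real.rpow_natCast r 2,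
      ← Real.rpow_sub hr]
    have : r ^ ((N : ℝ) + α - 2 - 1) = r ^ ((N : ℝ) - 1) * r ^ (α - ((2 : ℕ) : ℝ)) := by
      rw [← Real.rpow_add hr]
      congr 1
      push_cast
      ring
    rw [this]
    ring
  have hcu : Continuous (deriv u) := huc.continuous_deriv (by simp)
  have hch : Continuous (deriv h) := hhc.continuous_deriv (by simp)
  have ibp := integral_mul_deriv_eq_deriv_mul_of_integrable
    (fun r _ => ((huc.differentiable (by simp)) r).hasDerivAt)
    (fun r _ => ((hhc.differentiable (by simp)) r).hasDerivAt)
    ((huc.continuous.mul hch).integrable_of_hasCompactSupport hus.mul_right)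
    ((hcu.mul hhc.continuous).integrable_of_hasCompactSupport hus.deriv.mul_right)
    ((huc.continuous.mul hhc.continuous).integrable_of_hasCompactSupport hus.mul_right)
  rw [e1, ibp, neg_mul, e2]

end WeaklyHarmonic

section HomogeneousExtension

variable {N : ℕ} [NeZero N]

/-- The extension of `φ` from the sphere to `ℝ^N` which is homogeneous of degree `α`. -/
def homogeneousExt (α : ℝ) (φ : UnitSphere N → ℝ) (x : Euc N) : ℝ := ‖x‖ ^ α * φ (dir x)

lemma aestronglyMeasurable_comp_dir {F : Type*} [NormedAddCommGroup F] {φ : UnitSphere N → F}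
    (hφ : AEStronglyMeasurable φ (surfaceMeasure N)) :
    AEStronglyMeasurable (fun x : Euc N => φ (dir x)) volume :=
  hφ.comp_quasiMeasurePreserving
    (Measure.quasiMeasurePreserving_fst.comp measurePreserving_polar.quasiMeasurePreserving)

lemma aestronglyMeasurable_homogeneousExt {α : ℝ} {φ : UnitSphere N → ℝ}
    (hφ : AEStronglyMeasurable φ (surfaceMeasure N)) :
    AEStronglyMeasurable (homogeneousExt α φ) volume :=
  (measurable_norm.pow_const α).aestronglyMeasurable.mul (aestronglyMeasurable_comp_dir hφ)

lemma mem_coneLike_iff {Ω : Set (UnitSphere N)} {ρ : ℝ} (hρ : 0 ≤ ρ) {x : Euc N} :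
    x ∈ coneLike Ω ρ ↔ ρ < ‖x‖ ∧ dir x ∈ Ω := by
  refine and_congr_right fun hx => ⟨?_, fun h => ⟨dir x, h, (norm_smul_dir x).symm⟩⟩
  rintro ⟨θ, hθ, h⟩
  have h0 : 0 < ‖x‖ := hρ.trans_lt hx
  rw [h, dir_smul_unitSphere h0]
  exact hθ

lemma smul_mem_coneLike_iff {Ω : Set (UnitSphere N)} {r : ℝ} (hr : 0 < r) {θ : UnitSphere N} :
    r • (θ : Euc N) ∈ coneLike Ω 0 ↔ θ ∈ Ω := by
  rw [mem_coneLike_iff le_rfl, norm_smul_unitSphere hr.le, dir_smul_unitSphere hr]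
  simp [hr]

omit [NeZero N] in
lemma exists_norm_bounds {Ω : Set (UnitSphere N)} {K : Set (Euc N)} (hK : IsCompact K)
    (h : K ⊆ coneLike Ω 0) : ∃ p q : ℝ, 0 < p ∧ p ≤ q ∧ ∀ x ∈ K, ‖x‖ ∈ Set.Icc p q := by
  rcases K.eq_empty_or_nonempty with rfl | hne
  · exact ⟨1, 1, one_pos, le_rfl, by simp⟩
  obtain ⟨x, hx, hmin⟩ := hK.exists_isMinOn hne continuous_norm.continuousOn
  obtain ⟨y, hy, hmax⟩ := hK.exists_isMaxOn hne continuous_norm.continuousOn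
  exact ⟨‖x‖, ‖y‖, (h hx).1, hmax hx, fun z hz => ⟨hmin hz, hmax hz⟩⟩

lemma isSphereTest_comp_smul {Ω : Set (UnitSphere N)} {η : Euc N → ℝ} (hη : ContDiff ℝ ∞ η)
    (hsupp : tsupport η ⊆ coneLike Ω 0) {r : ℝ} (hr : 0 < r) :
    IsSphereTest Ω fun x => η (r • x) := by
  refine ⟨hη.comp (contDiff_id.const_smul r), fun θ hθ => ?_⟩
  have := tsupport_comp_subset_preimage η (f := fun θ : UnitSphere N => r • (θ : Euc N))
    (continuous_subtype_val.const_smul r) hθ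
  exact (smul_mem_coneLike_iff hr).1 (hsupp this)

/-- If `φ` is an eigenfunction with eigenvalue `α (α + N - 2)`, then its homogeneous extension of
degree `α` is harmonic in the cone, in the sense of distributions. The identity is tested on the
homogeneous extensions of smooth approximations of `φ`, which are cut off near the support of the
test function. -/
lemma integral_homogeneousExt_mul_coordLaplacian {Ω : Set (UnitSphere N)} {φ : UnitSphere N → ℝ}
    {g : UnitSphere N → Euc N} (hH : IsSphereH10 Ω φ g) {α : ℝ}
    (hweak : ∀ ψ : Euc N → ℝ, IsSphereTest Ω ψ →
      ∫ θ, inner ℝ (g θ) (tangentialGradient ψ θ) ∂(surfaceMeasure N) =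
        (α * (α + N - 2)) * ∫ θ, φ θ * ψ (θ : Euc N) ∂(surfaceMeasure N))
    {η : Euc N → ℝ} (hη : ContDiff ℝ ∞ η) (hs : HasCompactSupport η)
    (hsupp : tsupport η ⊆ coneLike Ω 0) :
    ∫ x, homogeneousExt α φ x * coordLaplacian η x = 0 := by
  obtain ⟨p, q, hp, hpq, hpqη⟩ := exists_norm_bounds hs hsupp
  obtain ⟨a, ha, ha0, haα⟩ := exists_rpow_cutoff hp hpq α
  have hη' := continuous_gradient hη
  have hac : ∀ r : ℝ, r ∈ Set.Icc (p / 2) (q + p) → r ≠ 0 := fun r hr =>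
    (by linarith [hr.1] : 0 < r).ne'
  have hda0 : ∀ r ∉ Set.Icc (p / 2) (q + p), deriv a r = 0 := fun r hr =>
    deriv_eq_zero_of_notMem_Icc ha0 hr
  have hcda : Continuous (deriv a) := ha.continuous_deriv (by simp)
  -- the radial weights of the three moments
  have hb₀ : Integrable a (radialMeasure N) :=
    integrable_radialMeasure_of_Icc ha.continuous.continuousOn ha0
  have hb₁ : Integrable (fun r => deriv a r / r) (radialMeasure N) :=
    integrable_radialMeasure_of_Icc (hcda.continuousOn.div continuousOn_id hac)
      fun r hr => by simp [hda0 r hr]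
  have hb₂ : Integrable (fun r => a r / r) (radialMeasure N) :=
    integrable_radialMeasure_of_Icc (ha.continuous.continuousOn.div continuousOn_id hac)
      fun r hr => by simp [ha0 r hr]
  have hb₃ : Integrable (fun r => a r / r ^ 2) (radialMeasure N) :=
    integrable_radialMeasure_of_Icc (ha.continuous.continuousOn.div (continuousOn_id.pow 2)
      fun r hr => pow_ne_zero 2 (hac r hr)) fun r hr => by simp [ha0 r hr]
  have hLc := continuous_coordLaplacian hη
  obtain ⟨C₀, hC₀⟩ := norm_le_of_hasCompactSupport hLc (hasCompactSupport_coordLaplacian hs)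
  have hw₁ : Continuous fun x => inner ℝ x (gradient η x) := by fun_prop
  obtain ⟨C₁, hC₁⟩ := norm_le_of_hasCompactSupport hw₁ (HasCompactSupport.intro hs fun x hx => by
    rw [gradient_eq_zero_of_notMem_tsupport hx, inner_zero_right])
  obtain ⟨C₂, hC₂⟩ := norm_le_of_hasCompactSupport hη' (hasCompactSupport_gradient hs)
  obtain ⟨C₃, hC₃⟩ := norm_le_of_hasCompactSupport hη.continuous hs
  set m₀ := radialMoment (N := N) a (coordLaplacian η) with hm₀
  set m₁ := radialMoment (N := N) (fun r => deriv a r / r) (fun x => inner ℝ x (gradient η x))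
    with hm₁
  set m₂ := radialMoment (N := N) (fun r => a r / r) (gradient η) with hm₂
  set m₃ := radialMoment (N := N) (fun r => a r / r ^ 2) η with hm₃
  have hm₀c : MemLp m₀ 2 (surfaceMeasure N) := memLp_sphere (continuous_radialMoment hb₀ hLc hC₀)
  have hm₁c : MemLp m₁ 2 (surfaceMeasure N) := memLp_sphere (continuous_radialMoment hb₁ hw₁ hC₁)
  have hm₂c : MemLp m₂ 2 (surfaceMeasure N) := memLp_sphere (continuous_radialMoment hb₂ hη' hC₂)
  have hm₃c : MemLp m₃ 2 (surfaceMeasure N) :=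
    memLp_sphere (continuous_radialMoment hb₃ hη.continuous hC₃)
  have hposae : ∀ᵐ z ∂((surfaceMeasure N).prod (radialMeasure N)), 0 < z.2 :=
    (Measure.quasiMeasurePreserving_snd (μ := surfaceMeasure N)
      (ν := radialMeasure N)).ae ae_radialMeasure_pos
  -- the identity for smooth functions on the sphere
  have hsmooth : ∀ (ψ : Euc N → ℝ) (hψ : ContDiff ℝ ∞ ψ),
      inner ℝ (restrictLp ψ hψ) (hm₀c.toLp m₀) = -(inner ℝ (restrictLp ψ hψ) (hm₁c.toLp m₁) +
        inner ℝ (tangentialLp ψ hψ) (hm₂c.toLp m₂)) := fun ψ hψ => by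
    have hFc := contDiff_separated ha
      (eventually_eq_zero_of_Icc (by positivity : 0 < p / 2) ha0) hψ
    have hψL : MemLp (fun θ : UnitSphere N => ψ (θ : Euc N)) 2 (surfaceMeasure N) :=
      memLp_sphere (hψ.continuous.comp continuous_subtype_val)
    have hψT := memLp_sphere (continuous_tangentialGradient hψ)
    have h1 := integral_mul_coordLaplacian hFc hη hs
    rw [integral_polar (f := fun x => separated a ψ x * coordLaplacian η x)
        (hFc.continuous.mul hLc).aestronglyMeasurable,
      integral_polar ((continuous_gradient hFc).inner hη').aestronglyMeasurable] at h1
    rw [restrictLp, tangentialLp, inner_toLp, inner_toLp, inner_toLp,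
      ← integral_inner_radial hψL hb₀ hLc hC₀, ← integral_inner_radial hψL hb₁ hw₁ hC₁,
      ← integral_inner_radial hψT hb₂ hη' hC₂,
      ← integral_add (integrable_inner_radial hψL hb₁ hw₁ hC₁)
        (integrable_inner_radial hψT hb₂ hη' hC₂)]
    convert h1 using 1
    · refine integral_congr_ae ?_
      filter_upwards [hposae] with z hz
      rw [separated_smul a ψ hz]
      simp
      ring
    · congr 1
      refine integral_congr_ae ?_
      filter_upwards [hposae] with z hz
      rw [gradient_separated hz (ha.differentiable (by simp) z.2).hasDerivAt hψ]
      simp only [inner_add_left, inner_smul_left, inner_smul_right, RCLike.conj_to_real,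
        smul_eq_mul, RCLike.inner_apply]
      field_simp
  obtain ⟨ψ, hψ, t1, t2⟩ := hH.exists_tendsto
  have hlim : inner ℝ (hH.1.toLp φ) (hm₀c.toLp m₀) =
      -(inner ℝ (hH.1.toLp φ) (hm₁c.toLp m₁) + inner ℝ (hH.2.1.toLp g) (hm₂c.toLp m₂)) := by
    have l1 := t1.inner (𝕜 := ℝ) (tendsto_const_nhds (x := hm₀c.toLp m₀))
    have l2 := ((t1.inner (𝕜 := ℝ) (tendsto_const_nhds (x := hm₁c.toLp m₁))).add
      (t2.inner (𝕜 := ℝ) (tendsto_const_nhds (x := hm₂c.toLp m₂)))).neg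
    simp only [hsmooth] at l1
    exact tendsto_nhds_unique l1 l2
  -- the angular part, by the weak equation on each sphere
  have hang : inner ℝ (hH.2.1.toLp g) (hm₂c.toLp m₂) =
      (α * (α + N - 2)) * inner ℝ (hH.1.toLp φ) (hm₃c.toLp m₃) := by
    rw [inner_toLp, inner_toLp, ← integral_inner_radial hH.2.1 hb₂ hη' hC₂,
      ← integral_inner_radial hH.1 hb₃ hη.continuous hC₃,
      integral_prod_symm _ (integrable_inner_radial hH.2.1 hb₂ hη' hC₂),
      integral_prod_symm _ (integrable_inner_radial hH.1 hb₃ hη.continuous hC₃),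
      ← integral_const_mul]
    refine integral_congr_ae ?_
    filter_upwards [ae_radialMeasure_pos] with r hr
    have hw := hweak _ (isSphereTest_comp_smul hη hsupp hr)
    have e1 : ∫ θ, inner ℝ (g θ) ((a r / r) • gradient η (r • (θ : Euc N))) ∂(surfaceMeasure N) =
        (a r / r ^ 2) * ∫ θ, inner ℝ (g θ) (tangentialGradient (fun x => η (r • x)) θ)
          ∂(surfaceMeasure N) := by
      rw [← integral_const_mul]
      refine integral_congr_ae ?_
      filter_upwards [hH.ae_inner_eq_zero] with θ hθ
      rw [real_inner_comm] at hθ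
      rw [tangentialGradient, gradient_comp_smul hη, inner_sub_right, inner_smul_right,
        inner_smul_right, inner_smul_right, hθ]
      field_simp
      ring
    rw [e1, hw, ← mul_assoc, mul_comm (a r / r ^ 2), mul_assoc, ← integral_const_mul]
    congr 1
    refine integral_congr_ae (ae_of_all _ fun θ => ?_)
    simp
    ring
  -- the radial part, by integration by parts
  have hrad : inner ℝ (hH.1.toLp φ) (hm₁c.toLp m₁) =
      -(α * (α + N - 2)) * inner ℝ (hH.1.toLp φ) (hm₃c.toLp m₃) := by
    rw [inner_toLp, inner_toLp, ← integral_const_mul]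
    refine integral_congr_ae (ae_of_all _ fun θ => ?_)
    simp only [hm₁, hm₃, radialMoment_deriv hη hp hpqη ha ha0 haα θ]
    simp
    ring
  have hzero : inner ℝ (hH.1.toLp φ) (hm₀c.toLp m₀) = 0 := by
    rw [hlim, hang, hrad]; ring
  rw [integral_polar (f := fun x => homogeneousExt α φ x * coordLaplacian η x)
    ((aestronglyMeasurable_homogeneousExt hH.1.1).mul hLc.aestronglyMeasurable),
    ← hzero, inner_toLp, ← integral_inner_radial hH.1 hb₀ hLc hC₀]
  refine integral_congr_ae ?_
  filter_upwards [hposae] with z hz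
  by_cases hz' : z.2 • (z.1 : Euc N) ∈ tsupport η
  · have := hpqη _ hz'
    rw [norm_smul_unitSphere hz.le] at this
    rw [homogeneousExt, norm_smul_unitSphere hz.le, dir_smul_unitSphere hz,
      ← (haα _ this).eq_of_nhds]
    simp
    ring
  · simp [coordLaplacian_eq_zero_of_notMem_tsupport hz']

end HomogeneousExtension

/-! ### Weakly harmonic functions -/

section Weyl

variable {N : ℕ}

/-- A smooth profile on `ℝ`, positive on `(-∞, 1)` and zero on `[1, ∞)`. -/
def kernelProfile (s : ℝ) : ℝ := expNegInvGlue (1 - s)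

lemma contDiff_kernelProfile : ContDiff ℝ ∞ kernelProfile :=
  expNegInvGlue.contDiff.comp (contDiff_const.sub contDiff_id)

lemma kernelProfile_nonneg (s : ℝ) : 0 ≤ kernelProfile s := expNegInvGlue.nonneg _

lemma kernelProfile_pos {s : ℝ} (hs : s < 1) : 0 < kernelProfile s :=
  expNegInvGlue.pos_of_pos (by linarith)

lemma kernelProfile_eq_zero {s : ℝ} (hs : 1 ≤ s) : kernelProfile s = 0 :=
  expNegInvGlue.zero_of_nonpos (by linarith)

/-- The primitive of `-kernelProfile` which vanishes on `[1, ∞)`. -/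
def kernelPrimitive (s : ℝ) : ℝ := ∫ τ in s..1, kernelProfile τ

lemma hasDerivAt_kernelPrimitive (s : ℝ) :
    HasDerivAt kernelPrimitive (-kernelProfile s) s :=
  intervalIntegral.integral_hasDerivAt_left
    (contDiff_kernelProfile.continuous.intervalIntegrable _ _)
    contDiff_kernelProfile.continuous.stronglyMeasurable.stronglyMeasurableAtFilter
    contDiff_kernelProfile.continuous.continuousAt

lemma contDiff_kernelPrimitive : ContDiff ℝ ∞ kernelPrimitive := by
  refine contDiff_infty_iff_deriv.2 ⟨fun s => (hasDerivAt_kernelPrimitive s).differentiableAt, ?_⟩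
  rw [show deriv kernelPrimitive = fun s => -kernelProfile s from
    funext fun s => (hasDerivAt_kernelPrimitive s).deriv]
  exact contDiff_kernelProfile.neg

lemma kernelPrimitive_eq_zero {s : ℝ} (hs : 1 ≤ s) : kernelPrimitive s = 0 := by
  rw [kernelPrimitive, intervalIntegral.integral_congr (g := fun _ => 0),
    intervalIntegral.integral_zero]
  intro τ hτ
  rw [Set.uIcc_of_ge hs] at hτ
  exact kernelProfile_eq_zero hτ.1

/-- A radial kernel supported in the ball of radius `1 / t`, not yet of mass one. -/
def rawKernel (t : ℝ) (z : Euc N) : ℝ := t ^ N * kernelProfile (t ^ 2 * ‖z‖ ^ 2)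

lemma rawKernel_nonneg {t : ℝ} (ht : 0 ≤ t) (z : Euc N) : 0 ≤ rawKernel t z :=
  mul_nonneg (pow_nonneg ht _) (kernelProfile_nonneg _)

lemma rawKernel_neg (t : ℝ) (z : Euc N) : rawKernel t (-z) = rawKernel t z := by
  simp [rawKernel]

lemma contDiff_rawKernel : ContDiff ℝ ∞ fun p : ℝ × Euc N => rawKernel p.1 p.2 :=
  (contDiff_fst.pow N).mul (contDiff_kernelProfile.comp
    ((contDiff_fst.pow 2).mul ((contDiff_norm_sq ℝ).comp contDiff_snd)))

lemma contDiff_rawKernel_right (t : ℝ) : ContDiff ℝ ∞ (rawKernel t : Euc N → ℝ) :=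
  contDiff_rawKernel.comp (contDiff_const.prodMk contDiff_id)

lemma one_le_of_inv_le {t r : ℝ} (ht : 0 < t) (h : t⁻¹ ≤ r) : 1 ≤ t ^ 2 * r ^ 2 := by
  rw [← mul_pow]
  exact one_le_pow₀ ((inv_le_iff_one_le_mul₀' ht).1 h)

lemma rawKernel_eq_zero {t : ℝ} (ht : 0 < t) {z : Euc N} (hz : t⁻¹ ≤ ‖z‖) :
    rawKernel t z = 0 := by
  rw [rawKernel, kernelProfile_eq_zero (one_le_of_inv_le ht hz), mul_zero]

lemma rawKernel_pos {t : ℝ} (ht : 0 < t) {z : Euc N} (hz : ‖z‖ < t⁻¹) : 0 < rawKernel t z := by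
  refine mul_pos (pow_pos ht _) (kernelProfile_pos ?_)
  rw [← mul_pow]
  refine pow_lt_one₀ (by positivity) ?_ two_ne_zero
  exact (lt_inv_mul_iff₀ ht).1 (by simpa using hz)

lemma hasCompactSupport_rawKernel {t : ℝ} (ht : 0 < t) :
    HasCompactSupport (rawKernel t : Euc N → ℝ) :=
  HasCompactSupport.intro (isCompact_closedBall (0 : Euc N) t⁻¹) fun z hz =>
    rawKernel_eq_zero ht (by simpa using (not_le.1 fun h => hz (by simpa using h)).le)

lemma rawKernel_eq (t : ℝ) (z : Euc N) : rawKernel t z = t ^ N * rawKernel 1 (t • z) := by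
  simp [rawKernel, norm_smul, mul_pow]

lemma integral_rawKernel {t : ℝ} (ht : 0 < t) :
    ∫ z : Euc N, rawKernel t z = ∫ z : Euc N, rawKernel 1 z := by
  simp only [rawKernel_eq t]
  rw [integral_const_mul, Measure.integral_comp_smul (μ := volume) (rawKernel (N := N) 1) t]
  simp only [finrank_euclideanSpace, Fintype.card_fin, smul_eq_mul]
  rw [abs_of_pos (by positivity)]
  field_simp

lemma integral_rawKernel_pos : 0 < ∫ z : Euc N, rawKernel 1 z := by
  have hc := contDiff_rawKernel_right (N := N) 1
  refine hc.continuous.integral_pos_of_hasCompactSupport_nonneg_nonzero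
    (hasCompactSupport_rawKernel one_pos) (fun z => rawKernel_nonneg zero_le_one z) (x := 0) ?_
  exact (rawKernel_pos one_pos (by simp)).ne'

/-- The function whose Laplacian is the derivative of `rawKernel` in the scale. -/
lemma coordLaplacian_kernelPrimitive (t : ℝ) (x y : Euc N) :
    coordLaplacian (fun y => kernelPrimitive (t ^ 2 * ‖y - x‖ ^ 2)) y =
      -(2 * t ^ 2) * (N * kernelProfile (t ^ 2 * ‖y - x‖ ^ 2) +
        2 * t ^ 2 * ‖y - x‖ ^ 2 * deriv kernelProfile (t ^ 2 * ‖y - x‖ ^ 2)) := by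
  have hsq : ∀ y : Euc N, HasFDerivAt (fun y => t ^ 2 * ‖y - x‖ ^ 2)
      (t ^ 2 • (2 • innerSL ℝ (y - x))) y := fun y => by
    have := ((hasStrictFDerivAt_norm_sq (y - x)).hasFDerivAt.comp y
      ((hasFDerivAt_id y).sub_const x)).const_mul (t ^ 2)
    exact this
  have h1 : ∀ y, gradient (fun y => kernelPrimitive (t ^ 2 * ‖y - x‖ ^ 2)) y =
      (-(2 * t ^ 2) * kernelProfile (t ^ 2 * ‖y - x‖ ^ 2)) • (y - x) := fun y => by
    refine gradient_eq_of_hasFDerivAt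
      ((hasDerivAt_kernelPrimitive _).comp_hasFDerivAt y (hsq y)) fun w => ?_
    simp [inner_smul_left, inner_sub_left]
    ring
  have h2 : ∀ i, gradient (fun y => ((-(2 * t ^ 2) *
      kernelProfile (t ^ 2 * ‖y - x‖ ^ 2)) • (y - x)) i) y i =
      -(2 * t ^ 2) * (kernelProfile (t ^ 2 * ‖y - x‖ ^ 2) +
        2 * t ^ 2 * ((y - x) i) ^ 2 * deriv kernelProfile (t ^ 2 * ‖y - x‖ ^ 2)) := fun i => by
    have hk := (contDiff_kernelProfile.differentiable (by simp)
      (t ^ 2 * ‖y - x‖ ^ 2)).hasDerivAt.comp_hasFDerivAt y (hsq y)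
    have hi : HasFDerivAt (fun y : Euc N => (y - x) i) (EuclideanSpace.proj i : Euc N →L[ℝ] ℝ) y :=
      (EuclideanSpace.proj i : Euc N →L[ℝ] ℝ).hasFDerivAt.comp y ((hasFDerivAt_id y).sub_const x)
    rw [gradient_apply]
    have := (hk.const_mul (-(2 * t ^ 2))).mul hi
    simp only [Function.comp_def] at this
    change HasFDerivAt (fun y => -(2 * t ^ 2) * kernelProfile (t ^ 2 * ‖y - x‖ ^ 2) * (y - x) i)
      _ y at this
    rw [show (fun y => ((-(2 * t ^ 2) * kernelProfile (t ^ 2 * ‖y - x‖ ^ 2)) • (y - x)) i) =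
      fun y => -(2 * t ^ 2) * kernelProfile (t ^ 2 * ‖y - x‖ ^ 2) * (y - x) i from by
        ext; simp, this.fderiv]
    simp [EuclideanSpace.inner_single_right]
    ring
  simp only [coordLaplacian, h1, h2]
  rw [← Finset.mul_sum, Finset.sum_add_distrib, ← Finset.sum_mul, ← Finset.mul_sum,
    EuclideanSpace.norm_sq_eq (y - x)]
  simp

lemma hasDerivAt_rawKernel {t : ℝ} (ht : 0 < t) (x y : Euc N) :
    HasDerivAt (fun t => rawKernel t (y - x)) (-(t ^ N / (2 * t ^ 3)) *
      coordLaplacian (fun y => kernelPrimitive (t ^ 2 * ‖y - x‖ ^ 2)) y) t := by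
  have h := (hasDerivAt_pow N t).mul ((contDiff_kernelProfile.differentiable (by simp)
      (t ^ 2 * ‖y - x‖ ^ 2)).hasDerivAt.comp t ((hasDerivAt_pow 2 t).mul_const (‖y - x‖ ^ 2)))
  refine h.congr_deriv ?_
  rw [coordLaplacian_kernelPrimitive]
  rcases N.eq_zero_or_pos with rfl | hN
  · simp; field_simp
  · obtain ⟨n, rfl⟩ := Nat.exists_eq_succ_of_ne_zero hN.ne'
    simp
    field_simp
    ring

/-- Averages of a weakly harmonic function against the kernels of different scales agree: the
derivative in the scale is the integral of the function against a Laplacian. -/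
lemma integral_mul_rawKernel_eq {G : Set (Euc N)} {v : Euc N → ℝ} (hv : LocallyIntegrable v)
    (hharm : ∀ η : Euc N → ℝ, ContDiff ℝ ∞ η → HasCompactSupport η → tsupport η ⊆ G →
      ∫ x, v x * coordLaplacian η x = 0)
    {x : Euc N} {t₀ : ℝ} (ht₀ : 0 < t₀) (hG : Metric.closedBall x t₀⁻¹ ⊆ G) {t t' : ℝ}
    (ht : t₀ < t) (ht' : t₀ < t') :
    ∫ y, v y * rawKernel t (y - x) = ∫ y, v y * rawKernel t' (y - x) := by
  set B := Metric.closedBall x t₀⁻¹ with hB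
  have hz : ∀ s, t₀ < s → ∀ y ∉ B, s⁻¹ ≤ ‖y - x‖ := fun s hs y hy => by
    rw [hB, Metric.mem_closedBall, dist_eq_norm, not_le] at hy
    exact (inv_anti₀ ht₀ hs.le).trans hy.le
  have hvB : IntegrableOn v B := hv.integrableOn_isCompact (isCompact_closedBall _ _)
  have hset : ∀ f : Euc N → ℝ, (∀ y ∉ B, f y = 0) → ∫ y, v y * f y = ∫ y in B, v y * f y :=
    fun f hf => (setIntegral_eq_integral_of_forall_compl_eq_zero fun y hy => by
      simp [hf y hy]).symm
  let D : ℝ → Euc N → ℝ := fun s y => -(s ^ N / (2 * s ^ 3)) *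
      coordLaplacian (fun y => kernelPrimitive (s ^ 2 * ‖y - x‖ ^ 2)) y
  have hDc : ContinuousOn (fun p : ℝ × Euc N => D p.1 p.2) (Set.Ioi 0 ×ˢ Set.univ) := by
    have hk' : Continuous (deriv kernelProfile) := contDiff_kernelProfile.continuous_deriv (by simp)
    have hk := contDiff_kernelProfile.continuous
    simp only [D, coordLaplacian_kernelPrimitive]
    refine ContinuousOn.mul (ContinuousOn.neg (ContinuousOn.div (by fun_prop) (by fun_prop)
      fun p hp => ?_)) (Continuous.continuousOn (by fun_prop))
    have : 0 < p.1 := hp.1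
    positivity
  have hderiv : ∀ s ∈ Set.Ioi t₀,
      HasDerivAt (fun s => ∫ y in B, v y * rawKernel s (y - x)) 0 s := fun s hs => by
    have hs0 : 0 < s := ht₀.trans hs
    obtain ⟨M, hM⟩ := (isCompact_Icc (a := t₀) (b := s + 1)).prod (isCompact_closedBall x t₀⁻¹)
      |>.exists_bound_of_continuousOn (hDc.mono (Set.prod_mono
        (fun r hr => ht₀.trans_le hr.1) (Set.subset_univ _)))
    have hcont : ∀ r : ℝ, AEStronglyMeasurable (fun y => v y * rawKernel r (y - x))
        (volume.restrict B) := fun r =>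
      hvB.aestronglyMeasurable.mul ((contDiff_rawKernel_right r).continuous.comp
        (continuous_id.sub continuous_const)).aestronglyMeasurable
    have hDs : Continuous (D s) := by
      have := hDc.comp_continuous (f := fun y : Euc N => (s, y)) (by fun_prop)
        (fun y => ⟨hs0, trivial⟩)
      exact this
    have hint : IntegrableOn (fun y => v y * rawKernel s (y - x)) B := by
      refine hvB.mul_continuousOn ?_ (isCompact_closedBall _ _)
      exact ((contDiff_rawKernel_right s).continuous.comp
        (continuous_id.sub continuous_const)).continuousOn
    have h := (hasDerivAt_integral_of_dominated_loc_of_deriv_le (μ := volume.restrict B)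
      (F := fun s y => v y * rawKernel s (y - x)) (F' := fun s y => v y * D s y)
      (bound := fun y => |v y| * M) (Ioo_mem_nhds (show t₀ < s from hs) (lt_add_one s))
      (Eventually.of_forall hcont) hint
      (hvB.aestronglyMeasurable.mul hDs.aestronglyMeasurable) ?_ (hvB.abs.mul_const M)
      (ae_of_all _ fun y r hr => (hasDerivAt_rawKernel (ht₀.trans hr.1) x y).const_mul _)).2
    · refine h.congr_deriv ?_
      have hη : ContDiff ℝ ∞ fun y : Euc N => kernelPrimitive (s ^ 2 * ‖y - x‖ ^ 2) :=
        contDiff_kernelPrimitive.comp (contDiff_const.mul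
          ((contDiff_norm_sq ℝ).comp (contDiff_id.sub contDiff_const)))
      have hsupp : tsupport (fun y : Euc N => kernelPrimitive (s ^ 2 * ‖y - x‖ ^ 2)) ⊆ B :=
        closure_minimal (fun y hy => by_contra fun h => hy
          (kernelPrimitive_eq_zero (one_le_of_inv_le hs0 (hz s hs y h)))) Metric.isClosed_closedBall
      rw [← hset]
      · have := hharm _ hη ((isCompact_closedBall x t₀⁻¹).of_isClosed_subset
          (isClosed_tsupport _) hsupp) (hsupp.trans hG)
        simp only [D, mul_left_comm (v _), integral_const_mul, this, mul_zero]
      · intro y hy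
        simp only [D]
        rw [coordLaplacian_eq_zero_of_notMem_tsupport fun h => hy (hsupp h), mul_zero]
    · filter_upwards [ae_restrict_mem Metric.isClosed_closedBall.measurableSet] with y hy r hr
      rw [norm_mul, Real.norm_eq_abs (v y)]
      exact mul_le_mul_of_nonneg_left (hM (r, y) ⟨⟨hr.1.le, hr.2.le⟩, hy⟩) (abs_nonneg _)
  rw [hset _ fun y hy => rawKernel_eq_zero (ht₀.trans ht) (hz t ht y hy),
    hset _ fun y hy => rawKernel_eq_zero (ht₀.trans ht') (hz t' ht' y hy)]
  exact isOpen_Ioi.is_const_of_deriv_eq_zero isPreconnected_Ioi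
    (fun s hs => (hderiv s hs).differentiableAt.differentiableWithinAt)
    (fun s hs => (hderiv s hs).deriv) ht ht'

end Weyl

section WeylLemma

open scoped Convolution

variable {N : ℕ}

lemma gradient_comp_const_sub {g : Euc N → ℝ} (hg : ContDiff ℝ ∞ g) (x y : Euc N) :
    gradient (fun y => g (x - y)) y = -gradient g (x - y) := by
  refine gradient_eq_of_hasFDerivAt ((hg.differentiable (by simp) (x - y)).hasFDerivAt.comp y
    ((hasFDerivAt_id y).const_sub x)) fun w => ?_
  simp [inner_gradient_left, inner_neg_left]

lemma coordLaplacian_comp_const_sub {g : Euc N → ℝ} (hg : ContDiff ℝ ∞ g) (x y : Euc N) :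
    coordLaplacian (fun y => g (x - y)) y = coordLaplacian g (x - y) := by
  refine Finset.sum_congr rfl fun i _ => ?_
  have h : (fun y => gradient (fun y => g (x - y)) y i) =
      fun y => (fun z => -gradient g z i) (x - y) := by
    ext y; simp [gradient_comp_const_sub hg]
  rw [h, gradient_comp_const_sub (contDiff_gradient_apply hg i).neg]
  rw [show (fun z => -gradient g z i) = -(fun z => gradient g z i) from rfl, PiLp.neg_apply,
    gradient_apply, gradient_apply, fderiv_neg]
  simp

/-- Derivatives of a convolution fall on the smooth factor. -/
lemma gradient_convolution_apply {f g : Euc N → ℝ} (hf : LocallyIntegrable f)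
    (hg : ContDiff ℝ ∞ g) (hs : HasCompactSupport g) (x : Euc N) (i : Fin N) :
    gradient (f ⋆[ContinuousLinearMap.lsmul ℝ ℝ, volume] g) x i =
      (f ⋆[ContinuousLinearMap.lsmul ℝ ℝ, volume] fun y => gradient g y i) x := by
  rw [gradient_apply, (hs.hasFDerivAt_convolution_right (ContinuousLinearMap.lsmul ℝ ℝ) hf
    (hg.of_le (by simp)) x).fderiv, convolution_precompR_apply _ hf (hs.fderiv ℝ)
    (hg.continuous_fderiv (by simp))]
  simp only [gradient_apply]

lemma coordLaplacian_convolution {f g : Euc N → ℝ} (hf : LocallyIntegrable f)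
    (hg : ContDiff ℝ ∞ g) (hs : HasCompactSupport g) (x : Euc N) :
    coordLaplacian (f ⋆[ContinuousLinearMap.lsmul ℝ ℝ, volume] g) x =
      ∫ y, f y * coordLaplacian (fun y => g (x - y)) y := by
  simp only [coordLaplacian_comp_const_sub hg]
  simp only [coordLaplacian, Finset.mul_sum, gradient_convolution_apply hf hg hs]
  rw [integral_finsetSum]
  · refine Finset.sum_congr rfl fun i _ => ?_
    exact gradient_convolution_apply hf (contDiff_gradient_apply hg i)
      (hasCompactSupport_gradient_apply hs i) x i
  · intro i _
    exact (hasCompactSupport_gradient_apply (hasCompactSupport_gradient_apply hs i)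
      i).convolutionExists_right (ContinuousLinearMap.lsmul ℝ ℝ) hf (contDiff_gradient_apply
        (contDiff_gradient_apply hg i) i).continuous x

lemma coordLaplacian_congr {f g : Euc N → ℝ} {x : Euc N} (h : f =ᶠ[𝓝 x] g) :
    coordLaplacian f x = coordLaplacian g x := by
  refine Finset.sum_congr rfl fun i _ => ?_
  have : (fun y => gradient f y i) =ᶠ[𝓝 x] fun y => gradient g y i := by
    filter_upwards [h.eventuallyEq_nhds] with y hy
    rw [hy.gradient_eq]
  rw [this.gradient_eq]

/-- The averages of a locally integrable function against the shrinking kernels converge almost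
everywhere. -/
lemma ae_tendsto_integral_mul_rawKernel {v : Euc N → ℝ} (hv : LocallyIntegrable v) :
    ∀ᵐ x : Euc N, Tendsto (fun n : ℕ => ∫ y, v y * rawKernel ((n : ℝ) + 1) (y - x)) atTop
      (𝓝 ((∫ z : Euc N, rawKernel 1 z) * v x)) := by
  set M := ∫ z : Euc N, rawKernel 1 z with hM
  have hM0 : 0 < M := integral_rawKernel_pos
  obtain ⟨D, hD⟩ := norm_le_of_hasCompactSupport
    (contDiff_rawKernel_right (N := N) 1).continuous (hasCompactSupport_rawKernel one_pos)
  filter_upwards [(Besicovitch.vitaliFamily (volume : Measure (Euc N))).ae_tendsto_average_norm_sub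
    hv] with x hx
  have ht : ∀ n : ℕ, (0:ℝ) < (n : ℝ) + 1 := fun n => by positivity
  have hr : Tendsto (fun n : ℕ => ((n : ℝ) + 1)⁻¹) atTop (𝓝[>] 0) := by
    refine tendsto_nhdsWithin_iff.2 ⟨?_, Eventually.of_forall fun n => inv_pos.2 (ht n)⟩
    simpa using tendsto_one_div_add_atTop_nhds_zero_nat (𝕜 := ℝ)
  have h := tendsto_integral_smul_of_tendsto_average_norm_sub (μ := volume)
    (a := fun n : ℕ => Metric.closedBall x ((n : ℝ) + 1)⁻¹)
    (g := fun n y => M⁻¹ * rawKernel ((n : ℝ) + 1) (y - x))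
    (M⁻¹ * D * volume.real (Metric.closedBall (0 : Euc N) 1))
    ((hx.comp (Besicovitch.tendsto_filterAt volume x)).comp hr)
    (Eventually.of_forall fun n => hv.integrableOn_isCompact (isCompact_closedBall _ _)) ?_ ?_ ?_
  · have := h.const_mul M
    refine this.congr fun n => ?_
    rw [← integral_const_mul]
    refine integral_congr_ae (ae_of_all _ fun y => ?_)
    simp only [smul_eq_mul]
    field_simp
  · refine tendsto_const_nhds.congr fun n => ?_
    rw [integral_const_mul, integral_sub_right_eq_self (fun y => rawKernel ((n : ℝ) + 1) y),
      integral_rawKernel (ht n), inv_mul_cancel₀ hM0.ne']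
  · refine Eventually.of_forall fun n y hy => ?_
    by_contra hc
    rw [Metric.mem_closedBall, dist_eq_norm, not_le] at hc
    exact hy (by simp [rawKernel_eq_zero (ht n) hc.le])
  · refine Eventually.of_forall fun n y => ?_
    have hvol : volume.real (Metric.closedBall x ((n : ℝ) + 1)⁻¹) =
        (((n : ℝ) + 1)⁻¹) ^ N * volume.real (Metric.closedBall (0 : Euc N) 1) := by
      rw [measureReal_def, Measure.addHaar_closedBall' _ _ (inv_nonneg.2 (ht n).le),
        ENNReal.toReal_mul, ENNReal.toReal_ofReal (by have := ht n; positivity)]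
      simp [measureReal_def]
    have hpos : 0 < volume.real (Metric.closedBall (0 : Euc N) 1) :=
      ENNReal.toReal_pos (Metric.measure_closedBall_pos volume 0 one_pos).ne'
        (isCompact_closedBall _ _).measure_lt_top.ne
    rw [hvol, rawKernel_eq, abs_mul, abs_mul, abs_of_pos (inv_pos.2 hM0),
      abs_of_pos (pow_pos (ht n) _)]
    have hDn := hD (((n : ℝ) + 1) • (y - x))
    rw [Real.norm_eq_abs] at hDn
    have := ht n
    calc _ ≤ M⁻¹ * (((n : ℝ) + 1) ^ N * D) := by gcongr
      _ = _ := by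
        rw [inv_pow]
        field_simp

/-- Weyl's lemma: a locally integrable function which is harmonic in the sense of distributions in
`G` agrees almost everywhere in `G` with a smooth harmonic function. If it is nonnegative then so is
its harmonic representative, whose zeros are interior to the zero set (by the mean value property,
with a smooth kernel). -/
lemma exists_harmonic_representative {G : Set (Euc N)} (hG : IsOpen G) {v : Euc N → ℝ}
    (hv : LocallyIntegrable v)
    (hharm : ∀ η : Euc N → ℝ, ContDiff ℝ ∞ η → HasCompactSupport η → tsupport η ⊆ G →
      ∫ x, v x * coordLaplacian η x = 0) :
    ∃ V : Euc N → ℝ, ContDiffOn ℝ ∞ V G ∧ (∀ x ∈ G, coordLaplacian V x = 0) ∧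
      (∀ᵐ x, x ∈ G → V x = v x) ∧
      ((∀ᵐ x, 0 ≤ v x) → ∀ x ∈ G, 0 ≤ V x ∧
        (V x = 0 → ∃ r > 0, ∀ᵐ y, y ∈ Metric.ball x r → v y = 0)) := by
  set M := ∫ z : Euc N, rawKernel 1 z with hM
  have hM0 : 0 < M := integral_rawKernel_pos
  have hex : ∀ x : Euc N, ∃ c, x ∈ G → ∀ t₀ > 0, Metric.closedBall x t₀⁻¹ ⊆ G → ∀ t > t₀,
      ∫ y, v y * rawKernel t (y - x) = M * c := fun x => by
    by_cases hx : ∃ T₀ : ℝ, 0 < T₀ ∧ Metric.closedBall x T₀⁻¹ ⊆ G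
    · obtain ⟨T₀, hT, hTG⟩ := hx
      refine ⟨M⁻¹ * ∫ y, v y * rawKernel (T₀ + 1) (y - x), fun _ t₀ ht₀ hB t ht => ?_⟩
      rw [mul_inv_cancel_left₀ hM0.ne',
        integral_mul_rawKernel_eq hv hharm ht₀ hB ht (lt_max_of_lt_left ht),
        integral_mul_rawKernel_eq hv hharm hT hTG (lt_add_one T₀)
          (lt_max_of_lt_right (lt_add_one T₀))]
    · exact ⟨0, fun _ t₀ ht₀ hB => absurd ⟨t₀, ht₀, hB⟩ hx⟩
  choose V hV using hex
  have hball : ∀ x ∈ G, ∃ t₀ : ℝ, 0 < t₀ ∧ Metric.closedBall x (2 * t₀⁻¹) ⊆ G := fun x hx => by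
    obtain ⟨r, hr, hB⟩ := Metric.nhds_basis_closedBall.mem_iff.1 (hG.mem_nhds hx)
    refine ⟨2 / r, by positivity, ?_⟩
    rwa [inv_div, mul_div_cancel₀ _ two_ne_zero]
  have hsmall : ∀ x t₀, 0 < t₀ → Metric.closedBall x (2 * t₀⁻¹) ⊆ G →
      Metric.closedBall x t₀⁻¹ ⊆ G := fun x t₀ ht₀ hB =>
    (Metric.closedBall_subset_closedBall (by have := inv_pos.2 ht₀; linarith)).trans hB
  -- locally, `V` is the convolution with one fixed kernel
  have hconv : ∀ x ∈ G, ∃ t : ℝ, 0 < t ∧ Metric.closedBall x t⁻¹ ⊆ G ∧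
      V =ᶠ[𝓝 x] (v ⋆[ContinuousLinearMap.lsmul ℝ ℝ, volume] fun z => M⁻¹ * rawKernel t z) :=
    fun x hx => by
    obtain ⟨t₀, ht₀, hB⟩ := hball x hx
    have hi := inv_pos.2 ht₀
    refine ⟨2 * t₀, by positivity, (Metric.closedBall_subset_closedBall ?_).trans hB, ?_⟩
    · rw [mul_inv]
      linarith
    filter_upwards [Metric.ball_mem_nhds x hi] with z hz
    have hzB : Metric.closedBall z t₀⁻¹ ⊆ G :=
      (Metric.closedBall_subset_closedBall' (by
        rw [Metric.mem_ball] at hz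
        linarith)).trans hB
    have h := hV z (hzB (Metric.mem_closedBall_self hi.le)) t₀ ht₀ hzB (2 * t₀) (by linarith)
    rw [← inv_mul_cancel_left₀ hM0.ne' (V z), ← h, ← integral_const_mul, convolution_def]
    refine integral_congr_ae (ae_of_all _ fun y => ?_)
    simp only [ContinuousLinearMap.lsmul_apply, smul_eq_mul]
    rw [← rawKernel_neg, neg_sub]
    ring
  have hKs : ∀ t : ℝ, ContDiff ℝ ∞ fun z : Euc N => M⁻¹ * rawKernel t z := fun t =>
    contDiff_const.mul (contDiff_rawKernel_right t)
  have hKc : ∀ t : ℝ, 0 < t → HasCompactSupport fun z : Euc N => M⁻¹ * rawKernel t z :=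
    fun t ht => (hasCompactSupport_rawKernel ht).mul_left
  refine ⟨V, fun x hx => ?_, fun x hx => ?_, ?_, fun hv0 x hx => ?_⟩
  · obtain ⟨t, ht, -, h⟩ := hconv x hx
    exact (((hKc t ht).contDiff_convolution_right (n := ⊤) (ContinuousLinearMap.lsmul ℝ ℝ) hv
      (hKs t)).contDiffAt.congr_of_eventuallyEq h).contDiffWithinAt
  · obtain ⟨t, ht, hB, h⟩ := hconv x hx
    rw [coordLaplacian_congr h, coordLaplacian_convolution hv (hKs t) (hKc t ht)]
    have hsupp : tsupport (fun y => M⁻¹ * rawKernel t (x - y)) ⊆ Metric.closedBall x t⁻¹ := by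
      refine closure_minimal (fun y hy => by_contra fun hc => hy ?_) Metric.isClosed_closedBall
      rw [Metric.mem_closedBall, dist_eq_norm', not_le] at hc
      simp [rawKernel_eq_zero ht hc.le]
    exact hharm _ ((hKs t).comp (contDiff_const.sub contDiff_id))
      ((isCompact_closedBall x t⁻¹).of_isClosed_subset (isClosed_tsupport _) hsupp)
      (hsupp.trans hB)
  · filter_upwards [ae_tendsto_integral_mul_rawKernel hv] with x hx hxG
    obtain ⟨t₀, ht₀, hB⟩ := hball x hxG
    have : ∀ᶠ n : ℕ in atTop, ∫ y, v y * rawKernel ((n : ℝ) + 1) (y - x) = M * V x := by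
      filter_upwards [eventually_gt_atTop ⌈t₀⌉₊] with n hn
      refine hV x hxG t₀ ht₀ (hsmall x t₀ ht₀ hB) _ ?_
      have := Nat.lt_of_ceil_lt hn
      linarith
    have h := tendsto_nhds_unique (tendsto_const_nhds.congr'
      (this.mono fun n hn => hn.symm)) hx
    exact mul_left_cancel₀ hM0.ne' h
  · obtain ⟨t₀, ht₀, hB⟩ := hball x hx
    have h := hV x hx t₀ ht₀ (hsmall x t₀ ht₀ hB) (t₀ + 1) (lt_add_one _)
    have ht : 0 < t₀ + 1 := by linarith
    have hnn : 0 ≤ᵐ[volume] fun y => v y * rawKernel (t₀ + 1) (y - x) := by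
      filter_upwards [hv0] with y hy
      exact mul_nonneg hy (rawKernel_nonneg ht.le _)
    refine ⟨nonneg_of_mul_nonneg_right (h ▸ integral_nonneg_of_ae hnn) hM0, fun h0 => ?_⟩
    rw [h0, mul_zero] at h
    have hint : Integrable fun y => v y * rawKernel (t₀ + 1) (y - x) := by
      have := (hasCompactSupport_rawKernel ht).convolutionExists_right
        (ContinuousLinearMap.lsmul ℝ ℝ) hv (contDiff_rawKernel_right (t₀ + 1)).continuous x
      refine this.congr (ae_of_all _ fun y => ?_)
      simp only [ContinuousLinearMap.lsmul_apply, smul_eq_mul]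
      rw [← rawKernel_neg, neg_sub]
    refine ⟨(t₀ + 1)⁻¹, inv_pos.2 ht, ?_⟩
    filter_upwards [(integral_eq_zero_iff_of_nonneg_ae hnn hint).1 h] with y hy hyB
    refine (mul_eq_zero.1 hy).resolve_right (rawKernel_pos ht ?_).ne'
    rwa [Metric.mem_ball, dist_eq_norm] at hyB

end WeylLemma

/-! ### A positive homogeneous harmonic function in the cone -/

section Cone

variable {N : ℕ} [NeZero N]

lemma isOpen_coneLike {Ω : Set (UnitSphere N)} (hΩ : IsOpen Ω) {ρ : ℝ} (hρ : 0 ≤ ρ) :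
    IsOpen (coneLike Ω ρ) := by
  have h1 : IsOpen (({0}ᶜ : Set (Euc N)) ∩ dir ⁻¹' Ω) :=
    continuousOn_dir.isOpen_inter_preimage isOpen_compl_singleton hΩ
  have h2 : coneLike Ω ρ = {x | ρ < ‖x‖} ∩ (({0}ᶜ : Set (Euc N)) ∩ dir ⁻¹' Ω) := by
    ext x
    rw [mem_coneLike_iff hρ]
    refine ⟨fun h => ⟨h.1, ?_, h.2⟩, fun h => ⟨h.1, h.2.2⟩⟩
    exact norm_pos_iff.1 (hρ.trans_lt h.1)
  rw [h2]
  exact (isOpen_lt continuous_const continuous_norm).inter h1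

lemma isPreconnected_coneLike {Ω : Set (UnitSphere N)} (hΩ : IsPreconnected Ω) :
    IsPreconnected (coneLike Ω 0) := by
  have h : coneLike Ω 0 =
      (fun p : UnitSphere N × ℝ => p.2 • (p.1 : Euc N)) '' (Ω ×ˢ Set.Ioi 0) := by
    ext x
    constructor
    · intro hx
      rw [mem_coneLike_iff le_rfl] at hx
      exact ⟨(dir x, ‖x‖), ⟨hx.2, hx.1⟩, norm_smul_dir x⟩
    · rintro ⟨p, hp, rfl⟩
      exact (smul_mem_coneLike_iff hp.2).2 hp.1
  rw [h]
  exact (hΩ.prod isPreconnected_Ioi).image _ (Continuous.continuousOn (by fun_prop))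

lemma smul_mem_coneLike {Ω : Set (UnitSphere N)} {t : ℝ} (ht : 0 < t) {x : Euc N}
    (hx : x ∈ coneLike Ω 0) : t • x ∈ coneLike Ω 0 := by
  rw [mem_coneLike_iff le_rfl] at hx ⊢
  rw [dir_smul ht, norm_smul, Real.norm_of_nonneg ht.le]
  exact ⟨mul_pos ht hx.1, hx.2⟩

omit [NeZero N] in
lemma coneLike_subset {Ω : Set (UnitSphere N)} {ρ : ℝ} (hρ : 0 ≤ ρ) :
    coneLike Ω ρ ⊆ coneLike Ω 0 := fun _ hx => ⟨hρ.trans_lt hx.1, hx.2⟩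

lemma homogeneousExt_smul {α t : ℝ} (ht : 0 < t) (φ : UnitSphere N → ℝ) (x : Euc N) :
    homogeneousExt α φ (t • x) = t ^ α * homogeneousExt α φ x := by
  rw [homogeneousExt, homogeneousExt, dir_smul ht, norm_smul, Real.norm_of_nonneg ht.le,
    Real.mul_rpow ht.le (norm_nonneg _), mul_assoc]

lemma locallyIntegrable_homogeneousExt {α : ℝ} (hα : 0 ≤ α) {φ : UnitSphere N → ℝ}
    (hφ : Integrable φ (surfaceMeasure N)) : LocallyIntegrable (homogeneousExt α φ) := by
  intro x
  refine ⟨Metric.ball 0 (‖x‖ + 1), Metric.isOpen_ball.mem_nhds (by simp), ?_⟩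
  set R := ‖x‖ + 1
  rw [← integrable_indicator_iff Metric.isOpen_ball.measurableSet,
    integrable_polar_iff ((aestronglyMeasurable_homogeneousExt hφ.1).indicator
      Metric.isOpen_ball.measurableSet)]
  have hrad : Integrable ((Set.Ioo 0 R).indicator fun r : ℝ => r ^ α) (radialMeasure N) := by
    rw [integrable_radialMeasure_iff]
    have hc : ContinuousOn (fun r : ℝ => r ^ (N - 1) * r ^ α) (Set.Icc 0 R) :=
      (continuousOn_id.pow _).mul (continuousOn_id.rpow_const fun _ _ => Or.inr hα)
    have := (hc.integrableOn_Icc (μ := volume)).mono_set Set.Ioo_subset_Icc_self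
    rw [← integrable_indicator_iff measurableSet_Ioo] at this
    refine this.integrableOn.congr_fun (fun r hr => ?_) measurableSet_Ioi
    by_cases h : r ∈ Set.Ioo 0 R <;> simp [h]
  refine (hφ.mul_prod hrad).congr ?_
  filter_upwards [(Measure.quasiMeasurePreserving_snd (μ := surfaceMeasure N)
    (ν := radialMeasure N)).ae ae_radialMeasure_pos] with z hz
  have hn := norm_smul_unitSphere (le_of_lt hz) z.1
  have hb : z.2 • (z.1 : Euc N) ∈ Metric.ball (0 : Euc N) R ↔ z.2 < R := by
    rw [Metric.mem_ball, dist_zero_right, hn]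
  by_cases h : z.2 < R
  · rw [Set.indicator_of_mem (show z.2 ∈ Set.Ioo 0 R from ⟨hz, h⟩),
      Set.indicator_of_mem (hb.2 h), homogeneousExt, hn,
      dir_smul_unitSphere hz, mul_comm]
  · rw [Set.indicator_of_notMem fun hm => h hm.2, Set.indicator_of_notMem (mt hb.1 h), mul_zero]

lemma radialMeasure_ne_zero : radialMeasure N ≠ 0 := by
  intro h
  have h1 : volume (Set.univ : Set (Euc N)) = 0 := by
    rw [← measurePreserving_smul_unitSphere.map_eq, h]
    simp
  simp at h1

/-- Values of a function of the direction are seen almost everywhere on the sphere. -/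
lemma ae_of_ae_dir {p : UnitSphere N → Prop} (h : ∀ᵐ x : Euc N, p (dir x)) :
    ∀ᵐ θ ∂(surfaceMeasure N), p θ := by
  have h1 := measurePreserving_smul_unitSphere.quasiMeasurePreserving.ae h
  have h2 : ∀ᵐ z ∂((surfaceMeasure N).prod (radialMeasure N)), p z.1 := by
    filter_upwards [h1, (Measure.quasiMeasurePreserving_snd (μ := surfaceMeasure N)
      (ν := radialMeasure N)).ae ae_radialMeasure_pos] with z hz h0
    rwa [dir_smul_unitSphere h0] at hz
  have : NeZero (radialMeasure N) := ⟨radialMeasure_ne_zero⟩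
  filter_upwards [Measure.ae_ae_of_ae_prod h2] with θ hθ
  exact hθ.exists.choose_spec

/-- The cone over `Ω` carries a positive harmonic function which is homogeneous of degree `α`, where
`α ≥ 0` and `α (α + N - 2)` is the principal eigenvalue of `Ω`: the homogeneous extension of the
principal eigenfunction. The homogeneity is expressed by Euler's relation. -/
lemma exists_pos_homogeneous_harmonic (hN : 2 ≤ N) {Ω : Set (UnitSphere N)} (hΩ : IsOpen Ω)
    (hc : IsConnected Ω) :
    ∃ (α : ℝ) (V : Euc N → ℝ), α * (α + N - 2) = rayleighInf Ω ∧
      ContDiffOn ℝ ∞ V (coneLike Ω 0) ∧ (∀ x ∈ coneLike Ω 0, coordLaplacian V x = 0) ∧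
      (∀ x ∈ coneLike Ω 0, 0 < V x) ∧
      ∀ x ∈ coneLike Ω 0, inner ℝ x (gradient V x) = α * V x := by
  have hN' : (0:ℝ) ≤ (N : ℝ) - 2 := by
    have : (2:ℝ) ≤ N := by exact_mod_cast hN
    linarith
  have hlam := rayleighInf_nonneg Ω
  set S := Real.sqrt (((N : ℝ) - 2) ^ 2 + 4 * rayleighInf Ω) with hS
  have hS2 : S ^ 2 = ((N : ℝ) - 2) ^ 2 + 4 * rayleighInf Ω := Real.sq_sqrt (by positivity)
  have hSN : (N : ℝ) - 2 ≤ S := Real.le_sqrt_of_sq_le (by linarith)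
  set α := (S - ((N : ℝ) - 2)) / 2 with hα
  have hα0 : 0 ≤ α := by rw [hα]; linarith
  have hαeq : α * (α + N - 2) = rayleighInf Ω := by rw [hα]; linarith
  obtain ⟨φ, g, hH, hφ0, hφne, hweak⟩ := exists_principal_eigenfunction hΩ hc.nonempty
  have hO := isOpen_coneLike hΩ le_rfl
  obtain ⟨V, hV, hVh, hVv, hVpos⟩ := exists_harmonic_representative hO
    (locallyIntegrable_homogeneousExt hα0 (hH.1.integrable (by norm_num)))
    (fun η hη hs hsupp => integral_homogeneousExt_mul_coordLaplacian (α := α) hH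
      (fun ψ hψ => by rw [hαeq]; exact hweak ψ hψ) hη hs hsupp)
  have hVpos := hVpos (by
    filter_upwards [(Measure.quasiMeasurePreserving_fst.comp
      measurePreserving_polar.quasiMeasurePreserving).ae hφ0] with x hx
    exact mul_nonneg (Real.rpow_nonneg (norm_nonneg _) _) hx)
  have hVc := hV.continuousOn
  -- the zero set of the harmonic representative is open
  have hopen : IsOpen {x | x ∈ coneLike Ω 0 ∧ V x = 0} := by
    refine isOpen_iff_mem_nhds.2 fun x ⟨hx, hx0⟩ => ?_
    obtain ⟨r, hr, hb⟩ := (hVpos x hx).2 hx0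
    have hEq : Set.EqOn V (fun _ => 0) (Metric.ball x r ∩ coneLike Ω 0) := by
      refine Measure.eqOn_open_of_ae_eq (μ := volume) ?_ (Metric.isOpen_ball.inter hO)
        (hVc.mono Set.inter_subset_right) continuousOn_const
      filter_upwards [ae_restrict_of_ae hb, ae_restrict_of_ae hVv,
        ae_restrict_mem (Metric.isOpen_ball.inter hO).measurableSet] with y h1 h2 h3
      rw [h2 h3.2, h1 h3.1]
    filter_upwards [Metric.ball_mem_nhds x hr, hO.mem_nhds hx] with y h1 h2
    exact ⟨h2, hEq ⟨h1, h2⟩⟩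
  have hpos : ∀ x ∈ coneLike Ω 0, 0 < V x := by
    by_contra! hcon
    obtain ⟨x, hx, hx0⟩ := hcon
    have hsub := (isPreconnected_coneLike hc.isPreconnected).subset_right_of_subset_union
      (hVc.isOpen_inter_preimage hO isOpen_compl_singleton (t := {0}ᶜ)) hopen
      (Set.disjoint_left.2 fun y h1 h2 => h1.2 h2.2)
      (fun y hy => (em (V y = 0)).symm.imp (fun h => ⟨hy, h⟩) fun h => ⟨hy, h⟩)
      ⟨x, hx, hx, le_antisymm hx0 (hVpos x hx).1⟩
    refine hφne (ae_of_ae_dir ?_)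
    have hsupp := (Measure.quasiMeasurePreserving_fst.comp
      measurePreserving_polar.quasiMeasurePreserving).ae hH.ae_eq_zero
    have hn0 : ∀ᵐ x : Euc N, x ≠ 0 := by simp [ae_iff, measure_singleton]
    filter_upwards [hsupp, hVv, hn0] with y h1 h2 h3
    by_cases hy : dir y ∈ Ω
    · have hyc : y ∈ coneLike Ω 0 := (mem_coneLike_iff le_rfl).2 ⟨norm_pos_iff.2 h3, hy⟩
      have h4 := h2 hyc
      rw [(hsub hyc).2, homogeneousExt, eq_comm] at h4
      exact (mul_eq_zero.1 h4).resolve_left (Real.rpow_pos_of_pos (norm_pos_iff.2 h3) _).ne'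
    · exact h1 hy
  have hhom : ∀ t > 0, ∀ x ∈ coneLike Ω 0, V (t • x) = t ^ α * V x := fun t ht => by
    refine Measure.eqOn_open_of_ae_eq (μ := volume) ?_ hO
      (hVc.comp (continuous_const_smul t).continuousOn fun x hx => smul_mem_coneLike ht hx)
      (continuousOn_const.mul hVc)
    filter_upwards [ae_restrict_of_ae hVv, ae_restrict_mem hO.measurableSet,
      ae_restrict_of_ae ((Measure.quasiMeasurePreserving_smul (volume : Measure (Euc N))
        ht.ne').ae hVv)] with x h1 h2 h3
    rw [h1 h2, h3 (smul_mem_coneLike ht h2), homogeneousExt_smul ht]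
  refine ⟨α, V, hαeq, hV, hVh, hpos, fun x hx => ?_⟩
  have hd := ((hV.contDiffAt (hO.mem_nhds hx)).differentiableAt (by simp)).hasFDerivAt
  have h1 : HasDerivAt (fun t : ℝ => t • x) x 1 := by
    simpa using (hasDerivAt_id (1:ℝ)).smul_const x
  have h2 : HasDerivAt (fun t : ℝ => V (t • x)) (fderiv ℝ V x x) 1 :=
    HasFDerivAt.comp_hasDerivAt (1:ℝ) (by simpa using hd) h1
  have h3 : HasDerivAt (fun t : ℝ => t ^ α * V x) (α * V x) 1 := by
    simpa using (Real.hasDerivAt_rpow_const (p := α) (Or.inl one_ne_zero)).mul_const (V x)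
  have h4 : (fun t : ℝ => V (t • x)) =ᶠ[𝓝 1] fun t => t ^ α * V x := by
    filter_upwards [Ioi_mem_nhds zero_lt_one] with t ht using hhom t ht x hx
  rw [real_inner_comm, inner_gradient_left]
  exact h2.unique (h3.congr_of_eventuallyEq h4)

end Cone

/-! ### Existence of a positive super-solution -/

section Existence

variable {N : ℕ}

lemma hasFDerivAt_norm_rpow_euc (s : ℝ) {x : Euc N} (hx : x ≠ 0) :
    HasFDerivAt (fun y : Euc N => ‖y‖ ^ s) ((s * ‖x‖ ^ (s - 2)) • innerSL ℝ x) x := by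
  have hn := norm_pos_iff.2 hx
  refine ((Real.hasDerivAt_rpow_const (p := s) (Or.inl hn.ne')).comp_hasFDerivAt x
    (hasFDerivAt_norm_euc hx)).congr_fderiv ?_
  rw [smul_smul, show s - 1 = s - 2 + 1 by ring, Real.rpow_add_one hn.ne']
  congr 1
  field_simp

lemma contDiffOn_norm_rpow_euc (s : ℝ) {G : Set (Euc N)} (h0 : ∀ x ∈ G, x ≠ 0) :
    ContDiffOn ℝ ∞ (fun y : Euc N => ‖y‖ ^ s) G := fun x hx =>
  ((contDiffAt_norm ℝ (h0 x hx)).rpow_const_of_ne (norm_ne_zero_iff.2 (h0 x hx))).contDiffWithinAt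

lemma contDiffOn_gradient_apply {f : Euc N → ℝ} {G : Set (Euc N)} (hG : IsOpen G)
    (hf : ContDiffOn ℝ ∞ f G) (i : Fin N) : ContDiffOn ℝ ∞ (fun x => gradient f x i) G := by
  simp only [gradient_apply]
  exact (hf.fderiv_of_isOpen hG (m := ∞) (by simp)).clm_apply contDiffOn_const

lemma continuousOn_gradient {f : Euc N → ℝ} {G : Set (Euc N)} (hG : IsOpen G)
    (hf : ContDiffOn ℝ ∞ f G) : ContinuousOn (gradient f) G :=
  (InnerProductSpace.toDual ℝ (Euc N)).symm.continuous.comp_continuousOn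
    (hf.continuousOn_fderiv_of_isOpen hG (by simp))

lemma integral_euc_apply {f : Euc N → Euc N} {μ : Measure (Euc N)} (hf : Integrable f μ)
    (i : Fin N) : (∫ x, f x ∂μ) i = ∫ x, f x i ∂μ :=
  ((EuclideanSpace.proj i : Euc N →L[ℝ] ℝ).integral_comp_comm hf).symm

lemma memLp_euc_apply {f : Euc N → Euc N} {μ : Measure (Euc N)} {p : ℝ≥0∞} (hf : MemLp f p μ)
    (i : Fin N) : MemLp (fun x => f x i) p μ :=
  (EuclideanSpace.proj i : Euc N →L[ℝ] ℝ).comp_memLp' hf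

lemma memLp_of_continuousOn_isCompact {F : Type*} [NormedAddCommGroup F] {f : Euc N → F}
    {K : Set (Euc N)} (hf : ContinuousOn f K) (hK : IsCompact K) {p : ℝ≥0∞} :
    MemLp f p (volume.restrict K) := by
  obtain ⟨C, hC⟩ := hK.exists_bound_of_continuousOn hf
  have : IsFiniteMeasure (volume.restrict K) := isFiniteMeasure_restrict.2 hK.measure_lt_top.ne
  exact MemLp.of_bound (hf.aestronglyMeasurable_of_isCompact hK hK.measurableSet) C
    ((ae_restrict_mem hK.measurableSet).mono hC)

lemma integrable_smul_of_memLp_two {f : Euc N → ℝ} {g : Euc N → Euc N} {μ : Measure (Euc N)}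
    (hf : MemLp f 2 μ) (hg : MemLp g 2 μ) : Integrable (fun x => f x • g x) μ :=
  memLp_one_iff_integrable.1 (hg.smul hf)

/-- A smooth function has its classical gradient as weak gradient. -/
lemma isH1Loc_of_contDiffOn {G : Set (Euc N)} (hG : IsOpen G) {u : Euc N → ℝ}
    (hu : ContDiffOn ℝ ∞ u G) : IsH1Loc G u (gradient u) := by
  refine ⟨fun K hKG hK => ⟨?_, ?_⟩, fun η hη hs hsupp => ?_⟩
  · exact memLp_of_continuousOn_isCompact (hu.continuousOn.mono hKG) hK
  · exact memLp_of_continuousOn_isCompact ((continuousOn_gradient hG hu).mono hKG) hK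
  · obtain ⟨w, hw, -, -, hwu⟩ := exists_contDiff_extension hs hG hsupp hu
    have hwu : ∀ x ∈ tsupport η, w =ᶠ[𝓝 x] u := eventually_nhdsSet_iff_forall.1 hwu
    have e1 : ∫ x in G, u x • gradient η x = ∫ x, w x • gradient η x := by
      rw [setIntegral_eq_integral_of_forall_compl_eq_zero fun x hx => by
        rw [gradient_eq_zero_of_notMem_tsupport fun h => hx (hsupp h), smul_zero]]
      refine integral_congr_ae (ae_of_all _ fun x => ?_)
      by_cases hx : x ∈ tsupport η
      · simp only [(hwu x hx).self_of_nhds]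
      · simp only [gradient_eq_zero_of_notMem_tsupport hx, smul_zero]
    have e2 : ∫ x in G, η x • gradient u x = ∫ x, η x • gradient w x := by
      rw [setIntegral_eq_integral_of_forall_compl_eq_zero fun x hx => by
        rw [image_eq_zero_of_notMem_tsupport fun h => hx (hsupp h), zero_smul]]
      refine integral_congr_ae (ae_of_all _ fun x => ?_)
      by_cases hx : x ∈ tsupport η
      · simp only [(hwu x hx).gradient_eq]
      · simp only [image_eq_zero_of_notMem_tsupport hx, zero_smul]
    rw [e1, e2]
    have i1 : Integrable fun x => w x • gradient η x :=
      (hw.continuous.smul (continuous_gradient hη)).integrable_of_hasCompactSupport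
        (hasCompactSupport_gradient hs).smul_left
    have i2 : Integrable fun x => η x • gradient w x :=
      (hη.continuous.smul (continuous_gradient hw)).integrable_of_hasCompactSupport hs.smul_right
    ext i
    rw [PiLp.neg_apply, integral_euc_apply i1, integral_euc_apply i2]
    simpa [mul_comm] using integral_mul_gradient_apply hw hη hs i

/-- The weak gradient of a function vanishes where the function does. -/
lemma IsH1cLinftyc.ae_eq_zero {G : Set (Euc N)} (hG : IsOpen G) {φ : Euc N → ℝ}
    {h : Euc N → Euc N} (hφ : IsH1cLinftyc G φ h) {K : Set (Euc N)} (hK : IsCompact K)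
    (hφK : ∀ᵐ x ∂(volume.restrict G), x ∉ K → φ x = 0) :
    ∀ᵐ x ∂(volume.restrict G), x ∉ K → h x = 0 := by
  obtain ⟨-, h2, hw, -, -⟩ := hφ
  have hO : IsOpen (G \ K) := hG.sdiff hK.isClosed
  have hloc : LocallyIntegrableOn h (G \ K) := by
    have : LocallyIntegrableOn h G := locallyIntegrableOn_of_locallyIntegrable_restrict
      (h2.locallyIntegrable (by norm_num))
    exact this.mono_set Set.sdiff_subset
  have := hO.ae_eq_zero_of_integral_contDiff_smul_eq_zero hloc fun η hη hs hsupp => by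
    have e := hw η hη hs (hsupp.trans Set.sdiff_subset)
    have e0 : ∫ x in G, φ x • gradient η x = 0 := by
      refine integral_eq_zero_of_ae ?_
      filter_upwards [hφK] with x hx
      by_cases hxK : x ∈ K
      · simp [gradient_eq_zero_of_notMem_tsupport fun h => (hsupp h).2 hxK]
      · simp [hx hxK]
    rw [e0, eq_comm, neg_eq_zero, setIntegral_eq_integral_of_forall_compl_eq_zero fun x hx => by
        rw [image_eq_zero_of_notMem_tsupport fun h => hx (hsupp h).1, zero_smul]] at e
    exact e
  rw [ae_restrict_iff' hG.measurableSet]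
  filter_upwards [this] with x hx hxG hxK using hx ⟨hxG, hxK⟩

/-- The divergence theorem for a smooth field against a compactly supported Sobolev function. -/
lemma IsH1cLinftyc.integral_sum_mul {G : Set (Euc N)} (hG : IsOpen G) {φ : Euc N → ℝ}
    {h : Euc N → Euc N} (hφ : IsH1cLinftyc G φ h) {X : Fin N → Euc N → ℝ}
    (hX : ∀ i, ContDiffOn ℝ ∞ (X i) G) :
    ∫ x in G, ∑ i, X i x * h x i = -∫ x in G, φ x * ∑ i, gradient (X i) x i := by
  obtain ⟨K, hKG, hK, hφK⟩ := hφ.2.2.2.2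
  have hhK := hφ.ae_eq_zero hG hK hφK
  obtain ⟨h1, h2, hw, -, -⟩ := hφ
  choose Y hY hYs hYG hYX using fun i => exists_contDiff_extension hK hG hKG (hX i)
  have hYX : ∀ i, ∀ x ∈ K, Y i =ᶠ[𝓝 x] X i := fun i => eventually_nhdsSet_iff_forall.1 (hYX i)
  have hYm : ∀ i, MemLp (Y i) 2 (volume.restrict G) := fun i =>
    ((hY i).continuous.memLp_of_hasCompactSupport (hYs i)).restrict G
  have hgm : ∀ i, MemLp (gradient (Y i)) 2 (volume.restrict G) := fun i =>
    ((continuous_gradient (hY i)).memLp_of_hasCompactSupport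
      (hasCompactSupport_gradient (hYs i))).restrict G
  have hcomp : ∀ i, ∫ x in G, Y i x * h x i = -∫ x in G, φ x * gradient (Y i) x i := fun i => by
    have e := congrArg (fun v : Euc N => v i) (hw (Y i) (hY i) (hYs i) (hYG i))
    simp only [PiLp.neg_apply] at e
    rw [integral_euc_apply (integrable_smul_of_memLp_two h1 (hgm i)),
      integral_euc_apply (integrable_smul_of_memLp_two (hYm i) h2)] at e
    simp only [PiLp.smul_apply, smul_eq_mul] at e
    linarith
  have e1 : ∫ x in G, ∑ i, X i x * h x i = ∫ x in G, ∑ i, Y i x * h x i := by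
    refine integral_congr_ae ?_
    filter_upwards [hhK] with x hx
    refine Finset.sum_congr rfl fun i _ => ?_
    by_cases hxK : x ∈ K
    · rw [(hYX i x hxK).self_of_nhds]
    · simp [hx hxK]
  have e2 : ∫ x in G, φ x * ∑ i, gradient (X i) x i = ∫ x in G, ∑ i, φ x * gradient (Y i) x i := by
    refine integral_congr_ae ?_
    filter_upwards [hφK] with x hx
    rw [← Finset.mul_sum]
    by_cases hxK : x ∈ K
    · congr 1
      refine Finset.sum_congr rfl fun i _ => ?_
      rw [(hYX i x hxK).gradient_eq]
    · simp [hx hxK]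
  rw [e1, e2, integral_finsetSum, integral_finsetSum, ← Finset.sum_neg_distrib]
  · exact Finset.sum_congr rfl fun i _ => hcomp i
  · exact fun i _ => h1.integrable_mul (memLp_euc_apply (hgm i) i)
  · exact fun i _ => (hYm i).integrable_mul (memLp_euc_apply h2 i)

end Existence

section PowerSolution

variable {N : ℕ}

/-- The gradient of `|x|^γ V`. -/
lemma gradient_norm_rpow_mul {V : Euc N → ℝ} {x : Euc N} (hx : x ≠ 0)
    (hV : DifferentiableAt ℝ V x) (γ : ℝ) :
    gradient (fun y => ‖y‖ ^ γ * V y) x =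
      (γ * ‖x‖ ^ (γ - 2) * V x) • x + ‖x‖ ^ γ • gradient V x := by
  refine gradient_eq_of_hasFDerivAt ((hasFDerivAt_norm_rpow_euc γ hx).mul hV.hasFDerivAt)
    fun w => ?_
  simp [inner_add_left, inner_smul_left, inner_gradient_left]
  ring

lemma inner_single_one (x : Euc N) (i : Fin N) :
    inner ℝ x (EuclideanSpace.single i (1:ℝ)) = x i := by
  simp [EuclideanSpace.inner_single_right]

/-- The divergence of `|x|^A ∇(|x|^γ V)`, written out for a smooth function `V`. -/
lemma sum_gradient_weighted {V : Euc N → ℝ} {G : Set (Euc N)} (hG : IsOpen G)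
    (hV : ContDiffOn ℝ ∞ V G) (p q γ : ℝ) {x : Euc N} (hx : x ∈ G) (h0 : x ≠ 0) :
    ∑ i, gradient (fun y => γ * ‖y‖ ^ p * V y * y i + ‖y‖ ^ q * gradient V y i) x i =
      γ * (p * ‖x‖ ^ (p - 2) * V x * ‖x‖ ^ 2 + ‖x‖ ^ p * inner ℝ x (gradient V x) +
        N * (‖x‖ ^ p * V x)) +
      q * ‖x‖ ^ (q - 2) * inner ℝ x (gradient V x) + ‖x‖ ^ q * coordLaplacian V x := by
  have hVx := (((hV.contDiffAt (hG.mem_nhds hx)).differentiableAt (by simp))).hasFDerivAt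
  have h1 : ∀ i, gradient (fun y => γ * ‖y‖ ^ p * V y * y i + ‖y‖ ^ q * gradient V y i) x i =
      γ * (p * ‖x‖ ^ (p - 2) * V x * (x i * x i) + ‖x‖ ^ p * (x i * gradient V x i) +
        ‖x‖ ^ p * V x) + q * ‖x‖ ^ (q - 2) * (x i * gradient V x i) +
        ‖x‖ ^ q * gradient (fun y => gradient V y i) x i := fun i => by
    have hgi := ((contDiffOn_gradient_apply hG hV i).contDiffAt (hG.mem_nhds hx)).differentiableAt
      (by simp) |>.hasFDerivAt
    have hi : HasFDerivAt (fun y : Euc N => y i) (EuclideanSpace.proj i : Euc N →L[ℝ] ℝ) x :=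
      (EuclideanSpace.proj i : Euc N →L[ℝ] ℝ).hasFDerivAt
    have := ((((hasFDerivAt_norm_rpow_euc p h0).const_mul γ).mul hVx).mul hi).add
      ((hasFDerivAt_norm_rpow_euc q h0).mul hgi)
    rw [gradient_apply]
    have h2 := congrArg (fun L : Euc N →L[ℝ] ℝ => L (EuclideanSpace.single i 1)) this.fderiv
    refine h2.trans ?_
    have hii : (EuclideanSpace.proj i : Euc N →L[ℝ] ℝ) (EuclideanSpace.single i 1) = 1 := by simp
    simp only [add_apply, smul_apply, smul_eq_mul, innerSL_apply_apply, inner_single_one,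
      ← gradient_apply, hii, Pi.mul_apply]
    ring
  simp only [h1, coordLaplacian]
  rw [Finset.sum_add_distrib, Finset.sum_add_distrib, ← Finset.mul_sum, Finset.sum_add_distrib,
    Finset.sum_add_distrib, ← Finset.mul_sum, ← Finset.mul_sum, ← Finset.mul_sum,
    ← Finset.mul_sum, ← Finset.mul_sum, ← euc_inner_eq_sum, ← euc_inner_eq_sum,
    real_inner_self_eq_norm_sq, Finset.sum_const, Finset.card_univ, Fintype.card_fin, nsmul_eq_mul]
  ring

/-- Below the critical value a positive solution is `|x|^(β - α) V`, where `V` is the positive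
`α`-homogeneous harmonic function of the cone and `β` is a root of the indicial equation. -/
lemma exists_positive_superSolution (hN : 2 ≤ N) {A B C ρ : ℝ} (hρ : 0 ≤ ρ)
    {Ω : Set (UnitSphere N)} (hΩ : IsOpen Ω) (hc : IsConnected Ω)
    (hBC : B + C ≤ hardyConstant N A + rayleighInf Ω) :
    ∃ u : Euc N → ℝ, IsPositiveSuperSolution A B C (coneLike Ω ρ) u := by
  have : NeZero N := ⟨by omega⟩
  obtain ⟨α, V, hα, hV, hVh, hV0, hVE⟩ := exists_pos_homogeneous_harmonic hN hΩ hc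
  set lam := rayleighInf Ω
  have hsub := coneLike_subset (Ω := Ω) hρ
  have hO := isOpen_coneLike hΩ hρ
  have hne : ∀ x ∈ coneLike Ω ρ, x ≠ 0 := fun x hx => norm_pos_iff.1 (hρ.trans_lt hx.1)
  replace hV := hV.mono hsub
  set D := Real.sqrt ((A + N - 2) ^ 2 + 4 * (lam - B - C)) with hD
  have hD2 : D ^ 2 = (A + N - 2) ^ 2 + 4 * (lam - B - C) := Real.sq_sqrt (by
    rw [hardyConstant] at hBC
    linarith [show (2 - (N:ℝ) - A) ^ 2 = (A + N - 2) ^ 2 by ring])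
  set β := (D - (A + N - 2)) / 2 with hβ
  have hβeq : β * (β + A + N - 2) = lam - B - C := by rw [hβ]; linarith
  set γ := β - α with hγ
  set u : Euc N → ℝ := fun y => ‖y‖ ^ γ * V y with hu
  have hus : ContDiffOn ℝ ∞ u (coneLike Ω ρ) := (contDiffOn_norm_rpow_euc γ hne).mul hV
  have hupos : ∀ x ∈ coneLike Ω ρ, 0 < u x := fun x hx =>
    mul_pos (Real.rpow_pos_of_pos (norm_pos_iff.2 (hne x hx)) _) (hV0 x (hsub hx))
  refine ⟨u, ⟨?_, gradient u, isH1Loc_of_contDiffOn hO hus, fun φ h hφ _ => ?_⟩,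
    fun K hKG hK => ?_⟩
  · filter_upwards [ae_restrict_mem hO.measurableSet] with x hx using (hupos x hx).le
  · let X : Fin N → Euc N → ℝ := fun i y =>
      γ * ‖y‖ ^ (A + γ - 2) * V y * y i + ‖y‖ ^ (A + γ) * gradient V y i
    have hX : ∀ i, ContDiffOn ℝ ∞ (X i) (coneLike Ω ρ) := fun i =>
      (((contDiffOn_const.mul (contDiffOn_norm_rpow_euc _ hne)).mul hV).mul
        (EuclideanSpace.proj i : Euc N →L[ℝ] ℝ).contDiff.contDiffOn).add
        ((contDiffOn_norm_rpow_euc _ hne).mul (contDiffOn_gradient_apply hO hV i))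
    have e := hφ.integral_sum_mul hO hX
    have e1 : ∫ x in coneLike Ω ρ, ∑ i, X i x * h x i =
        ∫ x in coneLike Ω ρ, inner ℝ (gradient u x) (h x) * ‖x‖ ^ A := by
      refine setIntegral_congr_fun hO.measurableSet fun x hx => ?_
      have hn := norm_pos_iff.2 (hne x hx)
      simp only [X]
      rw [gradient_norm_rpow_mul (hne x hx)
        ((hV.contDiffAt (hO.mem_nhds hx)).differentiableAt (by simp)), euc_inner_eq_sum,
        Finset.sum_mul]
      refine Finset.sum_congr rfl fun i _ => ?_
      rw [show A + γ - 2 = A + (γ - 2) by ring, Real.rpow_add hn, Real.rpow_add hn]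
      simp only [PiLp.add_apply, PiLp.smul_apply, smul_eq_mul]
      ring
    have e2 : ∫ x in coneLike Ω ρ, φ x * ∑ i, gradient (X i) x i =
        -((B + C) * ∫ x in coneLike Ω ρ, u x * φ x * ‖x‖ ^ (A - 2)) := by
      rw [← integral_const_mul, ← integral_neg]
      refine setIntegral_congr_fun hO.measurableSet fun x hx => ?_
      have hn := norm_pos_iff.2 (hne x hx)
      simp only [X]
      rw [sum_gradient_weighted hO hV _ _ _ hx (hne x hx), hVh x (hsub hx), hVE x (hsub hx)]
      have p1 : ‖x‖ ^ (A + γ - 2 - 2) * ‖x‖ ^ 2 = ‖x‖ ^ (A + γ - 2) := by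
        rw [← Real.rpow_natCast, ← Real.rpow_add hn]
        norm_num
      have p2 : ‖x‖ ^ (A + γ - 2) = ‖x‖ ^ γ * ‖x‖ ^ (A - 2) := by
        rw [← Real.rpow_add hn]
        ring_nf
      have key : γ * (A + γ - 2 + α + N) + (A + γ) * α = -(B + C) := by
        rw [hγ]
        linarith
      simp only [hu]
      calc _ = φ x * V x * (γ * ((A + γ - 2) * (‖x‖ ^ (A + γ - 2 - 2) * ‖x‖ ^ 2) +
            (α + N) * ‖x‖ ^ (A + γ - 2)) + (A + γ) * α * ‖x‖ ^ (A + γ - 2)) := by ring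
        _ = φ x * V x * (γ * (A + γ - 2 + α + N) + (A + γ) * α) * ‖x‖ ^ (A + γ - 2) := by
          rw [p1]
          ring
        _ = _ := by
          rw [key, p2]
          ring
    rw [e1, e2] at e
    linarith
  · rcases K.eq_empty_or_nonempty with rfl | hKne
    · exact ⟨1, one_pos, by simp⟩
    · obtain ⟨x, hx, hmin⟩ := hK.exists_isMinOn hKne (hus.continuousOn.mono hKG)
      exact ⟨u x, hupos x (hKG hx), (ae_restrict_mem hK.measurableSet).mono fun y hy => hmin hy⟩

end PowerSolution

/-! ### Mollification of a positive super-solution -/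

section MollifySolution

open scoped Convolution

variable {N : ℕ}

lemma isH1cLinftyc_of_contDiff {G : Set (Euc N)} (hG : IsOpen G) {η : Euc N → ℝ}
    (hη : ContDiff ℝ ∞ η) (hs : HasCompactSupport η) (hsupp : tsupport η ⊆ G) :
    IsH1cLinftyc G η (gradient η) :=
  ⟨(hη.continuous.memLp_of_hasCompactSupport hs).restrict G,
    ((continuous_gradient hη).memLp_of_hasCompactSupport
      (hasCompactSupport_gradient hs)).restrict G,
    (isH1Loc_of_contDiffOn hG hη.contDiffOn).2,
    (hη.continuous.memLp_of_hasCompactSupport hs).restrict G,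
    tsupport η, hsupp, hs, ae_of_all _ fun _ hx => image_eq_zero_of_notMem_tsupport hx⟩

/-- A mollification is bounded below by a lower bound of the function near the point. -/
lemma le_convolution_normed (φ : ContDiffBump (0 : Euc N)) {f : Euc N → ℝ}
    (hf : LocallyIntegrable f) {c : ℝ} {x : Euc N}
    (hc : ∀ᵐ y, y ∈ Metric.ball x φ.rOut → c ≤ f y) :
    c ≤ (φ.normed volume ⋆[ContinuousLinearMap.lsmul ℝ ℝ, volume] f) x := by
  have hi : Integrable fun t => φ.normed volume t * f (x - t) :=
    φ.hasCompactSupport_normed.convolutionExists_left (ContinuousLinearMap.lsmul ℝ ℝ)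
      φ.continuous_normed hf x
  calc c = ∫ t, φ.normed volume t * c := by
        rw [integral_mul_const, φ.integral_normed, one_mul]
    _ ≤ ∫ t, φ.normed volume t * f (x - t) := by
        refine integral_mono_ae (φ.integrable_normed.mul_const c) hi ?_
        have h := (quasiMeasurePreserving_sub_left (volume : Measure (Euc N))
          x).ae hc
        filter_upwards [h] with t ht
        by_cases htb : t ∈ Metric.ball (0 : Euc N) φ.rOut
        · exact mul_le_mul_of_nonneg_left (ht (by simpa [dist_eq_norm] using htb))
            (φ.nonneg_normed t)
        · rw [← φ.support_normed_eq (μ := volume), Function.notMem_support] at htb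
          simp [htb]
    _ = _ := rfl

/-- The gradient of a mollification is the mollification of the weak gradient, at points at a
distance from the boundary. -/
lemma gradient_convolution_normed {G K : Set (Euc N)} (hK : IsCompact K) (hKG : K ⊆ G)
    {u : Euc N → ℝ} {g : Euc N → Euc N} (hu : IsH1Loc G u g)
    (φ : ContDiffBump (0 : Euc N)) {x : Euc N} (hx : Metric.closedBall x φ.rOut ⊆ K) :
    gradient (φ.normed volume ⋆[ContinuousLinearMap.lsmul ℝ ℝ, volume] K.indicator u) x =
      (φ.normed volume ⋆[ContinuousLinearMap.lsmul ℝ ℝ, volume] K.indicator g) x := by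
  set ρ := φ.normed (volume : Measure (Euc N)) with hρ
  have hρs : ContDiff ℝ ∞ ρ := φ.contDiff_normed
  have hρc : HasCompactSupport ρ := φ.hasCompactSupport_normed
  obtain ⟨hm1, hm2⟩ := hu.1 K hKG hK
  have hf : LocallyIntegrable (K.indicator u) :=
    ((memLp_indicator_iff_restrict hK.measurableSet).2 hm1).locallyIntegrable (by norm_num)
  have hfg : LocallyIntegrable (K.indicator g) :=
    ((memLp_indicator_iff_restrict hK.measurableSet).2 hm2).locallyIntegrable (by norm_num)
  have hη : ContDiff ℝ ∞ fun y => ρ (x - y) := hρs.comp (contDiff_const.sub contDiff_id)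
  have hsuppK : tsupport (fun y => ρ (x - y)) ⊆ K := by
    refine (closure_minimal (fun y hy => ?_) Metric.isClosed_closedBall).trans hx
    have : x - y ∈ Function.support ρ := hy
    rw [hρ, φ.support_normed_eq, Metric.mem_ball, dist_zero_right] at this
    rw [Metric.mem_closedBall, dist_eq_norm']
    exact this.le
  have hs : HasCompactSupport fun y => ρ (x - y) :=
    hK.of_isClosed_subset (isClosed_tsupport _) hsuppK
  have hw := hu.2 _ hη hs (hsuppK.trans hKG)
  have e1 : ∫ y in G, u y • gradient (fun y => ρ (x - y)) y =
      ∫ y, K.indicator u y • gradient (fun y => ρ (x - y)) y := by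
    rw [setIntegral_eq_integral_of_forall_compl_eq_zero fun y hy => by
      rw [gradient_eq_zero_of_notMem_tsupport fun h => hy (hKG (hsuppK h)), smul_zero]]
    refine integral_congr_ae (ae_of_all _ fun y => ?_)
    by_cases hy : y ∈ K
    · simp only [Set.indicator_of_mem hy]
    · simp only [gradient_eq_zero_of_notMem_tsupport fun h => hy (hsuppK h), smul_zero]
  have e2 : ∫ y in G, ρ (x - y) • g y = ∫ y, ρ (x - y) • K.indicator g y := by
    rw [setIntegral_eq_integral_of_forall_compl_eq_zero fun y hy => by
      rw [image_eq_zero_of_notMem_tsupport (f := fun y => ρ (x - y))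
        fun h => hy (hKG (hsuppK h)), zero_smul]]
    refine integral_congr_ae (ae_of_all _ fun y => ?_)
    by_cases hy : y ∈ K
    · simp only [Set.indicator_of_mem hy]
    · simp only [image_eq_zero_of_notMem_tsupport (f := fun y => ρ (x - y))
        fun h => hy (hsuppK h), zero_smul]
  have hswap : (ρ ⋆[ContinuousLinearMap.lsmul ℝ ℝ, volume] K.indicator u) =
      (K.indicator u ⋆[ContinuousLinearMap.lsmul ℝ ℝ, volume] ρ) := by
    ext z
    rw [convolution_lsmul_swap, convolution_def]
    refine integral_congr_ae (ae_of_all _ fun y => ?_)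
    simp [mul_comm]
  have hint : Integrable fun y => K.indicator u y • gradient (fun y => ρ (x - y)) y := by
    refine integrable_smul_of_memLp_two
      ((memLp_indicator_iff_restrict hK.measurableSet).2 hm1) ?_
    exact (continuous_gradient hη).memLp_of_hasCompactSupport (hasCompactSupport_gradient hs)
  rw [convolution_lsmul_swap, ← e2, ← neg_eq_iff_eq_neg.2 hw, e1]
  ext i
  rw [hswap, gradient_convolution_apply hf hρs hρc, PiLp.neg_apply, integral_euc_apply hint,
    convolution_def, ← integral_neg]
  refine integral_congr_ae (ae_of_all _ fun y => ?_)
  simp [gradient_comp_const_sub hρs]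

/-- The gradient of `Ψ² / v`. -/
lemma gradient_sq_div {Ψ v : Euc N → ℝ} {x : Euc N} (hΨ : DifferentiableAt ℝ Ψ x)
    (hv : DifferentiableAt ℝ v x) (h0 : v x ≠ 0) :
    gradient (fun y => Ψ y ^ 2 * (v y)⁻¹) x =
      (2 * Ψ x / v x) • gradient Ψ x - (Ψ x ^ 2 / v x ^ 2) • gradient v x := by
  refine gradient_eq_of_hasFDerivAt ((hΨ.hasFDerivAt.pow 2).mul
    ((hasDerivAt_inv h0).comp_hasFDerivAt x hv.hasFDerivAt)) fun w => ?_
  simp [inner_sub_left, inner_smul_left, inner_gradient_left]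
  field_simp
  ring

end MollifySolution

/-! ### The energy inequality -/

section Energy

open scoped Convolution

/-- A perturbed form of Picone's inequality `2 (P/v) q·p - (P/v)² |q|² ≤ |p|²`, with an error which
is small when `g` is close to `q`. -/
lemma inner_picone_le {E : Type*} [NormedAddCommGroup E] [InnerProductSpace ℝ E] {P v c : ℝ}
    (hc : 0 < c) (hcv : c ≤ v) (g q p : E) :
    inner ℝ g ((2 * P / v) • p - (P ^ 2 / v ^ 2) • q) ≤
      ‖p‖ ^ 2 + ‖g - q‖ * (2 * |P| * ‖p‖ / c + P ^ 2 / c ^ 2 * (‖g‖ + ‖g - q‖)) := by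
  have hv : 0 < v := hc.trans_le hcv
  set X := (2 * P / v) • p - (P ^ 2 / v ^ 2) • q with hX
  have h1 : inner ℝ q X ≤ ‖p‖ ^ 2 := by
    have h := sq_nonneg ‖p - (P / v) • q‖
    rw [norm_sub_sq_real, inner_smul_right, norm_smul, mul_pow, Real.norm_eq_abs, sq_abs,
      real_inner_comm] at h
    have : inner ℝ q X = 2 * (P / v * inner ℝ q p) - (P / v) ^ 2 * ‖q‖ ^ 2 := by
      rw [hX, inner_sub_right, inner_smul_right, inner_smul_right, real_inner_self_eq_norm_sq]
      ring
    linarith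
  have h2 : ‖X‖ ≤ 2 * |P| * ‖p‖ / c + P ^ 2 / c ^ 2 * (‖g‖ + ‖g - q‖) := by
    refine (norm_sub_le _ _).trans (add_le_add ?_ ?_)
    · rw [norm_smul, Real.norm_eq_abs, abs_div, abs_mul, abs_two, abs_of_pos hv, div_mul_eq_mul_div]
      exact div_le_div_of_nonneg_left (by positivity) hc hcv
    · rw [norm_smul, Real.norm_eq_abs, abs_of_nonneg (by positivity)]
      have hq : ‖q‖ ≤ ‖g‖ + ‖g - q‖ := by
        have := norm_sub_le g (g - q)
        rwa [sub_sub_cancel] at this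
      gcongr
  calc inner ℝ g X = inner ℝ q X + inner ℝ (g - q) X := by rw [inner_sub_left]; ring
    _ ≤ ‖p‖ ^ 2 + ‖g - q‖ * ‖X‖ := add_le_add h1 (real_inner_le_norm _ _)
    _ ≤ _ := by gcongr

lemma mul_le_sq_add_sq_div {a b δ : ℝ} (hδ : 0 < δ) : a * b ≤ δ * b ^ 2 + δ⁻¹ * a ^ 2 := by
  have h := two_mul_le_add_sq (Real.sqrt δ * b) (Real.sqrt δ⁻¹ * a)
  have e : Real.sqrt δ * Real.sqrt δ⁻¹ = 1 := by
    rw [← Real.sqrt_mul hδ.le, mul_inv_cancel₀ hδ.ne', Real.sqrt_one]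
  rw [mul_pow, mul_pow, Real.sq_sqrt hδ.le, Real.sq_sqrt (inv_nonneg.2 hδ.le)] at h
  have e2 : 2 * (Real.sqrt δ * b) * (Real.sqrt δ⁻¹ * a) = 2 * (a * b) := by
    linear_combination 2 * a * b * e
  have : 0 ≤ δ * b ^ 2 + δ⁻¹ * a ^ 2 := by positivity
  linarith

variable {N : ℕ}

lemma integral_norm_sq_eq {F : Type*} [NormedAddCommGroup F] {d : Euc N → F}
    {μ : Measure (Euc N)} (hd : AEStronglyMeasurable d μ) :
    ∫ x, ‖d x‖ ^ 2 ∂μ = (∫⁻ x, ‖d x‖ₑ ^ 2 ∂μ).toReal := by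
  have h : AEStronglyMeasurable (fun x => ‖d x‖ ^ 2) μ := hd.norm.pow 2
  rw [integral_eq_lintegral_of_nonneg_ae (ae_of_all _ fun x => by positivity) h]
  congr 1
  refine lintegral_congr fun x => ?_
  rw [ENNReal.ofReal_pow (norm_nonneg _), ofReal_norm]

lemma integrable_inner_of_memLp_two {F : Type*} [NormedAddCommGroup F] [InnerProductSpace ℝ F]
    {f g : Euc N → F} {μ : Measure (Euc N)} (hf : MemLp f 2 μ) (hg : MemLp g 2 μ) :
    Integrable (fun x => inner ℝ (f x) (g x)) μ :=
  (hf.norm.integrable_mul hg.norm).mono' (hf.1.inner hg.1)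
    (ae_of_all _ fun _ => norm_inner_le_norm _ _)

lemma tendsto_setIntegral_sub_convolution {F : Type*} [NormedAddCommGroup F] [NormedSpace ℝ F]
    [CompleteSpace F] {f f' : Euc N → F} (hf : MemLp f 2) {K : Set (Euc N)} (hK : MeasurableSet K)
    (hff' : ∀ x ∈ K, f x = f' x) :
    Tendsto (fun n => ∫ x in K, ‖f' x - ((bumpSeq N n).normed volume
      ⋆[ContinuousLinearMap.lsmul ℝ ℝ, volume] f) x‖ ^ 2) atTop (𝓝 0) := by
  have h := tendsto_lintegral_sub_convolution hf
  have h2 := (ENNReal.tendsto_toReal ENNReal.zero_ne_top).comp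
    (tendsto_of_tendsto_of_tendsto_of_le_of_le tendsto_const_nhds h (fun n => zero_le) fun n =>
      (setLIntegral_le_lintegral K fun x => ‖f x - ((bumpSeq N n).normed volume
        ⋆[ContinuousLinearMap.lsmul ℝ ℝ, volume] f) x‖ₑ ^ 2))
  refine h2.congr fun n => ?_
  have hm : AEStronglyMeasurable (fun x => f x - ((bumpSeq N n).normed volume
      ⋆[ContinuousLinearMap.lsmul ℝ ℝ, volume] f) x) (volume.restrict K) :=
    (hf.1.sub (((bumpSeq N n).hasCompactSupport_normed.continuous_convolution_left _
      (bumpSeq N n).continuous_normed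
        (hf.locallyIntegrable (by norm_num))).aestronglyMeasurable)).restrict
  rw [setIntegral_congr_fun (g := fun x => ‖f x - ((bumpSeq N n).normed volume
      ⋆[ContinuousLinearMap.lsmul ℝ ℝ, volume] f) x‖ ^ 2) hK fun x hx => by simp only [hff' x hx],
    integral_norm_sq_eq hm]
  rfl

/-- The quadratic form of the equation is nonnegative on test functions as soon as there is a
positive super-solution `u`: the equation is tested with `Ψ² / u_n`, where `u_n` are mollifications
of `u`, which are bounded below near the support of `Ψ`. -/
lemma IsPositiveSuperSolution.energy_le {G : Set (Euc N)} (hG : IsOpen G) (h0 : ∀ x ∈ G, x ≠ 0)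
    {A B C : ℝ} (hBC : 0 ≤ B + C) {u : Euc N → ℝ} (hu : IsPositiveSuperSolution A B C G u)
    {Ψ : Euc N → ℝ} (hΨ : ContDiff ℝ ∞ Ψ) (hs : HasCompactSupport Ψ) (hsupp : tsupport Ψ ⊆ G) :
    (B + C) * ∫ x, Ψ x ^ 2 * ‖x‖ ^ (A - 2) ≤ ∫ x, ‖gradient Ψ x‖ ^ 2 * ‖x‖ ^ A := by
  obtain ⟨⟨-, g, hH, hsup⟩, hpos⟩ := hu
  set K := tsupport Ψ with hK
  have hKc : IsCompact K := hs
  have hKm := hKc.measurableSet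
  obtain ⟨K', hK'c, hKK', hK'G⟩ := exists_compact_between hKc hG hsupp
  obtain ⟨c, hc, hcu⟩ := hpos K' hK'G hK'c
  obtain ⟨d, hd, hdK⟩ := hKc.exists_cthickening_subset_open isOpen_interior hKK'
  set O := Metric.thickening (d / 2) K with hO
  have hOo : IsOpen O := Metric.isOpen_thickening
  have hKO : K ⊆ O := Metric.self_subset_thickening (by positivity) K
  have hball : ∀ x ∈ O, Metric.closedBall x (d / 2) ⊆ K' := fun x hx y hy => by
    obtain ⟨z, hz, hxz⟩ := Metric.mem_thickening_iff.1 hx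
    refine interior_subset (hdK (Metric.thickening_subset_cthickening _ _
      (Metric.mem_thickening_iff.2 ⟨z, hz, ?_⟩)))
    have := dist_triangle y x z
    rw [Metric.mem_closedBall] at hy
    linarith
  have hKK : K ⊆ K' := hKK'.trans interior_subset
  obtain ⟨hu2, hg2⟩ := hH.1 K' hK'G hK'c
  obtain ⟨huK, hgK⟩ := hH.1 K hsupp hKc
  have hf2 : MemLp (K'.indicator u) 2 := (memLp_indicator_iff_restrict hK'c.measurableSet).2 hu2
  have hfg2 : MemLp (K'.indicator g) 2 := (memLp_indicator_iff_restrict hK'c.measurableSet).2 hg2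
  set v : ℕ → Euc N → ℝ := fun n => (bumpSeq N n).normed volume
    ⋆[ContinuousLinearMap.lsmul ℝ ℝ, volume] K'.indicator u with hv
  set q : ℕ → Euc N → Euc N := fun n => (bumpSeq N n).normed volume
    ⋆[ContinuousLinearMap.lsmul ℝ ℝ, volume] K'.indicator g with hq
  have hvs : ∀ n, ContDiff ℝ ∞ (v n) := fun n =>
    (bumpSeq N n).hasCompactSupport_normed.contDiff_convolution_left (n := ⊤) _
      (bumpSeq N n).contDiff_normed (hf2.locallyIntegrable (by norm_num))
  have hqc : ∀ n, Continuous (q n) := fun n =>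
    (bumpSeq N n).hasCompactSupport_normed.continuous_convolution_left _
      (bumpSeq N n).continuous_normed (hfg2.locallyIntegrable (by norm_num))
  -- the weights are bounded on the support
  have hw : ∀ s : ℝ, ContinuousOn (fun x : Euc N => ‖x‖ ^ s) K := fun s =>
    (contDiffOn_norm_rpow_euc s fun x hx => h0 x (hsupp hx)).continuousOn
  have hΨc := hΨ.continuous
  have hΨ'c := continuous_gradient hΨ
  obtain ⟨Ma, hMa⟩ := hKc.exists_bound_of_continuousOn
    ((hΨc.pow 2).continuousOn.mul (hw (A - 2)))
  obtain ⟨Mb, hMb⟩ := hKc.exists_bound_of_continuousOn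
    (((hΨc.abs.const_mul 2).mul hΨ'c.norm).continuousOn.mul (hw A))
  obtain ⟨Mc, hMc⟩ := hKc.exists_bound_of_continuousOn ((hΨc.pow 2).continuousOn.mul (hw A))
  set Q := |Mb| / c + |Mc| / c ^ 2 with hQ
  have hQ0 : 0 ≤ Q := by positivity
  set I₂ := ∫ x, Ψ x ^ 2 * ‖x‖ ^ (A - 2) with hI₂
  set I₁ := ∫ x, ‖gradient Ψ x‖ ^ 2 * ‖x‖ ^ A with hI₁
  have hI₂K : I₂ = ∫ x in K, Ψ x ^ 2 * ‖x‖ ^ (A - 2) :=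
    (setIntegral_eq_integral_of_forall_compl_eq_zero fun x hx => by
      simp [image_eq_zero_of_notMem_tsupport hx]).symm
  have hI₁K : I₁ = ∫ x in K, ‖gradient Ψ x‖ ^ 2 * ‖x‖ ^ A :=
    (setIntegral_eq_integral_of_forall_compl_eq_zero fun x hx => by
      simp [gradient_eq_zero_of_notMem_tsupport hx]).symm
  set J := ∫ x in K, (1 + ‖g x‖) ^ 2 with hJ
  set k := (volume : Measure (Euc N)).real K with hk
  set e : ℕ → ℝ := fun n => ∫ x in K, ‖u x - v n x‖ ^ 2 with he
  set E : ℕ → ℝ := fun n => ∫ x in K, ‖g x - q n x‖ ^ 2 with hE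
  have hte : Tendsto e atTop (𝓝 0) := tendsto_setIntegral_sub_convolution hf2 hKm
    fun x hx => Set.indicator_of_mem (hKK hx) u
  have htE : Tendsto E atTop (𝓝 0) := tendsto_setIntegral_sub_convolution hfg2 hKm
    fun x hx => Set.indicator_of_mem (hKK hx) g
  have hfinK : IsFiniteMeasure (volume.restrict K) :=
    isFiniteMeasure_restrict.2 hKc.measure_lt_top.ne
  have key : ∀ δ > 0, ∀ᶠ n in atTop, (B + C) * (I₂ - |Ma| / c * (δ * k + δ⁻¹ * e n)) ≤
      I₁ + Q * (δ * J + (δ⁻¹ + 1) * E n) := fun δ hδ => by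
    filter_upwards [(tendsto_bumpSeq_rOut N).eventually_lt_const (half_pos hd)] with n hn
    have hvc : ∀ x ∈ O, c ≤ v n x := fun x hx => by
      refine le_convolution_normed _ (hf2.locallyIntegrable (by norm_num)) ?_
      filter_upwards [ae_imp_of_ae_restrict hcu] with y hy hyB
      have : y ∈ K' := hball x hx (Metric.ball_subset_closedBall
        (Metric.ball_subset_ball hn.le hyB))
      rw [Set.indicator_of_mem this]
      exact hy this
    have hvq : ∀ x ∈ O, gradient (v n) x = q n x := fun x hx =>
      gradient_convolution_normed hK'c hK'G hH _
        ((Metric.closedBall_subset_closedBall hn.le).trans (hball x hx))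
    have hv0 : ∀ x ∈ O, v n x ≠ 0 := fun x hx => (hc.trans_le (hvc x hx)).ne'
    set Φ : Euc N → ℝ := fun y => Ψ y ^ 2 * (v n y)⁻¹ with hΦ
    have hΨ2 : tsupport (fun y => Ψ y ^ 2) ⊆ K :=
      closure_minimal (fun y hy => by_contra fun h => hy (by
        simp [image_eq_zero_of_notMem_tsupport h])) (isClosed_tsupport Ψ)
    have hΦs : ContDiff ℝ ∞ Φ := contDiff_mul_of_tsupport_subset hOo (hΨ.pow 2)
      (hΨ2.trans hKO) ((hvs n).contDiffOn.inv hv0)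
    have hΦK : tsupport Φ ⊆ K := tsupport_mul_subset_left.trans hΨ2
    have hΦc : HasCompactSupport Φ := hKc.of_isClosed_subset (isClosed_tsupport _) hΦK
    have hΦg : ∀ x ∈ K, gradient Φ x =
        (2 * Ψ x / v n x) • gradient Ψ x - (Ψ x ^ 2 / v n x ^ 2) • q n x := fun x hx => by
      rw [hΦ, gradient_sq_div (hΨ.differentiable (by simp) x) ((hvs n).differentiable (by simp) x)
        (hv0 x (hKO hx)), hvq x (hKO hx)]
    have htest := hsup Φ (gradient Φ) (isH1cLinftyc_of_contDiff hG hΦs hΦc (hΦK.trans hsupp)) (by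
      refine (ae_restrict_iff' hG.measurableSet).2 (ae_of_all _ fun x _ => ?_)
      by_cases hx : x ∈ K
      · exact mul_nonneg (sq_nonneg _) (inv_nonneg.2 (hc.le.trans (hvc x (hKO hx))))
      · simp [hΦ, image_eq_zero_of_notMem_tsupport hx])
    have r1 : ∫ x in G, u x * Φ x * ‖x‖ ^ (A - 2) = ∫ x in K, u x * Φ x * ‖x‖ ^ (A - 2) :=
      (setIntegral_eq_of_subset_of_forall_sdiff_eq_zero hG.measurableSet hsupp fun x hx => by
        simp [image_eq_zero_of_notMem_tsupport fun h => hx.2 (hΦK h)])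
    have r2 : ∫ x in G, inner ℝ (g x) (gradient Φ x) * ‖x‖ ^ A =
        ∫ x in K, inner ℝ (g x) (gradient Φ x) * ‖x‖ ^ A :=
      (setIntegral_eq_of_subset_of_forall_sdiff_eq_zero hG.measurableSet hsupp fun x hx => by
        simp [gradient_eq_zero_of_notMem_tsupport fun h => hx.2 (hΦK h)])
    rw [r1, r2] at htest
    -- integrability of all the terms
    have i1 : IntegrableOn (fun x => u x * Φ x * ‖x‖ ^ (A - 2)) K := by
      simp only [mul_assoc]
      exact huK.integrable_mul (memLp_of_continuousOn_isCompact (p := 2)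
        (hΦs.continuous.continuousOn.mul (hw (A - 2))) hKc)
    have i2 : IntegrableOn (fun x => inner ℝ (g x) (gradient Φ x) * ‖x‖ ^ A) K := by
      have := integrable_inner_of_memLp_two hgK (memLp_of_continuousOn_isCompact (p := 2)
        ((hw A).smul (continuous_gradient hΦs).continuousOn) hKc)
      refine this.congr (ae_of_all _ fun x => ?_)
      simp only [Pi.smul_apply', inner_smul_right]
      ring
    have i3 : IntegrableOn (fun x => Ψ x ^ 2 * ‖x‖ ^ (A - 2)) K :=
      ((hΨc.pow 2).continuousOn.mul (hw (A - 2))).integrableOn_compact hKc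
    have i4 : IntegrableOn (fun x => ‖gradient Ψ x‖ ^ 2 * ‖x‖ ^ A) K :=
      ((hΨ'c.norm.pow 2).continuousOn.mul (hw A)).integrableOn_compact hKc
    have i5 : IntegrableOn (fun x => (1 + ‖g x‖) ^ 2) K :=
      ((memLp_const (1:ℝ)).add hgK.norm).integrable_sq
    have i6 : IntegrableOn (fun x => ‖u x - v n x‖ ^ 2) K :=
      (huK.sub (memLp_of_continuousOn_isCompact (hvs n).continuous.continuousOn
        hKc)).norm.integrable_sq
    have i7 : IntegrableOn (fun x => ‖g x - q n x‖ ^ 2) K :=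
      (hgK.sub (memLp_of_continuousOn_isCompact (hqc n).continuousOn hKc)).norm.integrable_sq
    have j1 : IntegrableOn (fun x => δ * 1 + δ⁻¹ * ‖u x - v n x‖ ^ 2) K :=
      (integrable_const _).add (i6.const_mul _)
    have j2 : IntegrableOn (fun x => δ * (1 + ‖g x‖) ^ 2 + (δ⁻¹ + 1) * ‖g x - q n x‖ ^ 2) K :=
      (i5.const_mul _).add (i7.const_mul _)
    have low : I₂ - |Ma| / c * (δ * k + δ⁻¹ * e n) ≤
        ∫ x in K, u x * Φ x * ‖x‖ ^ (A - 2) := by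
      calc I₂ - |Ma| / c * (δ * k + δ⁻¹ * e n)
          = ∫ x in K, (Ψ x ^ 2 * ‖x‖ ^ (A - 2) -
              |Ma| / c * (δ * 1 + δ⁻¹ * ‖u x - v n x‖ ^ 2)) := by
            rw [integral_sub i3 (j1.const_mul _),
              integral_const_mul, integral_add (integrable_const _) (i6.const_mul _),
              integral_const_mul δ⁻¹, hI₂K]
            simp only [integral_const, measureReal_restrict_apply_univ, smul_eq_mul, mul_one]
            rw [mul_comm _ δ]
        _ ≤ _ := by
            refine setIntegral_mono_on (i3.sub (j1.const_mul _)) i1 hKm fun x hx => ?_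
            have hcv := hvc x (hKO hx)
            have hvpos := hc.trans_le hcv
            have h1 := hMa x hx
            have h2 : |u x - v n x| * 1 ≤ δ * 1 ^ 2 + δ⁻¹ * |u x - v n x| ^ 2 :=
              mul_le_sq_add_sq_div hδ
            simp only [Pi.mul_apply, Pi.pow_apply] at h1
            have h3 : Ψ x ^ 2 * ‖x‖ ^ (A - 2) * (|u x - v n x| / v n x) ≤
                |Ma| * (|u x - v n x| / c) := by
              refine mul_le_mul ((le_abs_self _).trans (h1.trans (le_abs_self _))) ?_
                (by positivity) (abs_nonneg _)
              exact div_le_div_of_nonneg_left (abs_nonneg _) hc hcv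
            have h4 : u x * Φ x * ‖x‖ ^ (A - 2) = Ψ x ^ 2 * ‖x‖ ^ (A - 2) +
                Ψ x ^ 2 * ‖x‖ ^ (A - 2) * ((u x - v n x) / v n x) := by
              simp only [hΦ]
              field_simp
              ring
            have h5 : -(|u x - v n x| / v n x) ≤ (u x - v n x) / v n x := by
              rw [← neg_div]
              exact div_le_div_of_nonneg_right (neg_abs_le _) hvpos.le
            have h6 := mul_le_mul_of_nonneg_left h5
              (by positivity : 0 ≤ Ψ x ^ 2 * ‖x‖ ^ (A - 2))
            have h7 : |Ma| * (|u x - v n x| / c) ≤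
                |Ma| / c * (δ * 1 + δ⁻¹ * ‖u x - v n x‖ ^ 2) := by
              rw [Real.norm_eq_abs, mul_div_assoc', div_mul_eq_mul_div]
              refine div_le_div_of_nonneg_right (mul_le_mul_of_nonneg_left ?_ (abs_nonneg _)) hc.le
              linarith
            linarith
    have high : ∫ x in K, inner ℝ (g x) (gradient Φ x) * ‖x‖ ^ A ≤
        I₁ + Q * (δ * J + (δ⁻¹ + 1) * E n) := by
      calc _ ≤ ∫ x in K, (‖gradient Ψ x‖ ^ 2 * ‖x‖ ^ A +
              Q * (δ * (1 + ‖g x‖) ^ 2 + (δ⁻¹ + 1) * ‖g x - q n x‖ ^ 2)) := by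
            refine setIntegral_mono_on i2 (i4.add (j2.const_mul _)) hKm fun x hx => ?_
            rw [hΦg x hx]
            have h1 := inner_picone_le (P := Ψ x) hc (hvc x (hKO hx)) (g x) (q n x) (gradient Ψ x)
            set D := ‖g x - q n x‖ with hD
            have hw0 : 0 ≤ ‖x‖ ^ A := by positivity
            have h2 := mul_le_mul_of_nonneg_right h1 hw0
            have h3 := (le_abs_self _).trans ((hMb x hx).trans (le_abs_self _))
            have h4 := (le_abs_self _).trans ((hMc x hx).trans (le_abs_self _))
            simp only [Pi.mul_apply, Pi.pow_apply] at h3 h4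
            have h5 : D * (1 + ‖g x‖) ≤ δ * (1 + ‖g x‖) ^ 2 + δ⁻¹ * D ^ 2 :=
              mul_le_sq_add_sq_div hδ
            have hD0 : 0 ≤ D := norm_nonneg _
            have h6 : D * (2 * |Ψ x| * ‖gradient Ψ x‖ / c +
                Ψ x ^ 2 / c ^ 2 * (‖g x‖ + D)) * ‖x‖ ^ A ≤ D * (Q * (1 + ‖g x‖ + D)) := by
              rw [mul_assoc]
              refine mul_le_mul_of_nonneg_left ?_ hD0
              calc _ = (2 * |Ψ x| * ‖gradient Ψ x‖ * ‖x‖ ^ A) / c * 1 +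
                    (Ψ x ^ 2 * ‖x‖ ^ A) / c ^ 2 * (‖g x‖ + D) := by ring
                _ ≤ |Mb| / c * (1 + ‖g x‖ + D) + |Mc| / c ^ 2 * (1 + ‖g x‖ + D) := by
                  gcongr
                  · linarith [norm_nonneg (g x)]
                  · linarith
                _ = _ := by rw [hQ]; ring
            calc _ ≤ _ := h2
              _ = ‖gradient Ψ x‖ ^ 2 * ‖x‖ ^ A + D * (2 * |Ψ x| * ‖gradient Ψ x‖ / c +
                Ψ x ^ 2 / c ^ 2 * (‖g x‖ + D)) * ‖x‖ ^ A := by ring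
              _ ≤ ‖gradient Ψ x‖ ^ 2 * ‖x‖ ^ A + Q * (D * (1 + ‖g x‖) + D ^ 2) := by
                linarith
              _ ≤ _ := by
                refine add_le_add le_rfl (mul_le_mul_of_nonneg_left ?_ hQ0)
                linarith
        _ = _ := by
            rw [integral_add i4 (j2.const_mul _),
              integral_const_mul, integral_add (i5.const_mul _) (i7.const_mul _),
              integral_const_mul, integral_const_mul, hI₁K]
    have h1 := mul_le_mul_of_nonneg_left low hBC
    linarith
  have key2 : ∀ δ > 0, (B + C) * (I₂ - |Ma| / c * (δ * k)) ≤ I₁ + Q * (δ * J) := fun δ hδ => by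
    have t1 : Tendsto (fun n => (B + C) * (I₂ - |Ma| / c * (δ * k + δ⁻¹ * e n))) atTop
        (𝓝 ((B + C) * (I₂ - |Ma| / c * (δ * k + δ⁻¹ * 0)))) :=
      (((hte.const_mul _).const_add _).const_mul _).const_sub _ |>.const_mul _
    have t2 : Tendsto (fun n => I₁ + Q * (δ * J + (δ⁻¹ + 1) * E n)) atTop
        (𝓝 (I₁ + Q * (δ * J + (δ⁻¹ + 1) * 0))) :=
      (((htE.const_mul _).const_add _).const_mul _).const_add _
    simpa using le_of_tendsto_of_tendsto t1 t2 (key δ hδ)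
  have c1 : Continuous fun δ : ℝ => (B + C) * (I₂ - |Ma| / c * (δ * k)) := by fun_prop
  have c2 : Continuous fun δ : ℝ => I₁ + Q * (δ * J) := by fun_prop
  have := le_of_tendsto_of_tendsto (b := 𝓝[>] 0) ((c1.tendsto 0).mono_left nhdsWithin_le_nhds)
    ((c2.tendsto 0).mono_left nhdsWithin_le_nhds)
    (eventually_nhdsWithin_of_forall fun δ hδ => key2 δ hδ)
  simpa using this

end Energy

/-! ### Nonexistence above the critical value -/

section Optimality

/-- Functions on the line whose derivative is small in `L^2` compared with the function, with
support far to the right: dilations of a fixed bump. -/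
lemma exists_slowly_varying (T₀ : ℝ) {ε : ℝ} (hε : 0 < ε) :
    ∃ (b : ℝ → ℝ) (p q : ℝ), ContDiff ℝ ∞ b ∧ T₀ < p ∧ (∀ t ∉ Set.Icc p q, b t = 0) ∧
      0 < ∫ t, b t ^ 2 ∧ ∫ t, deriv b t ^ 2 < ε * ∫ t, b t ^ 2 := by
  let χ : ContDiffBump (0 : ℝ) := ⟨1, 2, one_pos, one_lt_two⟩
  have hχc : Continuous χ := χ.continuous
  set Y := ∫ t, χ t ^ 2 with hY
  set X := ∫ t, deriv χ t ^ 2 with hX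
  have hY0 : 0 < Y := by
    refine (hχc.pow 2).integral_pos_of_hasCompactSupport_nonneg_nonzero
      (χ.hasCompactSupport.comp_left (g := fun s : ℝ => s ^ 2) (by simp))
      (fun t => sq_nonneg _) (x := 0) ?_
    rw [χ.one_of_mem_closedBall (by simp [χ])]
    norm_num
  have hX0 : 0 ≤ X := integral_nonneg fun t => sq_nonneg _
  set L := 1 + X / (ε * Y) with hL
  have hL1 : 1 ≤ L := le_add_of_nonneg_right (by positivity)
  have hL0 : 0 < L := one_pos.trans_le hL1
  have hLX : X < ε * (L * Y) := by
    have : ε * (L * Y) = ε * Y + X := by rw [hL]; field_simp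
    rw [this]
    linarith [mul_pos hε hY0]
  set T := T₀ + 2 * L + 1 with hT
  have hscale : ∀ F : ℝ → ℝ, ∫ t, F ((t - T) / L) = L * ∫ t, F t := fun F => by
    rw [integral_sub_right_eq_self (fun t => F (t / L)) T, Measure.integral_comp_div,
      abs_of_pos hL0, smul_eq_mul]
  have hd : ∀ t, deriv (fun t => χ ((t - T) / L)) t = L⁻¹ * deriv χ ((t - T) / L) := fun t => by
    have h1 := (χ.contDiff (n := 1)).differentiable (by simp) ((t - T) / L)
    have h2 : HasDerivAt (fun t => (t - T) / L) (1 / L) t :=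
      ((hasDerivAt_id t).sub_const T).div_const L
    refine (h1.hasDerivAt.comp t h2).deriv.trans ?_
    ring
  refine ⟨fun t => χ ((t - T) / L), T - 2 * L, T + 2 * L, ?_, by linarith, fun t ht => ?_, ?_, ?_⟩
  · exact χ.contDiff.comp ((contDiff_id.sub contDiff_const).div_const L)
  · refine χ.zero_of_le_dist ?_
    rw [Real.dist_eq, sub_zero, abs_div, abs_of_pos hL0, le_div_iff₀ hL0]
    change 2 * L ≤ |t - T|
    rw [le_abs']
    by_contra! h
    exact ht ⟨by linarith, by linarith⟩
  · rw [hscale fun t => χ t ^ 2]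
    positivity
  · simp only [hd, mul_pow]
    rw [integral_const_mul, hscale fun t => χ t ^ 2, hscale fun t => deriv χ t ^ 2]
    calc (L⁻¹) ^ 2 * (L * X) = X / L := by field_simp
      _ ≤ X := div_le_self hX0 hL1
      _ < _ := hLX

/-- The substitution `r = e^t`. -/
lemma integral_inv_mul_comp_log (F : ℝ → ℝ) :
    ∫ r in Set.Ioi (0:ℝ), r⁻¹ * F (Real.log r) = ∫ t, F t := by
  have h := integral_image_eq_integral_abs_deriv_smul (s := Set.univ) (f := Real.exp)
    (f' := Real.exp) MeasurableSet.univ (fun t _ => (Real.hasDerivAt_exp t).hasDerivWithinAt)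
    Real.exp_injective.injOn (fun r => r⁻¹ * F (Real.log r))
  rw [Set.image_univ, Real.range_exp] at h
  rw [h, setIntegral_univ]
  refine integral_congr_ae (ae_of_all _ fun t => ?_)
  simp only [Real.abs_exp, Real.log_exp, smul_eq_mul]
  rw [mul_inv_cancel_left₀ (Real.exp_pos t).ne']

/-- The function `r ↦ r^(-s) b(log r)`, extended by zero to `r ≤ 0`. -/
def logProfile (s : ℝ) (b : ℝ → ℝ) (r : ℝ) : ℝ :=
  (Set.Ioi 0).indicator (fun r => r ^ (-s) * b (Real.log r)) r

section LogProfile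

variable {s : ℝ} {b : ℝ → ℝ}

lemma logProfile_of_pos {r : ℝ} (hr : 0 < r) : logProfile s b r = r ^ (-s) * b (Real.log r) :=
  Set.indicator_of_mem (show r ∈ Set.Ioi 0 from hr) _

lemma logProfile_eq_zero {p q : ℝ} (h0 : ∀ t ∉ Set.Icc p q, b t = 0) {r : ℝ}
    (hr : r ∉ Set.Icc (Real.exp p) (Real.exp q)) : logProfile s b r = 0 := by
  by_cases h : 0 < r
  · rw [logProfile_of_pos h, h0, mul_zero]
    intro hm
    exact hr ⟨(Real.le_log_iff_exp_le h).1 hm.1, (Real.log_le_iff_le_exp h).1 hm.2⟩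
  · exact Set.indicator_of_notMem (show r ∉ Set.Ioi 0 from h) _

lemma contDiff_logProfile (hb : ContDiff ℝ ∞ b) {p q : ℝ} (h0 : ∀ t ∉ Set.Icc p q, b t = 0) :
    ContDiff ℝ ∞ (logProfile s b) := by
  refine contDiff_iff_contDiffAt.2 fun r => ?_
  by_cases hr : 0 < r
  · have h1 : ContDiffAt ℝ ∞ (fun r => r ^ (-s) * b (Real.log r)) r :=
      (Real.contDiffAt_rpow_const_of_ne hr.ne').mul
        (hb.contDiffAt.comp r (Real.contDiffAt_log.2 hr.ne'))
    refine h1.congr_of_eventuallyEq ?_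
    filter_upwards [Ioi_mem_nhds hr] with t ht using logProfile_of_pos ht
  · have h1 : logProfile s b =ᶠ[𝓝 r] fun _ => 0 := by
      filter_upwards [Iio_mem_nhds ((not_lt.1 hr).trans_lt (Real.exp_pos p))] with t ht
      exact logProfile_eq_zero h0 fun h => absurd h.1 (not_le.2 ht)
    exact contDiffAt_const.congr_of_eventuallyEq h1

lemma deriv_logProfile (hb : ContDiff ℝ ∞ b) {r : ℝ} (hr : 0 < r) :
    deriv (logProfile s b) r =
      r ^ (-s) * r⁻¹ * (deriv b (Real.log r) - s * b (Real.log r)) := by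
  have h1 : logProfile s b =ᶠ[𝓝 r] fun r => r ^ (-s) * b (Real.log r) := by
    filter_upwards [Ioi_mem_nhds hr] with t ht using logProfile_of_pos ht
  have h2 := (Real.hasDerivAt_rpow_const (p := -s) (Or.inl hr.ne')).mul
    ((hb.differentiable (by simp) (Real.log r)).hasDerivAt.comp r (Real.hasDerivAt_log hr.ne'))
  rw [h1.deriv_eq]
  refine h2.deriv.trans ?_
  rw [Real.rpow_sub_one hr.ne']
  simp only [Function.comp_apply]
  ring

end LogProfile

lemma integral_deriv_sub_mul_sq {b : ℝ → ℝ} (hb : ContDiff ℝ ∞ b) {p q : ℝ}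
    (h0 : ∀ t ∉ Set.Icc p q, b t = 0) (s : ℝ) :
    ∫ t, (deriv b t - s * b t) ^ 2 = (∫ t, deriv b t ^ 2) + s ^ 2 * ∫ t, b t ^ 2 := by
  have h1 : ∀ t ∉ Set.Icc p q, deriv b t = 0 := fun t ht => deriv_eq_zero_of_notMem_Icc h0 ht
  have hs : ∀ F : ℝ → ℝ, (∀ t ∉ Set.Icc p q, F t = 0) → Continuous F → Integrable F :=
    fun F hF hFc => hFc.integrable_of_hasCompactSupport (HasCompactSupport.intro isCompact_Icc hF)
  have hd : Continuous (deriv b) := hb.continuous_deriv (by simp)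
  have hc := hb.continuous
  have i1 : Integrable fun t => deriv b t ^ 2 := hs _ (fun t ht => by simp [h1 t ht]) (hd.pow 2)
  have i2 : Integrable fun t => b t ^ 2 := hs _ (fun t ht => by simp [h0 t ht]) (hc.pow 2)
  have i3 : Integrable fun t => 2 * b t * deriv b t :=
    hs _ (fun t ht => by simp [h0 t ht]) ((hc.const_mul 2).mul hd)
  have h3 : ∫ t, 2 * b t * deriv b t = 0 :=
    integral_eq_zero_of_hasDerivAt_of_integrable (f := fun t => b t ^ 2) (fun t =>
      ((hb.differentiable (by simp) t).hasDerivAt.fun_pow 2).congr_deriv (by simp)) i3 i2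
  have e : ∀ t, (deriv b t - s * b t) ^ 2 =
      (deriv b t ^ 2 + s ^ 2 * b t ^ 2) - s * (2 * b t * deriv b t) := fun t => by ring
  simp only [e]
  have i4 : Integrable fun t => deriv b t ^ 2 + s ^ 2 * b t ^ 2 := i1.add (i2.const_mul _)
  rw [integral_sub i4 (i3.const_mul s), integral_const_mul s, h3,
    integral_add i1 (i2.const_mul _), integral_const_mul]
  ring

variable {N : ℕ} [NeZero N]

lemma tsupport_separated_subset {Ω : Set (UnitSphere N)} {ρ : ℝ} {a : ℝ → ℝ} {ψ : Euc N → ℝ}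
    {p q : ℝ} (hp : 0 < p) (hρp : ρ < p) (h0 : ∀ r ∉ Set.Icc p q, a r = 0)
    (hψ : IsSphereTest Ω ψ) :
    HasCompactSupport (separated a ψ) ∧ tsupport (separated a ψ) ⊆ coneLike Ω ρ := by
  set S := tsupport fun θ : UnitSphere N => ψ (θ : Euc N) with hS
  set K := (fun z : UnitSphere N × ℝ => z.2 • (z.1 : Euc N)) '' (S ×ˢ Set.Icc p q) with hK
  have hSc : IsCompact S := (isClosed_tsupport _).isCompact
  have hKc : IsCompact K := (hSc.prod isCompact_Icc).image (by fun_prop)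
  have hsub : tsupport (separated a ψ) ⊆ K := by
    refine closure_minimal (fun x hx => ?_) hKc.isClosed
    have hr : ‖x‖ ∈ Set.Icc p q := by
      by_contra h
      exact hx (by rw [separated, h0 _ h, zero_mul])
    have hx0 : 0 < ‖x‖ := hp.trans_le hr.1
    refine ⟨(dir x, ‖x‖), ⟨subset_tsupport _ fun h => hx ?_, hr⟩, norm_smul_dir x⟩
    rw [coe_dir (norm_pos_iff.1 hx0)] at h
    rw [separated, h, mul_zero]
  refine ⟨hKc.of_isClosed_subset (isClosed_tsupport _) hsub, hsub.trans ?_⟩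
  rintro _ ⟨z, ⟨hz1, hz2⟩, rfl⟩
  have hn := norm_smul_unitSphere (hp.le.trans hz2.1) z.1
  exact ⟨by simpa only [hn] using hρp.trans_le hz2.1, z.1, hψ.2 hz1, by simp only [hn]⟩

/-- Above the critical value there is no positive super-solution: the energy inequality fails for
products of a radial function which is almost optimal for Hardy's inequality, supported far from the
origin, and an angular function which is almost optimal for the Rayleigh quotient. -/
lemma le_of_isPositiveSuperSolution {A B C ρ : ℝ} (hρ : 0 < ρ) {Ω : Set (UnitSphere N)}
    (hΩ : IsOpen Ω) (hne : Ω.Nonempty) {u : Euc N → ℝ}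
    (hu : IsPositiveSuperSolution A B C (coneLike Ω ρ) u) :
    B + C ≤ hardyConstant N A + rayleighInf Ω := by
  by_contra! hlt
  have hH0 : 0 ≤ hardyConstant N A := by unfold hardyConstant; positivity
  have hlam := rayleighInf_nonneg Ω
  set ε := (B + C - (hardyConstant N A + rayleighInf Ω)) / 2 with hε
  have hε0 : 0 < ε := by rw [hε]; linarith
  obtain ⟨ψ₀, h₀, hn₀⟩ := exists_sphereTest_norm_eq_one hΩ hne
  obtain ⟨_, ⟨ψ, hψ, hn, rfl⟩, hE⟩ := exists_lt_of_csInf_lt (⟨_, ψ₀, h₀, hn₀, rfl⟩ :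
    {q | ∃ (ψ : Euc N → ℝ) (h : IsSphereTest Ω ψ),
      ‖restrictLp ψ h.1‖ = 1 ∧ q = ‖tangentialLp ψ h.1‖ ^ 2}.Nonempty)
    (show rayleighInf Ω < rayleighInf Ω + ε by linarith)
  have hn2 := norm_restrictLp_sq hψ.1
  rw [hn, one_pow] at hn2
  rw [norm_tangentialLp_sq] at hE
  set E := ∫ θ, ‖tangentialGradient ψ θ‖ ^ 2 ∂(surfaceMeasure N)
  obtain ⟨b, p, q, hb, hp, hb0, hI, hDb⟩ := exists_slowly_varying (Real.log ρ) hε0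
  set s := ((N : ℝ) - 2 + A) / 2 with hs
  set a := logProfile s b with ha
  have ha0 : ∀ r ∉ Set.Icc (Real.exp p) (Real.exp q), a r = 0 := fun r hr =>
    logProfile_eq_zero hb0 hr
  have has : ContDiff ℝ ∞ a := contDiff_logProfile hb hb0
  have hep := Real.exp_pos p
  have hρp : ρ < Real.exp p := (Real.log_lt_iff_lt_exp hρ).1 hp
  obtain ⟨hsc, hsub⟩ := tsupport_separated_subset hep hρp ha0 hψ
  have henergy := hu.energy_le (isOpen_coneLike hΩ hρ.le)
    (fun x hx => norm_pos_iff.1 (hρ.trans hx.1)) (by linarith)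
    (contDiff_separated has (eventually_eq_zero_of_Icc hep ha0) hψ.1) hsc hsub
  rw [integral_separated_sq hep has ha0 hψ.1 (w := fun r => r ^ (A - 2)) (by fun_prop),
    integral_gradient_separated_sq hep has ha0 hψ.1 (w := fun r => r ^ A) (by fun_prop)
      (fun r hr => (Real.continuousAt_rpow_const r A (Or.inl (ne_of_gt hr))).continuousWithinAt),
    ← hn2, one_mul, one_mul] at henergy
  -- all the powers of `r` combine to `1 / r`
  have hpow : ∀ r : ℝ, 0 < r → r ^ (N - 1) * ((r ^ (-s)) ^ 2 * r ^ (A - 2)) = r⁻¹ := fun r hr => by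
    have hN1 : 1 ≤ N := NeZero.one_le
    rw [← Real.rpow_natCast, ← Real.rpow_natCast (r ^ (-s)), ← Real.rpow_mul hr.le,
      ← Real.rpow_add hr, ← Real.rpow_add hr, ← Real.rpow_neg_one, Nat.cast_sub hN1, hs]
    congr 1
    push_cast
    ring
  have hpow2 : ∀ r : ℝ, 0 < r → (r⁻¹) ^ 2 * r ^ A = r ^ (A - 2) := fun r hr => by
    rw [Real.rpow_sub hr, inv_pow, inv_mul_eq_div]
    norm_num
  have J₁ : ∫ r in Set.Ioi 0, r ^ (N - 1) * (a r ^ 2 * r ^ (A - 2)) = ∫ t, b t ^ 2 := by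
    rw [← integral_inv_mul_comp_log fun t => b t ^ 2]
    refine setIntegral_congr_fun measurableSet_Ioi fun r hr => ?_
    rw [ha, logProfile_of_pos hr, ← hpow r hr]
    ring
  have J₂ : ∫ r in Set.Ioi 0, r ^ (N - 1) * (deriv a r ^ 2 * r ^ A) =
      ∫ t, (deriv b t - s * b t) ^ 2 := by
    rw [← integral_inv_mul_comp_log fun t => (deriv b t - s * b t) ^ 2]
    refine setIntegral_congr_fun measurableSet_Ioi fun r hr => ?_
    rw [ha, deriv_logProfile hb hr]
    calc _ = r ^ (N - 1) * ((r ^ (-s)) ^ 2 * ((r⁻¹) ^ 2 * r ^ A)) *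
          (deriv b (Real.log r) - s * b (Real.log r)) ^ 2 := by ring
      _ = _ := by rw [hpow2 r hr, hpow r hr]
  have J₃ : ∫ r in Set.Ioi 0, r ^ (N - 1) * ((a r / r) ^ 2 * r ^ A) = ∫ t, b t ^ 2 := by
    rw [← J₁]
    refine setIntegral_congr_fun measurableSet_Ioi fun r hr => ?_
    rw [← hpow2 r hr]
    ring
  rw [J₁, J₂, J₃, integral_deriv_sub_mul_sq hb hb0] at henergy
  have hs2 : s ^ 2 = hardyConstant N A := by rw [hs, hardyConstant]; ring
  rw [hs2] at henergy
  have h1 : E * ∫ t, b t ^ 2 < (rayleighInf Ω + ε) * ∫ t, b t ^ 2 :=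
    mul_lt_mul_of_pos_right hE hI
  have h2 : (B + C) * ∫ t, b t ^ 2 =
      (hardyConstant N A + rayleighInf Ω + 2 * ε) * ∫ t, b t ^ 2 := by
    congr 1
    rw [hε]
    ring
  linarith

end Optimality

end

theorem theorem1p1 (N : ℕ) (hN : 2 ≤ N) (A B C ρ : ℝ) (hC : 0 < C) (hρ : 0 < ρ)
    (Ω : Set (UnitSphere N)) (hΩ_open : IsOpen Ω) (hΩ_conn : IsConnected Ω) :
    (¬ ∃ u : Euc N → ℝ, IsPositiveSuperSolution A B C (coneLike Ω ρ) u) ↔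
      B + C > hardyConstant N A + principalDirichletEigenvalue Ω := by
  have : NeZero N := ⟨by omega⟩
  rw [principalDirichletEigenvalue_eq hΩ_open hΩ_conn.nonempty, gt_iff_lt, ← not_le]
  exact not_congr ⟨fun ⟨_, hu⟩ => le_of_isPositiveSuperSolution hρ hΩ_open hΩ_conn.nonempty hu,
    exists_positive_superSolution hN hρ.le hΩ_open hΩ_conn⟩
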